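/- Let $K$ be a field of characteristic $0$ (for example $\mathbb{C}$ or a field of rational functions), let $q,t,u\in K$ be non-zero and let $(t/q)^{1/2}\in K$ be a fixed square root of $t/q$, with inverse $(q/t)^{1/2}$. Let $\mathcal F$ be the algebra of supersymmetric polynomials in infinitely many variables, freely generated over $K$ by the commuting power sums $p_k$ and the anticommuting power sums $\pi_k$ ($k\ge 1$); the $p_k,\pi_k$ act on $\mathcal F$ by left multiplication, $\partial/\partial p_k$ is the usual derivative and $\partial/\partial \pi_k$ is the left derivative. Define the vertex operators $$V_B^{(-)}(w)=\exp\Big(\sum_{k\ge1}\tfrac{1-t^{-k}}{k}p_kw^{2k}\Big),\qquad V_B^{(+)}(w)=\exp\Big(\sum_{k\ge1}(q^k-1)\tfrac{\partial}{\partial p_k}w^{-2k}\Big),$$ $$V_F^{(-)}(w)=\exp\Big((1-t^{-1})\sum_{k\ge1}t^{1-k}w^{2k-1}\pi_k\sum_{m=0}^{k-1}t^m\psi_m\Big),\qquad V_F^{(+)}(w)=\exp\Big((q-1)\sum_{k\ge1}q^{k-1}w^{-2k+1}\Big(\sum_{m=0}^{k-1}q^{-m}\psi_m^\dagger\Big)\tfrac{\partial}{\partial\pi_k}\Big),$$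 $$\widetilde V_F^{(-)}(w)=\exp\Big((1-t^{-1})\sum_{k\ge2}t^{2-k}w^{2k-1}\pi_k\sum_{m=0}^{k-2}t^m\psi_m\Big),\qquad \widetilde V_F^{(+)}(w)=\exp\Big((q-1)\sum_{k\ge2}q^{k-2}w^{-2k+1}\Big(\sum_{m=0}^{k-2}q^{-m}\psi_m^\dagger\Big)\tfrac{\partial}{\partial\pi_k}\Big).$$ Here $\psi_m,\psi_m^\dagger$ ($m\ge0$) are auxiliary charged fermions with $\{\psi_m,\psi_n^\dagger\}=\delta_{mn}$ and all other anticommutators among them zero, which anticommute with all $\pi_k$ and $\partial/\partial\pi_k$. The vacuum satisfies $\psi_m|\varnothing\rangle=0$, $\langle\varnothing|\psi_m^\dagger=0$ and $\langle\varnothing|\varnothing\rangle=1$. The expectation value $\langle\varnothing|\cdots|\varnothing\rangle_F$ is taken in these auxiliary fermions only, and $\oint\frac{dw}{w}$ denotes extraction of the coefficient of $w^0$. Write $$\langle V_F(w)\rangle=\langle\varnothing|V_F^{(-)}(w)V_F^{(+)}(w)|\varnothing\rangle_F,\qquad \langle \widetilde V_F(w)\rangle=\langle\varnothing|\widetilde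 V_F^{(-)}(w)\widetilde V_F^{(+)}(w)|\varnothing\rangle_F .$$ Define operators $\widetilde c_k[\partial/\partial p]$ by $\sum_{k\ge0}\widetilde c_k[\partial/\partial p]z^{-k}=\exp\big(\sum_{n\ge1}(q^{-n}-1)\frac{\partial}{\partial p_n}z^{-n}\big)$. Define the operators $E_{1,0},F_{2,-1},E_{2,1},F_{1,2}$ on $\mathcal F$ by $$E_{1,0}=\pi_1,\qquad F_{2,-1}=-\sum_{k\ge1}\pi_k\,\widetilde c_k[\partial/\partial p],$$ $$u^{-1}(q/t)^{1/2}E_{2,1}=-\sum_{k\ge1}\oint\frac{dw}{w}w^{-2k}V_B^{(-)}(w)V_B^{(+)}(w)\langle\widetilde V_F(w)\rangle\,q^k\frac{\partial}{\partial\pi_k},$$ $$u^{-1}F_{1,2}=\sum_{k\ge1}\oint\frac{dw}{w}w^{-2k+2}V_B^{(-)}(w)V_B^{(+)}(w)\langle\widetilde V_F(w)\rangle\,q^{k-1}\frac{\partial}{\partial\pi_k},$$ and the Hamiltonians $H_{1,+1},H_{2,+1}$ by $$u^{-1}H_{1,+1}=\oint\frac{dw}{w}V_B^{(-)}(w)V_B^{(+)}(w)\langle\widetilde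 V_F(w)\rangle,\qquad -u^{-1}(q/t)^{1/2}H_{2,+1}=\oint\frac{dw}{w}V_B^{(-)}(w)V_B^{(+)}(w)\langle V_F(w)\rangle.$$ Then all these infinite sums of operators are locally finite (only finitely many terms are non-zero on any given element of $\mathcal F$), so that the operators are well defined, and the anticommutators $[X,Y]_+=XY+YX$ satisfy $$[E_{2,1},F_{2,-1}]_+=(t/q)^{1/2}u\big(1+u^{-1}(q/t)^{1/2}H_{2,+1}\big),\qquad [E_{1,0},F_{1,2}]_+=H_{1,+1}.$$ -/

import Mathlib

open scoped TensorProduct Nat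

noncomputable section

namespace SuperMacdonald

/-! ### Formal series with operator coefficients -/

/-- The formal series `∑_{k ≥ 1} f k * z ^ (e k)` (used with injective exponents `e` only). -/
def series {A : Type*} [Semiring A] (e : ℕ+ → ℕ) (f : ℕ+ → A) : PowerSeries A :=
  PowerSeries.mk fun n => ∑ᶠ (k : ℕ+) (_ : e k = n), f k

/-- The formal exponential `exp g = ∑_j g ^ j / j!` of a power series `g` without constant term and
with coefficients in a (possibly noncommutative) `K`-algebra: the coefficient of `z ^ n` only
receives contributions from `j ≤ n`. -/
def fexp (K : Type*) [Field K] {A : Type*} [Ring A] [Algebra K A] (g : PowerSeries A) :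
    PowerSeries A :=
  PowerSeries.mk fun n =>
    ∑ j ∈ Finset.range (n + 1), ((j ! : K)⁻¹) • PowerSeries.coeff n (g ^ j)

/-! ### Locally finite sums of operators -/

/-- A family of operators is locally finite if every vector is killed by all but finitely many
members. -/
def LocFinite {K V ι : Type*} [Field K] [AddCommGroup V] [Module K V]
    (f : ι → Module.End K V) : Prop :=
  ∀ v : V, (Function.support fun i => f i v).Finite

open Classical in
/-- The sum of a locally finite family of operators, computed vector by vector
(zero by convention if the family is not locally finite). -/
def locSum {K V ι : Type*} [Field K] [AddCommGroup V] [Module K V]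
    (f : ι → Module.End K V) : Module.End K V :=
  if h : LocFinite f then
    { toFun := fun v => ∑ᶠ i, f i v
      map_add' := fun v w => by
        simp only [map_add]
        exact finsum_add_distrib (h v) (h w)
      map_smul' := fun c v => by
        simp only [map_smul, RingHom.id_apply]
        exact (smul_finsum' c (h v)).symm }
  else 0

/-! ### Fermions -/

/-- The Grassmann algebra on anticommuting generators indexed by `ι`. -/
abbrev Grass (K : Type*) [Field K] (ι : Type*) : Type _ := ExteriorAlgebra K (ι →₀ K)

/-- Left multiplication by the `i`-th Grassmann generator. -/
def create (K : Type*) [Field K] {ι : Type*} (i : ι) : Module.End K (Grass K ι) :=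
  LinearMap.mulLeft K (ExteriorAlgebra.ι K (Finsupp.single i 1))

/-- The left derivative with respect to the `i`-th Grassmann generator. -/
def annih (K : Type*) [Field K] {ι : Type*} (i : ι) : Module.End K (Grass K ι) :=
  CliffordAlgebra.contractLeft (Finsupp.lapply i : (ι →₀ K) →ₗ[K] K)

/-- The Grassmann algebra on the `π_k` (`k ≥ 1`, left summand) and the auxiliary fermions `ψ_m†`
(`m ≥ 0`, right summand): the space of polynomials in the `π_k` together with the Fock space of the
charged fermions `ψ_m`, `ψ_m†`. All of `π_k`, `∂/∂π_k` anticommute with all of `ψ_m`, `ψ_m†`. -/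
abbrev Ext (K : Type*) [Field K] : Type _ := Grass K (ℕ+ ⊕ ℕ)

/-- `π_k` on the extended space. -/
def piE (K : Type*) [Field K] (k : ℕ+) : Module.End K (Ext K) := create K (Sum.inl k)

/-- `∂/∂π_k` on the extended space. -/
def dpiE (K : Type*) [Field K] (k : ℕ+) : Module.End K (Ext K) := annih K (Sum.inl k)

/-- `ψ_m†`. -/
def psiDag (K : Type*) [Field K] (m : ℕ) : Module.End K (Ext K) := create K (Sum.inr m)

/-- `ψ_m`; it satisfies `{ψ_m, ψ_n†} = δ_{mn}` and kills the vacuum. -/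
def psi (K : Type*) [Field K] (m : ℕ) : Module.End K (Ext K) := annih K (Sum.inr m)

/-- `v ↦ v ⊗ |∅⟩`. -/
def vacIn (K : Type*) [Field K] : Grass K ℕ+ →ₗ[K] Ext K :=
  (ExteriorAlgebra.map (Finsupp.lmapDomain K K (Sum.inl : ℕ+ → ℕ+ ⊕ ℕ))).toLinearMap

/-- The pairing with `⟨∅|`: it sets all `ψ_m†` to zero. -/
def vacOut (K : Type*) [Field K] : Ext K →ₗ[K] Grass K ℕ+ :=
  (ExteriorAlgebra.map (Finsupp.lcomapDomain (Sum.inl : ℕ+ → ℕ+ ⊕ ℕ)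
    Sum.inl_injective : (ℕ+ ⊕ ℕ →₀ K) →ₗ[K] (ℕ+ →₀ K))).toLinearMap

/-- The vacuum expectation value `⟨∅| X |∅⟩` with respect to the `ψ_m`, `ψ_m†`; it is an operator
on polynomials in the `π_k`. -/
def vev {K : Type*} [Field K] (X : Module.End K (Ext K)) : Module.End K (Grass K ℕ+) :=
  vacOut K ∘ₗ X ∘ₗ vacIn K

/-! ### The space of supersymmetric polynomials in infinitely many variables -/

/-- Polynomials in the power sums `p_k`, `k ≥ 1`. -/
abbrev Bos (K : Type*) [Field K] : Type _ := MvPolynomial ℕ+ K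

/-- The algebra of supersymmetric polynomials, freely generated by the commuting `p_k` and the
anticommuting `π_k`, `k ≥ 1`. -/
abbrev Fock (K : Type*) [Field K] : Type _ := Bos K ⊗[K] Grass K ℕ+

/-- Multiplication by `p_k`. -/
def pB (K : Type*) [Field K] (k : ℕ+) : Module.End K (Bos K) :=
  LinearMap.mulLeft K (MvPolynomial.X k)

/-- `∂/∂p_k`. -/
def dpB (K : Type*) [Field K] (k : ℕ+) : Module.End K (Bos K) :=
  (MvPolynomial.pderiv k).toLinearMap

/-- A bosonic operator acting on the full space. -/
def liftB {K : Type*} [Field K] (X : Module.End K (Bos K)) : Module.End K (Fock K) :=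
  LinearMap.rTensor (Grass K ℕ+) X

/-- A fermionic operator acting on the full space. -/
def liftF {K : Type*} [Field K] (X : Module.End K (Grass K ℕ+)) : Module.End K (Fock K) :=
  LinearMap.lTensor (Bos K) X

/-- `π_k` on the space of supersymmetric polynomials. -/
def piOp (K : Type*) [Field K] (k : ℕ+) : Module.End K (Fock K) := liftF (create K k)

/-- `∂/∂π_k` on the space of supersymmetric polynomials. -/
def dpiOp (K : Type*) [Field K] (k : ℕ+) : Module.End K (Fock K) := liftF (annih K k)

/-! ### Vertex operators -/

/-- `V_B^{(-)}(w) = exp (∑_{k ≥ 1} (1 - t^{-k}) / k * p_k w^{2k})`, a series in `w`. -/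
def VBminus {K : Type*} [Field K] (t : K) : PowerSeries (Module.End K (Bos K)) :=
  fexp K (series (fun k => 2 * (k : ℕ))
    fun k => ((1 - t⁻¹ ^ (k : ℕ)) / ((k : ℕ) : K)) • pB K k)

/-- `V_B^{(+)}(w) = exp (∑_{k ≥ 1} (q^k - 1) ∂/∂p_k w^{-2k})`, a series in `w⁻¹`. -/
def VBplus {K : Type*} [Field K] (q : K) : PowerSeries (Module.End K (Bos K)) :=
  fexp K (series (fun k => 2 * (k : ℕ)) fun k => (q ^ (k : ℕ) - 1) • dpB K k)

/-- `V_F^{(-)}(w) = exp ((1 - t⁻¹) ∑_{k ≥ 1} t^{1-k} w^{2k-1} π_k ∑_{m=0}^{k-1} t^m ψ_m)`,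
a series in `w`. -/
def VFminus {K : Type*} [Field K] (t : K) : PowerSeries (Module.End K (Ext K)) :=
  fexp K (series (fun k => 2 * (k : ℕ) - 1) fun k =>
    ((1 - t⁻¹) * t ^ (1 - (k : ℤ))) •
      (piE K k * ∑ m ∈ Finset.range (k : ℕ), t ^ m • psi K m))

/-- `V_F^{(+)}(w) = exp ((q - 1) ∑_{k ≥ 1} q^{k-1} w^{-2k+1} (∑_{m=0}^{k-1} q^{-m} ψ_m†) ∂/∂π_k)`,
a series in `w⁻¹`. -/
def VFplus {K : Type*} [Field K] (q : K) : PowerSeries (Module.End K (Ext K)) :=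
  fexp K (series (fun k => 2 * (k : ℕ) - 1) fun k =>
    ((q - 1) * q ^ ((k : ℤ) - 1)) •
      ((∑ m ∈ Finset.range (k : ℕ), q⁻¹ ^ m • psiDag K m) * dpiE K k))

/-- `Ṽ_F^{(-)}(w) = exp ((1 - t⁻¹) ∑_{k ≥ 2} t^{2-k} w^{2k-1} π_k ∑_{m=0}^{k-2} t^m ψ_m)`,
a series in `w`. The term `k = 1` below has an empty inner sum. -/
def VFtildeMinus {K : Type*} [Field K] (t : K) : PowerSeries (Module.End K (Ext K)) :=
  fexp K (series (fun k => 2 * (k : ℕ) - 1) fun k =>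
    ((1 - t⁻¹) * t ^ (2 - (k : ℤ))) •
      (piE K k * ∑ m ∈ Finset.range ((k : ℕ) - 1), t ^ m • psi K m))

/-- `Ṽ_F^{(+)}(w) = exp ((q - 1) ∑_{k ≥ 2} q^{k-2} w^{-2k+1} (∑_{m=0}^{k-2} q^{-m} ψ_m†) ∂/∂π_k)`,
a series in `w⁻¹`. The term `k = 1` below has an empty inner sum. -/
def VFtildePlus {K : Type*} [Field K] (q : K) : PowerSeries (Module.End K (Ext K)) :=
  fexp K (series (fun k => 2 * (k : ℕ) - 1) fun k =>
    ((q - 1) * q ^ ((k : ℤ) - 2)) •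
      ((∑ m ∈ Finset.range ((k : ℕ) - 1), q⁻¹ ^ m • psiDag K m) * dpiE K k))

/-- The terms of `∮ dw/w w^r V_B^{(-)}(w) V_B^{(+)}(w) ⟨∅| M(w) P(w) |∅⟩`, where `M` is a series in
`w` and `P` a series in `w⁻¹`. The index `(a, b, c, d)` selects the coefficients of
`w^a`, `w^{-b}`, `w^c`, `w^{-d}` in the four factors, and `∮ dw/w` selects the total power `w^0`. -/
def contourTerm {K : Type*} [Field K] (q t : K) (M P : PowerSeries (Module.End K (Ext K))) (r : ℤ) :
    ℕ × ℕ × ℕ × ℕ → Module.End K (Fock K) := fun x =>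
  if r + x.1 - x.2.1 + x.2.2.1 - x.2.2.2 = 0 then
    liftB (PowerSeries.coeff x.1 (VBminus t) * PowerSeries.coeff x.2.1 (VBplus q)) *
      liftF (vev (PowerSeries.coeff x.2.2.1 M * PowerSeries.coeff x.2.2.2 P))
  else 0

/-- `∮ dw/w w^r V_B^{(-)}(w) V_B^{(+)}(w) ⟨∅| M(w) P(w) |∅⟩`. -/
def contour {K : Type*} [Field K] (q t : K) (M P : PowerSeries (Module.End K (Ext K))) (r : ℤ) :
    Module.End K (Fock K) :=
  locSum (contourTerm q t M P r)

/-! ### Super charges and Hamiltonians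

Here `s` stands for `(t/q)^{1/2}`. -/

/-- The operator `c̃_k[∂/∂p]`: the coefficient of `z^{-k}` in
`exp (∑_{n ≥ 1} (q^{-n} - 1) ∂/∂p_n z^{-n})`. -/
def cTilde {K : Type*} [Field K] (q : K) (k : ℕ) : Module.End K (Bos K) :=
  PowerSeries.coeff k
    (fexp K (series (fun n => (n : ℕ)) fun n => (q⁻¹ ^ (n : ℕ) - 1) • dpB K n))

/-- `E_{1,0} = π_1`. -/
def E10 (K : Type*) [Field K] : Module.End K (Fock K) := piOp K 1

/-- The terms `π_k c̃_k[∂/∂p]` of `-F_{2,-1}`. -/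
def F2m1Term {K : Type*} [Field K] (q : K) (k : ℕ+) : Module.End K (Fock K) :=
  piOp K k * liftB (cTilde q k)

/-- `F_{2,-1} = -∑_{k ≥ 1} π_k c̃_k[∂/∂p]`. -/
def F2m1 {K : Type*} [Field K] (q : K) : Module.End K (Fock K) :=
  -locSum (F2m1Term q)

/-- The terms `∮ dw/w w^{-2k} V_B^{(-)} V_B^{(+)} ⟨Ṽ_F^{(-)} Ṽ_F^{(+)}⟩ q^k ∂/∂π_k`. -/
def E21Term {K : Type*} [Field K] (q t : K) (k : ℕ+) : Module.End K (Fock K) :=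
  q ^ (k : ℕ) • (contour q t (VFtildeMinus t) (VFtildePlus q) (-2 * (k : ℤ)) * dpiOp K k)

/-- `E_{2,1}`, determined by
`u⁻¹ (q/t)^{1/2} E_{2,1} = -∑_{k ≥ 1} ∮ dw/w w^{-2k} V_B V_B ⟨Ṽ_F Ṽ_F⟩ q^k ∂/∂π_k`. -/
def E21 {K : Type*} [Field K] (q t u s : K) : Module.End K (Fock K) :=
  (u * s) • -locSum (E21Term q t)

/-- The terms `∮ dw/w w^{-2k+2} V_B^{(-)} V_B^{(+)} ⟨Ṽ_F^{(-)} Ṽ_F^{(+)}⟩ q^{k-1} ∂/∂π_k`. -/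
def F12Term {K : Type*} [Field K] (q t : K) (k : ℕ+) : Module.End K (Fock K) :=
  q ^ ((k : ℕ) - 1) •
    (contour q t (VFtildeMinus t) (VFtildePlus q) (-2 * (k : ℤ) + 2) * dpiOp K k)

/-- `F_{1,2}`, determined by
`u⁻¹ F_{1,2} = ∑_{k ≥ 1} ∮ dw/w w^{-2k+2} V_B V_B ⟨Ṽ_F Ṽ_F⟩ q^{k-1} ∂/∂π_k`. -/
def F12 {K : Type*} [Field K] (q t u : K) : Module.End K (Fock K) :=
  u • locSum (F12Term q t)

/-- `H_{1,+1}`, determined by `u⁻¹ H_{1,+1} = ∮ dw/w V_B V_B ⟨Ṽ_F Ṽ_F⟩`. -/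
def H11 {K : Type*} [Field K] (q t u : K) : Module.End K (Fock K) :=
  u • contour q t (VFtildeMinus t) (VFtildePlus q) 0

/-- `H_{2,+1}`, determined by `-u⁻¹ (q/t)^{1/2} H_{2,+1} = ∮ dw/w V_B V_B ⟨V_F V_F⟩`. -/
def H21 {K : Type*} [Field K] (q t u s : K) : Module.End K (Fock K) :=
  -((u * s) • contour q t (VFminus t) (VFplus q) 0)

/-- The anticommutator. -/
def acomm {A : Type*} [Ring A] (X Y : A) : A := X * Y + Y * X

end SuperMacdonald

end

noncomputable section

namespace SuperMacdonald

/-! ### Formal exponentials -/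

section Exponential

variable {K : Type*} [Field K]

/-! The vertex operators are, up to a central factor, algebra homomorphisms, so identities between
them only have to be checked on generators. The exponents of `VBplus` and of all four fermionic
exponentials are derivations (a product such as ψ†∂/∂π of two odd operators is an even derivation),
hence their exponentials are multiplicative (`isHasseSchmidt_fexp`). The maps |∅⟩ and ⟨∅| are
homomorphisms of Grassmann algebras, and V_B^{(-)} is multiplication by a central series. So T =
V_B⟨Ṽ_F⟩ is a central series times a homomorphism into Laurent series in w, the contour integrals
are coefficients of such fields (`contour_apply`), and T(π_a v) = P_a T(v) with P_a = w^{-2a} ∑_k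
A_{ak} π_k w^{2k}, where A is `tildeCoeff`.

Put D(v) = ∑_k q^k w^{-2k} T(∂v/∂π_k) (`dSum`). Up to scalars, E_{2,1} is the coefficient of w^0 in
D and F_{1,2} the coefficient of w^{-2}. The relation ∂_k π_a = δ_{ka} - π_a ∂_k gives D(π_a v) =
q^a w^{-2a} T(v) - P_a D(v) (`dSum_pi_mul`). For a = 1 one has P_1 = π_1, and the coefficient of
w^{-2} is the anticommutator with E_{1,0}.

The other anticommutator uses three facts about c(z) = ∑ c̃_k z^{-k}. (1) c(z) T(w) = g(w²/z) T(w)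
c(z), where g(x) = (1 - x/(qt))(1 - x)/((1 - x/q)(1 - x/t)) = ∑ g_m x^m (`coeffMap_vertex`). (2) At
z = w²/q the operator c(z) is inverse to V_B^{(+)}(w), so ∑_a q^a w^{-2a} T c̃_a = T⁻, the field
V_B^{(-)}⟨Ṽ_F⟩ (`sum_vertex_cF`). The same sum turns D into D⁻, built from T⁻ (`sum_dSum_cF`). (3)
The matrices involved differ by rank one: that of ⟨V_F⟩ is A_{ak} + q^a G_k (`fullCoeff_eq`), the
triangular Toeplitz matrix of g is A_{ak} + q^a S_k (`ite_structCoeff_eq`), and g_k = S_k - G_k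
(`structCoeff_eq`). Write G and S also for the odd series ∑ G_k π_k w^{2k} and ∑ S_k π_k w^{2k}. As
G² = 0, changing the images of the generators by the rank one term replaces T by T + G D
(`rank_one_update`), so V_B⟨V_F⟩ = T + G D.

Expanding with (1), (2) and (3), the P_a terms of the two orderings cancel, and the anticommutator,
with scalars and signs removed, is the coefficient of w^0 in (T⁻ + S D⁻) - (T + G D). The second
bracket is V_B⟨V_F⟩. In the first, π_a acts through ∑_{k≥a} g_{k-a} π_k w^{2(k-a)}, which has no
negative powers and constant term π_a; hence the bracket sends v to a power series with constant
term v (`exists_psL_minusField`). This is the summand 1 next to the Hamiltonian. -/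

theorem coeff_pow_of_lt {A : Type*} [Semiring A] {g : PowerSeries A}
    (hg : PowerSeries.coeff 0 g = 0) {n j : ℕ} (h : n < j) : PowerSeries.coeff n (g ^ j) = 0 := by
  induction j generalizing n with
  | zero => omega
  | succ j ih =>
    rw [pow_succ', PowerSeries.coeff_mul]
    refine Finset.sum_eq_zero fun p hp => ?_
    rw [Finset.HasAntidiagonal.mem_antidiagonal] at hp
    rcases Nat.eq_zero_or_pos p.1 with h0 | h0
    · rw [h0, hg, zero_mul]
    · rw [ih (by omega), mul_zero]

theorem coeff_pow_mul_pow_of_lt {A : Type*} [Semiring A] {a b : PowerSeries A}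
    (ha : PowerSeries.coeff 0 a = 0) (hb : PowerSeries.coeff 0 b = 0) {n i j : ℕ}
    (h : n < i + j) : PowerSeries.coeff n (a ^ i * b ^ j) = 0 := by
  rw [PowerSeries.coeff_mul]
  refine Finset.sum_eq_zero fun p hp => ?_
  rw [Finset.HasAntidiagonal.mem_antidiagonal] at hp
  rcases lt_or_ge p.1 i with h0 | h0
  · rw [coeff_pow_of_lt ha h0, zero_mul]
  · rw [coeff_pow_of_lt hb (by omega), mul_zero]

theorem coeff_fexp {A : Type*} [Ring A] [Algebra K A] (g : PowerSeries A) (n : ℕ) :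
    PowerSeries.coeff n (fexp K g) =
      ∑ j ∈ Finset.range (n + 1), ((j ! : K)⁻¹) • PowerSeries.coeff n (g ^ j) := by
  simp [fexp]

theorem coeff_fexp_of_le {A : Type*} [Ring A] [Algebra K A] {g : PowerSeries A}
    (hg : PowerSeries.coeff 0 g = 0) {n N : ℕ} (h : n ≤ N) :
    PowerSeries.coeff n (fexp K g) =
      ∑ j ∈ Finset.range (N + 1), ((j ! : K)⁻¹) • PowerSeries.coeff n (g ^ j) := by
  rw [coeff_fexp]
  refine Finset.sum_subset (by simpa using h) fun j _ hj => ?_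
  rw [coeff_pow_of_lt hg (by simpa using hj), smul_zero]

theorem coeff_zero_fexp {A : Type*} [Ring A] [Algebra K A] (g : PowerSeries A) :
    PowerSeries.coeff 0 (fexp K g) = 1 := by
  simp [coeff_fexp]

/-- Without constant terms, a^i b^j only reaches degrees at least i + j, so the square of index
pairs in the Cauchy product can be cut down to the triangle given by the binomial theorem. -/
theorem fexp_add [CharZero K] {A : Type*} [Ring A] [Algebra K A] {a b : PowerSeries A}
    (hab : Commute a b) (ha : PowerSeries.coeff 0 a = 0) (hb : PowerSeries.coeff 0 b = 0) :
    fexp K (a + b) = fexp K a * fexp K b := by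
  ext n
  have h1 : PowerSeries.coeff n (fexp K (a + b)) =
      ∑ m ∈ Finset.range (n + 1), ∑ p ∈ Finset.HasAntidiagonal.antidiagonal m,
        ((p.1 ! : K)⁻¹ * (p.2 ! : K)⁻¹) • PowerSeries.coeff n (a ^ p.1 * b ^ p.2) := by
    rw [coeff_fexp]
    refine Finset.sum_congr rfl fun m _ => ?_
    rw [hab.add_pow', map_sum, Finset.smul_sum]
    refine Finset.sum_congr rfl fun p hp => ?_
    rw [Finset.HasAntidiagonal.mem_antidiagonal] at hp
    rw [map_nsmul, ← Nat.cast_smul_eq_nsmul K, smul_smul, ← hp, Nat.choose_symm_add, Nat.add_choose,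
      Nat.cast_div (Nat.factorial_mul_factorial_dvd_factorial_add _ _)
        (by exact_mod_cast (Nat.mul_ne_zero (Nat.factorial_ne_zero _) (Nat.factorial_ne_zero _)))]
    congr 1
    have h1 : ((p.1 + p.2)! : K) ≠ 0 := by exact_mod_cast Nat.factorial_ne_zero _
    have h2 : (p.1 ! : K) ≠ 0 := by exact_mod_cast Nat.factorial_ne_zero _
    have h3 : (p.2 ! : K) ≠ 0 := by exact_mod_cast Nat.factorial_ne_zero _
    push_cast
    field_simp
  have h2 : PowerSeries.coeff n (fexp K a * fexp K b) =
      ∑ p ∈ Finset.range (n + 1) ×ˢ Finset.range (n + 1),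
        ((p.1 ! : K)⁻¹ * (p.2 ! : K)⁻¹) • PowerSeries.coeff n (a ^ p.1 * b ^ p.2) := by
    rw [PowerSeries.coeff_mul]
    have : ∀ r ∈ Finset.HasAntidiagonal.antidiagonal n,
        PowerSeries.coeff r.1 (fexp K a) * PowerSeries.coeff r.2 (fexp K b) =
        ∑ p ∈ Finset.range (n + 1) ×ˢ Finset.range (n + 1),
          ((p.1 ! : K)⁻¹ * (p.2 ! : K)⁻¹) •
            (PowerSeries.coeff r.1 (a ^ p.1) * PowerSeries.coeff r.2 (b ^ p.2)) := by
      intro r hr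
      rw [Finset.HasAntidiagonal.mem_antidiagonal] at hr
      rw [coeff_fexp_of_le ha (N := n) (by omega), coeff_fexp_of_le hb (N := n) (by omega),
        Finset.sum_mul_sum, Finset.sum_product]
      simp only [smul_mul_smul_comm]
    rw [Finset.sum_congr rfl this, Finset.sum_comm]
    simp only [PowerSeries.coeff_mul, Finset.smul_sum]
  rw [h1, h2]
  rw [← Finset.sum_subset (s₁ := (Finset.range (n + 1) ×ˢ Finset.range (n + 1)).filter
    fun p : ℕ × ℕ => p.1 + p.2 ∈ Finset.range (n + 1)) (Finset.filter_subset _ _)]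
  · rw [← Finset.sum_fiberwise_of_maps_to (t := Finset.range (n + 1)) (g := fun p : ℕ × ℕ => p.1 + p.2)]
    · refine Finset.sum_congr rfl fun m hm => Finset.sum_congr ?_ fun _ _ => rfl
      ext p
      simp only [Finset.HasAntidiagonal.mem_antidiagonal, Finset.mem_filter, Finset.mem_product,
        Finset.mem_range] at hm ⊢
      omega
    · intro p hp
      exact (Finset.mem_filter.1 hp).2
  · intro p hp hp'
    rw [Finset.mem_filter, not_and] at hp'
    have := hp' hp
    rw [Finset.mem_range] at this
    rw [coeff_pow_mul_pow_of_lt ha hb (by omega), smul_zero]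

theorem map_fexp {A B : Type*} [Ring A] [Algebra K A] [Ring B] [Algebra K B] (f : A →ₐ[K] B)
    (g : PowerSeries A) :
    PowerSeries.map (f : A →+* B) (fexp K g) = fexp K (PowerSeries.map (f : A →+* B) g) := by
  ext n
  rw [PowerSeries.coeff_map, coeff_fexp, coeff_fexp, map_sum]
  refine Finset.sum_congr rfl fun j _ => ?_
  rw [← map_pow, PowerSeries.coeff_map]
  exact map_smul f _ _

/-- Intertwining passes to powers and then to exponentials. It is needed for the multiplication map
B ⊗ B → B. -/
theorem fexp_intertwine {V W : Type*} [AddCommGroup V] [Module K V] [AddCommGroup W] [Module K W]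
    (μ : V →ₗ[K] W) {g : PowerSeries (Module.End K V)} {g' : PowerSeries (Module.End K W)}
    (h : ∀ n v, μ (PowerSeries.coeff n g v) = PowerSeries.coeff n g' (μ v)) (n : ℕ) (v : V) :
    μ (PowerSeries.coeff n (fexp K g) v) = PowerSeries.coeff n (fexp K g') (μ v) := by
  have key : ∀ (j n : ℕ) (v : V), μ ((PowerSeries.coeff n (g ^ j) : Module.End K V) v) =
      (PowerSeries.coeff n (g' ^ j) : Module.End K W) (μ v) := by
    intro j
    induction j with
    | zero =>
      intro n v
      rw [pow_zero, pow_zero, PowerSeries.coeff_one, PowerSeries.coeff_one]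
      split_ifs <;> simp
    | succ j ih =>
      intro n v
      rw [pow_succ, pow_succ, PowerSeries.coeff_mul, PowerSeries.coeff_mul]
      simp only [LinearMap.sum_apply, map_sum, Module.End.mul_apply, ih, h]
  rw [coeff_fexp, coeff_fexp]
  simp only [LinearMap.sum_apply, map_sum, LinearMap.smul_apply, map_smul, key]

/-! ### Exponentials of derivations -/

/-- A sequence of operators on an algebra whose generating series is multiplicative. -/
structure IsHasseSchmidt {B : Type*} [Ring B] [Algebra K B] (F : ℕ → Module.End K B) : Prop where
  map_one : ∀ n, F n 1 = if n = 0 then 1 else 0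
  map_mul : ∀ n x y, F n (x * y) = ∑ p ∈ Finset.HasAntidiagonal.antidiagonal n, F p.1 x * F p.2 y

/-- The operators on an algebra that satisfy the Leibniz rule. -/
def derivations (K : Type*) [Field K] (B : Type*) [Ring B] [Algebra K B] :
    Submodule K (Module.End K B) where
  carrier := {D | ∀ x y, D (x * y) = D x * y + x * D y}
  zero_mem' := by simp
  add_mem' := by
    intro D E hD hE x y
    simp only [LinearMap.add_apply, hD x y, hE x y, add_mul, mul_add]
    abel
  smul_mem' := by
    intro c D hD x y
    simp only [LinearMap.smul_apply, hD x y, smul_add, smul_mul_assoc, mul_smul_comm]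

theorem apply_one_of_mem_derivations {B : Type*} [Ring B] [Algebra K B] {D : Module.End K B}
    (hD : D ∈ derivations K B) : D 1 = 0 := by
  have := hD 1 1
  simpa using this

/-- The exponential stops after its linear term on v. Every exponential below has this property on
the generators, which makes its values there explicit. -/
theorem coeff_fexp_apply_of_sq {V : Type*} [AddCommGroup V] [Module K V]
    {g : PowerSeries (Module.End K V)} (hg : PowerSeries.coeff 0 g = 0) {v : V}
    (hv : ∀ a b, PowerSeries.coeff a g (PowerSeries.coeff b g v) = 0) (n : ℕ) :
    PowerSeries.coeff n (fexp K g) v = (if n = 0 then v else 0) + PowerSeries.coeff n g v := by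
  have h2 : ∀ j n : ℕ, (PowerSeries.coeff n (g ^ (j + 2)) : Module.End K V) v = 0 := by
    intro j n
    rw [pow_add, pow_two, PowerSeries.coeff_mul, LinearMap.sum_apply]
    refine Finset.sum_eq_zero fun p _ => ?_
    rw [PowerSeries.coeff_mul, Module.End.mul_apply, LinearMap.sum_apply]
    simp [hv]
  rw [coeff_fexp_of_le hg (N := n + 1) (by omega), LinearMap.sum_apply, Finset.sum_range_succ',
    Finset.sum_range_succ', Finset.sum_eq_zero]
  · simp only [zero_add, Nat.factorial_zero, Nat.factorial_one, Nat.cast_one, inv_one, one_smul,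
      pow_one, pow_zero, PowerSeries.coeff_one]
    rw [add_comm]
    split_ifs <;> simp
  · intro j _
    rw [add_assoc, LinearMap.smul_apply, h2, smul_zero]

/-- The Leibniz rule says that multiplication B ⊗ B → B intertwines D ⊗ 1 + 1 ⊗ D with D. The two
summands commute, so the exponential of the sum is the product of exp(D) ⊗ 1 and 1 ⊗ exp(D). -/
theorem coeff_fexp_apply_mul [CharZero K] {B : Type*} [Ring B] [Algebra K B]
    {g : PowerSeries (Module.End K B)} (hg : PowerSeries.coeff 0 g = 0)
    (hD : ∀ n, PowerSeries.coeff n g ∈ derivations K B) (n : ℕ) (x y : B) :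
    PowerSeries.coeff n (fexp K g) (x * y) = ∑ p ∈ Finset.HasAntidiagonal.antidiagonal n,
      PowerSeries.coeff p.1 (fexp K g) x * PowerSeries.coeff p.2 (fexp K g) y := by
  let r : Module.End K B →ₐ[K] Module.End K (B ⊗[K] B) := Module.End.rTensorAlgHom K B B
  let l : Module.End K B →ₐ[K] Module.End K (B ⊗[K] B) := Module.End.lTensorAlgHom K B B
  let a := PowerSeries.map (r : Module.End K B →+* Module.End K (B ⊗[K] B)) g
  let b := PowerSeries.map (l : Module.End K B →+* Module.End K (B ⊗[K] B)) g
  have hr : ∀ (D : Module.End K B) x y, r D (x ⊗ₜ y) = D x ⊗ₜ[K] y := fun _ _ _ => rfl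
  have hl : ∀ (D : Module.End K B) x y, l D (x ⊗ₜ y) = x ⊗ₜ[K] D y := fun _ _ _ => rfl
  have hrl : ∀ D E, r D * l E = l E * r D := by
    intro D E
    refine TensorProduct.ext' fun x y => ?_
    simp only [Module.End.mul_apply, hr, hl]
  have hab : Commute a b := by
    ext1 m
    rw [PowerSeries.coeff_mul, PowerSeries.coeff_mul, ← Finset.Nat.sum_antidiagonal_swap]
    refine Finset.sum_congr rfl fun p _ => ?_
    simp only [a, b, PowerSeries.coeff_map, Prod.fst_swap, Prod.snd_swap]
    exact hrl _ _
  have h := fexp_intertwine (K := K) (LinearMap.mul' K B) (g := a + b) (g' := g) (by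
    intro m v
    induction v using TensorProduct.induction_on with
    | zero => simp
    | add v w hv hw => rw [(PowerSeries.coeff m (a + b)).map_add, map_add, hv, hw, map_add, map_add]
    | tmul x y =>
      rw [map_add, LinearMap.add_apply]
      change LinearMap.mul' K B (r _ (x ⊗ₜ y) + l _ (x ⊗ₜ y)) = _
      rw [hr, hl, map_add]
      simp only [LinearMap.mul'_apply]
      exact (hD m x y).symm) n (x ⊗ₜ y)
  rw [LinearMap.mul'_apply, fexp_add hab (by simp [a, hg]) (by simp [b, hg]),
    ← map_fexp, ← map_fexp, PowerSeries.coeff_mul, LinearMap.sum_apply, map_sum] at h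
  rw [← h]
  rfl

theorem isHasseSchmidt_fexp [CharZero K] {B : Type*} [Ring B] [Algebra K B]
    {g : PowerSeries (Module.End K B)} (hg : PowerSeries.coeff 0 g = 0)
    (hD : ∀ n, PowerSeries.coeff n g ∈ derivations K B) :
    IsHasseSchmidt fun n => PowerSeries.coeff n (fexp K g) where
  map_one n := by
    rw [coeff_fexp_apply_of_sq hg]
    · rw [apply_one_of_mem_derivations (hD n), add_zero]
    · intro a b
      rw [apply_one_of_mem_derivations (hD b), map_zero]
  map_mul := coeff_fexp_apply_mul hg hD

namespace IsHasseSchmidt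

variable {B : Type*} [Ring B] [Algebra K B] {F : ℕ → Module.End K B}

/-- The generating series of a Hasse–Schmidt derivation. -/
def toPowerSeries (hF : IsHasseSchmidt F) : B →ₐ[K] PowerSeries B :=
  AlgHom.ofLinearMap
    { toFun := fun x => PowerSeries.mk fun n => F n x
      map_add' := fun x y => by ext n; simp
      map_smul' := fun c x => by ext n; simp }
    (by ext n; simp [hF.map_one, PowerSeries.coeff_one])
    (fun x y => by ext n; simp [hF.map_mul, PowerSeries.coeff_mul])

@[simp]
theorem coeff_toPowerSeries (hF : IsHasseSchmidt F) (x : B) (n : ℕ) :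
    PowerSeries.coeff n (hF.toPowerSeries x) = F n x := by
  simp [toPowerSeries]

/-- The elements killed by almost all members of a Hasse–Schmidt derivation. -/
def finiteSubalgebra (hF : IsHasseSchmidt F) : Subalgebra K B where
  carrier := {x | ∃ N, ∀ n, N ≤ n → F n x = 0}
  mul_mem' := by
    rintro x y ⟨M, hM⟩ ⟨N, hN⟩
    refine ⟨M + N, fun n hn => ?_⟩
    rw [hF.map_mul]
    refine Finset.sum_eq_zero fun p hp => ?_
    rw [Finset.HasAntidiagonal.mem_antidiagonal] at hp
    rcases le_or_gt M p.1 with h | h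
    · rw [hM _ h, zero_mul]
    · rw [hN _ (by omega), mul_zero]
  add_mem' := by
    rintro x y ⟨M, hM⟩ ⟨N, hN⟩
    refine ⟨max M N, fun n hn => ?_⟩
    rw [map_add, hM n (le_trans (le_max_left _ _) hn), hN n (le_trans (le_max_right _ _) hn),
      add_zero]
  algebraMap_mem' := by
    intro c
    refine ⟨1, fun n hn => ?_⟩
    rw [Algebra.algebraMap_eq_smul_one, map_smul, hF.map_one, if_neg (by omega), smul_zero]

/-- The generating polynomial of a locally finite Hasse–Schmidt derivation. -/
def toPolynomial (hF : IsHasseSchmidt F) (hfin : ∀ x, ∃ N, ∀ n, N ≤ n → F n x = 0) :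
    B →+* Polynomial B :=
  -- The chosen bound depends on x and is not additive or multiplicative; the coefficients do not
  -- depend on it.
  have hc : ∀ x n, (∑ k ∈ Finset.range (hfin x).choose, Polynomial.monomial k (F k x)).coeff n =
      F n x := by
    intro x n
    simp only [Polynomial.finsetSum_coeff, Polynomial.coeff_monomial]
    rw [Finset.sum_ite_eq']
    split_ifs with h
    · rfl
    · exact ((hfin x).choose_spec n (by simpa using h)).symm
  { toFun := fun x => ∑ k ∈ Finset.range (hfin x).choose, Polynomial.monomial k (F k x)
    map_one' := by
      ext n
      rw [hc, hF.map_one, Polynomial.coeff_one]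
    map_mul' := fun x y => by
      ext n
      rw [hc, hF.map_mul, Polynomial.coeff_mul]
      simp only [hc]
    map_zero' := by
      ext n
      rw [hc, map_zero, Polynomial.coeff_zero]
    map_add' := fun x y => by
      ext n
      rw [hc, map_add, Polynomial.coeff_add, hc, hc] }

@[simp]
theorem coeff_toPolynomial (hF : IsHasseSchmidt F) (hfin : ∀ x, ∃ N, ∀ n, N ≤ n → F n x = 0)
    (x : B) (n : ℕ) : (hF.toPolynomial hfin x).coeff n = F n x := by
  change (∑ k ∈ Finset.range (hfin x).choose, Polynomial.monomial k (F k x)).coeff n = _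
  simp only [Polynomial.finsetSum_coeff, Polynomial.coeff_monomial]
  rw [Finset.sum_ite_eq']
  split_ifs with h
  · rfl
  · exact ((hfin x).choose_spec n (by simpa using h)).symm

variable {C : Type*} [Ring C] [Algebra K C]

/-- The evaluation `x ↦ ∑ n, m (F n x) * z ^ n` of a locally finite Hasse–Schmidt derivation. -/
def eval (hF : IsHasseSchmidt F) (hfin : ∀ x, ∃ N, ∀ n, N ≤ n → F n x = 0) (m : B →ₐ[K] C) (z : C)
    (hz : ∀ x, Commute (m x) z) : B →ₐ[K] C :=
  { (Polynomial.eval₂RingHom' (m : B →+* C) z hz).comp (hF.toPolynomial hfin) with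
    commutes' := fun c => by
      have : hF.toPolynomial hfin (algebraMap K B c) = Polynomial.C (algebraMap K B c) := by
        ext n
        rw [coeff_toPolynomial, Polynomial.coeff_C, Algebra.algebraMap_eq_smul_one, map_smul,
          hF.map_one]
        split_ifs <;> simp
      change Polynomial.eval₂ (m : B →+* C) z (hF.toPolynomial hfin (algebraMap K B c)) = _
      rw [this, Polynomial.eval₂_C]
      exact m.commutes c }

theorem eval_apply (hF : IsHasseSchmidt F) (hfin : ∀ x, ∃ N, ∀ n, N ≤ n → F n x = 0)
    (m : B →ₐ[K] C) (z : C) (hz : ∀ x, Commute (m x) z) (x : B) {N : ℕ}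
    (hN : ∀ n, N ≤ n → F n x = 0) :
    hF.eval hfin m z hz x = ∑ n ∈ Finset.range N, m (F n x) * z ^ n := by
  change Polynomial.eval₂ (m : B →+* C) z (hF.toPolynomial hfin x) = _
  rw [Polynomial.eval₂_eq_sum_range' _ (n := max N ((hF.toPolynomial hfin x).natDegree + 1))
    (by omega)]
  simp only [coeff_toPolynomial]
  refine (Finset.sum_subset (by simp) fun n _ hn => ?_).symm
  rw [hN n (by simpa using hn), map_zero, zero_mul]

end IsHasseSchmidt

end Exponential

/-! ### Sparse series -/

section Series

theorem coeff_series {A : Type*} [Semiring A] {e : ℕ+ → ℕ} (he : Function.Injective e)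
    (f : ℕ+ → A) (k : ℕ+) : PowerSeries.coeff (e k) (series e f) = f k := by
  rw [series, PowerSeries.coeff_mk, finsum_eq_single _ k]
  · exact finsum_eq_if.trans (if_pos rfl)
  · intro j hj
    exact finsum_eq_if.trans (if_neg fun h => hj (he h))

theorem coeff_series_eq_zero {A : Type*} [Semiring A] {e : ℕ+ → ℕ}
    (f : ℕ+ → A) {n : ℕ} (h : ∀ k, e k ≠ n) : PowerSeries.coeff n (series e f) = 0 := by
  rw [series, PowerSeries.coeff_mk, ← finsum_zero (α := ℕ+)]
  refine finsum_congr fun k => ?_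
  exact finsum_eq_if.trans (if_neg (h k))

theorem coeff_series_induction {A : Type*} [Semiring A] {e : ℕ+ → ℕ} (he : Function.Injective e)
    {f : ℕ+ → A} {p : A → Prop} (h0 : p 0) (hf : ∀ k, p (f k)) (n : ℕ) :
    p (PowerSeries.coeff n (series e f)) := by
  by_cases h : ∃ k, e k = n
  · obtain ⟨k, rfl⟩ := h
    rw [coeff_series he]
    exact hf k
  · rw [coeff_series_eq_zero f (by simpa using h)]
    exact h0

theorem coeff_series_congr {A B C : Type*} [Semiring A] [Semiring B] {e : ℕ+ → ℕ}
    (he : Function.Injective e) {f : ℕ+ → A} {f' : ℕ+ → B} {p : A → C} {p' : B → C}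
    (h0 : p 0 = p' 0) (hf : ∀ k, p (f k) = p' (f' k)) (n : ℕ) :
    p (PowerSeries.coeff n (series e f)) = p' (PowerSeries.coeff n (series e f')) := by
  by_cases h : ∃ k, e k = n
  · obtain ⟨k, rfl⟩ := h
    rw [coeff_series he, coeff_series he, hf]
  · rw [coeff_series_eq_zero f (by simpa using h), coeff_series_eq_zero f' (by simpa using h), h0]

theorem map_series {A B : Type*} [Semiring A] [Semiring B] {e : ℕ+ → ℕ}
    (he : Function.Injective e) (g : A →+* B) (f : ℕ+ → A) :
    PowerSeries.map g (series e f) = series e fun k => g (f k) := by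
  ext n
  rw [PowerSeries.coeff_map]
  exact coeff_series_congr he (p := g) (p' := id) (map_zero g) (fun _ => rfl) n

theorem series_add {A : Type*} [Semiring A] {e : ℕ+ → ℕ} (he : Function.Injective e)
    (f g : ℕ+ → A) : series e f + series e g = series e fun k => f k + g k := by
  ext n
  rw [map_add]
  by_cases h : ∃ k, e k = n
  · obtain ⟨k, rfl⟩ := h
    simp only [coeff_series he]
  · simp only [not_exists] at h
    rw [coeff_series_eq_zero f h, coeff_series_eq_zero g h, coeff_series_eq_zero _ h, add_zero]

theorem coeff_series_single {A : Type*} [Semiring A] {e : ℕ+ → ℕ} (he : Function.Injective e)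
    (k : ℕ+) (x : A) (n : ℕ) :
    PowerSeries.coeff n (series e fun j => if j = k then x else 0) = if n = e k then x else 0 := by
  by_cases h : ∃ j, e j = n
  · obtain ⟨j, rfl⟩ := h
    rw [coeff_series he]
    simp only [he.eq_iff]
  · simp only [not_exists] at h
    rw [coeff_series_eq_zero _ h, if_neg fun h' => h k h'.symm]

variable {K : Type*} [Field K] {V : Type*} [AddCommGroup V] [Module K V]

theorem coeff_series_apply_single {e : ℕ+ → ℕ} (he : Function.Injective e)
    {f : ℕ+ → Module.End K V} {v : V} (k : ℕ+) (hv : ∀ j, j ≠ k → f j v = 0) (n : ℕ) :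
    PowerSeries.coeff n (series e f) v = if n = e k then f k v else 0 := by
  by_cases h : ∃ j, e j = n
  · obtain ⟨j, rfl⟩ := h
    rw [coeff_series he]
    simp only [he.eq_iff]
    split_ifs with hj
    · rw [hj]
    · exact hv j hj
  · simp only [not_exists] at h
    rw [coeff_series_eq_zero _ h, if_neg fun h' => h k h'.symm, LinearMap.zero_apply]

theorem coeff_series_apply_eq_zero {e : ℕ+ → ℕ} (he : Function.Injective e)
    {f : ℕ+ → Module.End K V} {v : V} (hv : ∀ j, f j v = 0) (n : ℕ) :
    PowerSeries.coeff n (series e f) v = 0 :=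
  coeff_series_induction he (p := fun D : Module.End K V => D v = 0) rfl hv n

end Series

theorem two_mul_injective : Function.Injective fun k : ℕ+ => 2 * (k : ℕ) := by
  intro a b h
  exact PNat.coe_injective (by simpa using h)

theorem two_mul_sub_one_injective : Function.Injective fun k : ℕ+ => 2 * (k : ℕ) - 1 := by
  intro a b h
  have := a.pos
  have := b.pos
  refine PNat.coe_injective ?_
  simp only at h
  omega

/-! ### Logarithmic series -/

section Logarithm

variable {K : Type*} [Field K] {R : Type*} [CommRing R] [Algebra K R]

theorem derivative_fexp [CharZero K] {g : PowerSeries R} (hg : PowerSeries.coeff 0 g = 0) :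
    PowerSeries.derivative R (fexp K g) = PowerSeries.derivative R g * fexp K g := by
  ext n
  have h1 : PowerSeries.coeff n (PowerSeries.derivative R g * fexp K g) =
      ∑ j ∈ Finset.range (n + 1),
        ((j ! : K)⁻¹) • PowerSeries.coeff n (PowerSeries.derivative R g * g ^ j) := by
    simp only [PowerSeries.coeff_mul, Finset.smul_sum]
    rw [Finset.sum_comm]
    refine Finset.sum_congr rfl fun p hp => ?_
    rw [Finset.HasAntidiagonal.mem_antidiagonal] at hp
    rw [coeff_fexp_of_le hg (N := n) (by omega), Finset.mul_sum]
    simp only [mul_smul_comm]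
  rw [h1, PowerSeries.coeff_derivative, coeff_fexp, Finset.sum_mul, Finset.sum_range_succ']
  have h0 : (((0 ! : K)⁻¹) • PowerSeries.coeff (n + 1) (g ^ 0)) * ((n : R) + 1) = 0 := by
    simp [PowerSeries.coeff_one]
  rw [h0, add_zero]
  refine Finset.sum_congr rfl fun j _ => ?_
  rw [smul_mul_assoc, ← PowerSeries.coeff_derivative, Derivation.leibniz_pow, Nat.add_sub_cancel,
    map_nsmul, ← Nat.cast_smul_eq_nsmul K, smul_smul, smul_eq_mul, mul_comm (g ^ j)]
  congr 1
  have : ((j + 1 : ℕ) : K) ≠ 0 := by exact_mod_cast Nat.succ_ne_zero j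
  rw [Nat.factorial_succ, Nat.cast_mul, mul_inv_rev, mul_assoc, inv_mul_cancel₀ this, mul_one]

/-- The series `-log (1 - a X ^ 2)`. -/
def logSeries (K : Type*) [Field K] {R : Type*} [CommRing R] [Algebra K R] (a : R) :
    PowerSeries R :=
  series (fun k => 2 * (k : ℕ)) fun k => ((k : ℕ) : K)⁻¹ • a ^ (k : ℕ)

theorem coeff_zero_logSeries (a : R) : PowerSeries.coeff 0 (logSeries K a) = 0 :=
  coeff_series_eq_zero _ fun k => by
    have := k.pos
    omega

/-- Logarithmic differentiation: the product has derivative zero and constant term 1. -/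
theorem fexp_logSeries_mul [CharZero K] (a : R) :
    fexp K (logSeries K a) * (1 - PowerSeries.C a * PowerSeries.X ^ 2) = 1 := by
  -- A power series is determined by its derivative and constant term only in the absence of
  -- torsion; R is a rational vector space through K.
  have : IsAddTorsionFree R := by
    have : Module ℚ R := Module.compHom R (algebraMap ℚ K)
    exact IsAddTorsionFree.of_module_rat R
  have hd : PowerSeries.derivative R (logSeries K a) *
      (1 - PowerSeries.C a * PowerSeries.X ^ 2) = PowerSeries.C (2 * a) * PowerSeries.X := by
    have h1 : PowerSeries.derivative R (logSeries K a) =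
        PowerSeries.mk fun n => if Odd n then 2 * a ^ ((n + 1) / 2) else 0 := by
      ext n
      rw [PowerSeries.coeff_derivative, PowerSeries.coeff_mk]
      rcases Nat.even_or_odd n with ⟨m, hm⟩ | ⟨m, hm⟩
      · rw [if_neg (by rw [Nat.not_odd_iff_even]; exact ⟨m, hm⟩), logSeries,
          coeff_series_eq_zero _ (by intro k; omega), zero_mul]
      · rw [if_pos ⟨m, hm⟩]
        have h := coeff_series two_mul_injective
          (fun k : ℕ+ => ((k : ℕ) : K)⁻¹ • a ^ (k : ℕ)) m.succPNat
        simp only [Nat.succPNat_coe] at h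
        rw [hm, logSeries, show 2 * m + 1 + 1 = 2 * m.succ by omega, h,
          show 2 * m.succ / 2 = m.succ by omega, smul_mul_assoc,
          show ((2 * m + 1 : ℕ) : R) + 1 = ((m.succ : ℕ) : R) * 2 by push_cast; ring,
          mul_comm (a ^ _), mul_assoc, ← nsmul_eq_mul, ← Nat.cast_smul_eq_nsmul K, smul_smul,
          inv_mul_cancel₀ (by exact_mod_cast Nat.succ_ne_zero m), one_smul]
    rw [h1]
    ext n
    rw [mul_sub, mul_one, map_sub, PowerSeries.coeff_mk, ← mul_assoc, PowerSeries.coeff_mul_X_pow',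
      PowerSeries.coeff_C_mul, PowerSeries.coeff_X]
    rcases lt_or_ge n 2 with h | h
    · interval_cases n <;> simp
    · obtain ⟨m, rfl⟩ := Nat.exists_eq_add_of_le h
      rw [if_pos h, Nat.add_sub_cancel_left, PowerSeries.coeff_mul_C,
        PowerSeries.coeff_mk, if_neg (show ¬ 2 + m = 1 by omega), mul_zero]
      have : Odd (2 + m) ↔ Odd m := by
        rw [Nat.odd_add']
        simp
      simp only [this]
      split_ifs
      · rw [show (2 + m + 1) / 2 = (m + 1) / 2 + 1 by omega, pow_succ]
        ring
      · simp
  refine PowerSeries.derivative.ext ?_ ?_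
  · rw [Derivation.leibniz, derivative_fexp (coeff_zero_logSeries a)]
    have h2 : PowerSeries.derivative R (1 - PowerSeries.C a * PowerSeries.X ^ 2 : PowerSeries R) =
        -(PowerSeries.C (2 * a) * PowerSeries.X) := by
      rw [map_sub, Derivation.map_one_eq_zero, Derivation.leibniz, PowerSeries.derivative_C,
        Derivation.leibniz_pow, PowerSeries.derivative_X]
      rw [map_mul, show (PowerSeries.C (2 : R) : PowerSeries R) = 2 from map_ofNat _ 2]
      simp
      ring
    rw [h2, ← hd, Derivation.map_one_eq_zero, smul_eq_mul, smul_eq_mul]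
    ring
  · rw [map_mul, ← PowerSeries.coeff_zero_eq_constantCoeff_apply, coeff_zero_fexp]
    simp

/-- The power sum `∑_{i + j = m - 1} a ^ i c ^ j`. -/
def homSum {R : Type*} [CommRing R] (a c : R) : ℕ → R
  | 0 => 0
  | m + 1 => a * homSum a c m + c ^ m

/-- The coefficients of `(1 - a c x) (1 - x) / ((1 - a x) (1 - c x))`. -/
def structCoeff {R : Type*} [CommRing R] (a c : R) : ℕ → R
  | 0 => 1
  | m + 1 => -((1 - a) * (1 - c) * homSum a c (m + 1))

/-- The series `∑ u m X ^ (2 m)`. -/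
def evenSeries {R : Type*} [CommRing R] (u : ℕ → R) : PowerSeries R :=
  PowerSeries.mk fun n => if Even n then u (n / 2) else 0

theorem evenSeries_mul (u : ℕ → R) (a : R) :
    evenSeries u * (1 - PowerSeries.C a * PowerSeries.X ^ 2) =
      evenSeries fun m => u m - if m = 0 then 0 else a * u (m - 1) := by
  ext n
  rw [mul_sub, mul_one, map_sub, ← mul_assoc, PowerSeries.coeff_mul_X_pow',
    mul_comm (evenSeries u), PowerSeries.coeff_C_mul]
  simp only [evenSeries, PowerSeries.coeff_mk]
  rcases lt_or_ge n 2 with h | h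
  · interval_cases n <;> simp
  · obtain ⟨m, rfl⟩ := Nat.exists_eq_add_of_le h
    have : Even (2 + m) ↔ Even m := by
      rw [Nat.even_add]
      simp
    simp only [if_pos h, Nat.add_sub_cancel_left, this, if_neg (show (2 + m) / 2 ≠ 0 by omega),
      show (2 + m) / 2 - 1 = m / 2 by omega]
    split_ifs <;> simp

/-- Denominator-free form of the generating function: numerator minus denominator is -(1 - a)(1 -
c)x, and x / ((1 - ax)(1 - cx)) generates `homSum`. -/
theorem evenSeries_structCoeff_mul (a c : K) (z : R) :
    evenSeries (fun m => structCoeff a c m • z ^ m) *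
        (1 - PowerSeries.C (a • z) * PowerSeries.X ^ 2) *
        (1 - PowerSeries.C (c • z) * PowerSeries.X ^ 2) =
      (1 - PowerSeries.C ((a * c) • z) * PowerSeries.X ^ 2) *
        (1 - PowerSeries.C z * PowerSeries.X ^ 2) := by
  have h1 : (1 : PowerSeries R) = evenSeries fun m => if m = 0 then 1 else 0 := by
    ext n
    rw [evenSeries, PowerSeries.coeff_mk, PowerSeries.coeff_one]
    rcases Nat.even_or_odd' n with ⟨m, rfl | rfl⟩ <;> simp
  -- A factor 1 is inserted on the right and read as an even series, so that both sides are an even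
  -- series times two quadratic factors.
  rw [← one_mul (1 - PowerSeries.C ((a * c) • z) * PowerSeries.X ^ 2)]
  nth_rewrite 3 [h1]
  rw [evenSeries_mul, evenSeries_mul, evenSeries_mul, evenSeries_mul]
  congr 1
  funext m
  -- Two quadratic factors involve the indices m, m - 1, m - 2, and `structCoeff` has a separate
  -- value at 0, so the recursion is uniform only from m = 3.
  match m with
  | 0 => simp [structCoeff]
  | 1 =>
    simp [structCoeff, homSum, Algebra.smul_def]
    ring
  | 2 =>
    simp [structCoeff, homSum, Algebra.smul_def]
    ring
  | m + 3 =>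
    simp [structCoeff, homSum, Algebra.smul_def]
    ring

/-- Expanding (1 - c^k)(a^k - 1) = a^k + c^k - (ac)^k - 1 writes the exponent as a combination of
four logarithms. -/
theorem fexp_logSeries [CharZero K] (a c : K) (z : R) :
    fexp K (series (fun k => 2 * (k : ℕ)) fun k =>
        (((1 - c ^ (k : ℕ)) / ((k : ℕ) : K)) * (a ^ (k : ℕ) - 1)) • z ^ (k : ℕ)) =
      evenSeries fun m => structCoeff a c m • z ^ m := by
  set d := series (fun k => 2 * (k : ℕ)) fun k : ℕ+ =>
    (((1 - c ^ (k : ℕ)) / ((k : ℕ) : K)) * (a ^ (k : ℕ) - 1)) • z ^ (k : ℕ)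
  have hd : PowerSeries.coeff 0 d = 0 := coeff_series_eq_zero _ fun k => by
    have := k.pos
    omega
  have hsum : d + logSeries K ((a * c) • z) + logSeries K z =
      logSeries K (a • z) + logSeries K (c • z) := by
    simp only [d, logSeries, series_add two_mul_injective]
    congr 1
    funext k
    simp only [smul_pow, smul_smul, ← add_smul]
    congr 1
    ring
  have h := congrArg (fexp K) hsum
  rw [fexp_add (Commute.all _ _) (by rw [map_add, hd, coeff_zero_logSeries, add_zero])
      (coeff_zero_logSeries _),
    fexp_add (Commute.all _ _) hd (coeff_zero_logSeries _),
    fexp_add (Commute.all _ _) (coeff_zero_logSeries _) (coeff_zero_logSeries _)] at h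
  have ha := fexp_logSeries_mul (K := K) (a • z)
  have hc := fexp_logSeries_mul (K := K) (c • z)
  have hac := fexp_logSeries_mul (K := K) ((a * c) • z)
  have hz := fexp_logSeries_mul (K := K) z
  have hG := evenSeries_structCoeff_mul a c z
  set A := fexp K (logSeries K (a • z))
  set B := fexp K (logSeries K (c • z))
  set E := fexp K (logSeries K ((a * c) • z))
  set F := fexp K (logSeries K z)
  set G := evenSeries fun m => structCoeff a c m • z ^ m
  set a' := 1 - PowerSeries.C (a • z) * PowerSeries.X ^ 2
  set c' := 1 - PowerSeries.C (c • z) * PowerSeries.X ^ 2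
  set e' := 1 - PowerSeries.C ((a * c) • z) * PowerSeries.X ^ 2
  set f' := 1 - PowerSeries.C z * PowerSeries.X ^ 2
  calc fexp K d = fexp K d * (E * e') * (F * f') := by rw [hac, hz]; ring
    _ = fexp K d * E * F * (e' * f') := by ring
    _ = (A * a') * (B * c') * G := by rw [h, ← hG]; ring
    _ = G := by rw [ha, hc]; ring

end Logarithm

/-! ### Derivations of exterior algebras -/

section Exterior

variable {K : Type*} [Field K]

/-- Contraction is an antiderivation, and moving v past a generator produces a second sign; the two
signs cancel. -/
theorem mulLeft_contractLeft_mem_derivations {M : Type*} [AddCommGroup M] [Module K M] (v : M)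
    (d : Module.Dual K M) :
    (LinearMap.mulLeft K (ExteriorAlgebra.ι K v) *
      (CliffordAlgebra.contractLeft d : Module.End K (ExteriorAlgebra K M))) ∈
      derivations K (ExteriorAlgebra K M) := by
  intro x
  have hι : ∀ a b, CliffordAlgebra.contractLeft d (ExteriorAlgebra.ι K a * b) =
      d a • b - ExteriorAlgebra.ι K a * CliffordAlgebra.contractLeft d b :=
    CliffordAlgebra.contractLeft_ι_mul d
  have hι1 : ∀ a, CliffordAlgebra.contractLeft d (ExteriorAlgebra.ι K a) =
      algebraMap K (ExteriorAlgebra K M) (d a) := CliffordAlgebra.contractLeft_ι _ d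
  have h1 : ∀ c, CliffordAlgebra.contractLeft d (algebraMap K (ExteriorAlgebra K M) c) = 0 :=
    CliffordAlgebra.contractLeft_algebraMap _ d
  have hswap : ∀ a, ExteriorAlgebra.ι K v * ExteriorAlgebra.ι K a =
      -(ExteriorAlgebra.ι K a * ExteriorAlgebra.ι K v) := fun a =>
    eq_neg_of_add_eq_zero_left (ExteriorAlgebra.ι_add_mul_swap v a)
  simp only [Module.End.mul_apply, LinearMap.mulLeft_apply]
  induction x using ExteriorAlgebra.induction with
  | algebraMap c =>
    intro y
    rw [h1, ← Algebra.smul_def, map_smul, mul_zero, zero_mul, zero_add, ← Algebra.smul_def,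
      mul_smul_comm]
  | ι a =>
    intro y
    rw [hι, hι1, mul_sub, ← mul_assoc, hswap, mul_smul_comm, ← Algebra.commutes, Algebra.smul_def]
    noncomm_ring
  | mul a b ha hb =>
    intro y
    rw [mul_assoc, ha, hb, ha, mul_add, add_mul]
    noncomm_ring
  | add a b ha hb =>
    intro y
    rw [add_mul, map_add, mul_add, ha, hb, map_add, mul_add, add_mul, add_mul]
    abel

/-- The generators of the Grassmann algebra. -/
def gen (K : Type*) [Field K] {ι : Type*} (i : ι) : Grass K ι :=
  ExteriorAlgebra.ι K (Finsupp.single i 1)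

theorem create_apply {ι : Type*} (i : ι) (x : Grass K ι) : create K i x = gen K i * x := rfl

theorem annih_gen_mul {ι : Type*} [DecidableEq ι] (i j : ι) (x : Grass K ι) :
    annih K i (gen K j * x) = (if j = i then x else 0) - gen K j * annih K i x := by
  refine (CliffordAlgebra.contractLeft_ι_mul _ _ _).trans ?_
  congr 1
  rw [Finsupp.lapply_apply, Finsupp.single_apply]
  split_ifs <;> simp

theorem annih_one {ι : Type*} (i : ι) : annih K i (1 : Grass K ι) = 0 :=
  CliffordAlgebra.contractLeft_one _ _

theorem annih_gen {ι : Type*} [DecidableEq ι] (i j : ι) :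
    annih K i (gen K j) = if j = i then 1 else 0 := by
  rw [← mul_one (gen K j), annih_gen_mul, annih_one, mul_zero, sub_zero]

theorem create_mul_annih_mem_derivations {ι : Type*} (i j : ι) :
    create K i * annih K j ∈ derivations K (Grass K ι) :=
  mulLeft_contractLeft_mem_derivations _ _

theorem grass_algHom_ext {ι : Type*} {A : Type*} [Semiring A] [Algebra K A]
    {f g : Grass K ι →ₐ[K] A} (h : ∀ i, f (gen K i) = g (gen K i)) : f = g := by
  refine ExteriorAlgebra.hom_ext (Finsupp.lhom_ext' fun i => LinearMap.ext_ring ?_)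
  exact h i

theorem grass_subalgebra_eq_top {ι : Type*} {S : Subalgebra K (Grass K ι)}
    (h : ∀ i, gen K i ∈ S) (x : Grass K ι) : x ∈ S := by
  have : (Algebra.adjoin K (Set.range (ExteriorAlgebra.ι K (M := ι →₀ K)))) = ⊤ :=
    CliffordAlgebra.adjoin_range_ι
  refine (Algebra.adjoin_le (S := S) ?_ : _ ≤ S) (this ▸ (Algebra.mem_top : x ∈ ⊤))
  rintro _ ⟨v, rfl⟩
  induction v using Finsupp.induction_linear with
  | zero => rw [map_zero]; exact S.zero_mem
  | add v w hv hw => rw [map_add]; exact S.add_mem hv hw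
  | single i c =>
    have hs : Finsupp.single i c = c • (Finsupp.single i 1 : ι →₀ K) := by simp
    rw [hs, map_smul]
    exact S.smul_mem (h i) c

theorem grass_left_induction {ι : Type*} {p : Grass K ι → Prop} (h1 : p 1)
    (hsmul : ∀ (c : K) x, p x → p (c • x)) (hadd : ∀ x y, p x → p y → p (x + y))
    (hmul : ∀ i x, p x → p (gen K i * x)) (x : Grass K ι) : p x := by
  refine CliffordAlgebra.left_induction (P := p) _ (fun r => ?_) hadd (fun x m hx => ?_) x
  · rw [Algebra.algebraMap_eq_smul_one]
    exact hsmul _ _ h1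
  · induction m using Finsupp.induction_linear with
    | zero =>
      rw [map_zero, zero_mul, ← zero_smul K x]
      exact hsmul _ _ hx
    | add v w hv hw =>
      rw [map_add, add_mul]
      exact hadd _ _ hv hw
    | single i c =>
      have hs : Finsupp.single i c = c • (Finsupp.single i 1 : ι →₀ K) := by simp
      rw [hs, map_smul, smul_mul_assoc]
      exact hsmul _ _ (hmul i x hx)

theorem exists_annih_eq_zero (x : Grass K ℕ+) : ∃ N : ℕ, ∀ k : ℕ+, N ≤ k → annih K k x = 0 := by
  induction x using grass_left_induction with
  | h1 => exact ⟨0, fun k _ => annih_one k⟩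
  | hsmul c x hx =>
    obtain ⟨N, hN⟩ := hx
    exact ⟨N, fun k hk => by rw [map_smul, hN k hk, smul_zero]⟩
  | hadd x y hx hy =>
    obtain ⟨M, hM⟩ := hx
    obtain ⟨N, hN⟩ := hy
    refine ⟨max M N, fun k hk => ?_⟩
    rw [map_add, hM k (le_trans (le_max_left _ _) hk), hN k (le_trans (le_max_right _ _) hk),
      add_zero]
  | hmul i x hx =>
    obtain ⟨N, hN⟩ := hx
    refine ⟨max (i + 1) N, fun k hk => ?_⟩
    have hik : i ≠ k := by
      rintro rfl
      have := le_trans (le_max_left _ _) hk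
      omega
    rw [annih_gen_mul, hN k (le_trans (le_max_right _ _) hk), if_neg hik, mul_zero, sub_zero]

end Exterior

/-! ### Bosonic and fermionic exponentials -/

section Exponentials

variable {K : Type*} [Field K]

theorem dpB_mem_derivations (k : ℕ+) : dpB K k ∈ derivations K (Bos K) := by
  intro x y
  change MvPolynomial.pderiv k (x * y) = MvPolynomial.pderiv k x * y + x * MvPolynomial.pderiv k y
  rw [Derivation.leibniz, smul_eq_mul, smul_eq_mul]
  ring

theorem dpB_X (k j : ℕ+) : dpB K k (MvPolynomial.X j) = if j = k then 1 else 0 := by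
  change MvPolynomial.pderiv k (MvPolynomial.X j) = _
  rw [MvPolynomial.pderiv_X, Pi.single_apply]

theorem bos_subalgebra_eq_top {S : Subalgebra K (Bos K)} (h : ∀ k, MvPolynomial.X k ∈ S)
    (x : Bos K) : x ∈ S := by
  have : Algebra.adjoin K (Set.range (MvPolynomial.X : ℕ+ → Bos K)) = ⊤ :=
    MvPolynomial.adjoin_range_X
  refine (Algebra.adjoin_le (S := S) ?_ : _ ≤ S) (this ▸ (Algebra.mem_top : x ∈ ⊤))
  rintro _ ⟨k, rfl⟩
  exact h k

/-- The exponential `exp (∑ c k ∂/∂p_k z ^ (e k))`. -/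
def bosExp (e : ℕ+ → ℕ) (c : ℕ+ → K) : PowerSeries (Module.End K (Bos K)) :=
  fexp K (series e fun k => c k • dpB K k)

/-- Taylor's formula: the exponential of derivatives translates p_k by a scalar. -/
theorem bosExp_X {e : ℕ+ → ℕ} (he : Function.Injective e) (he0 : ∀ k, e k ≠ 0) (c : ℕ+ → K)
    (k : ℕ+) (n : ℕ) : PowerSeries.coeff n (bosExp e c) (MvPolynomial.X k) =
      (if n = 0 then MvPolynomial.X k else 0) + if n = e k then algebraMap K (Bos K) (c k) else 0 := by
  have h : ∀ n, PowerSeries.coeff n (series e fun k => c k • dpB K k) (MvPolynomial.X k) =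
      if n = e k then algebraMap K (Bos K) (c k) else 0 := by
    intro n
    rw [coeff_series_apply_single he k]
    · rw [LinearMap.smul_apply, dpB_X, if_pos rfl, Algebra.algebraMap_eq_smul_one]
    · intro j hj
      rw [LinearMap.smul_apply, dpB_X, if_neg hj.symm, smul_zero]
  rw [bosExp, coeff_fexp_apply_of_sq (coeff_series_eq_zero _ he0), h]
  intro a b
  rw [h]
  split_ifs
  · refine coeff_series_apply_eq_zero he (fun j => ?_) a
    rw [LinearMap.smul_apply, Algebra.algebraMap_eq_smul_one, map_smul,
      apply_one_of_mem_derivations (dpB_mem_derivations j), smul_zero, smul_zero]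
  · rw [map_zero]

theorem isHasseSchmidt_bosExp [CharZero K] {e : ℕ+ → ℕ} (he : Function.Injective e)
    (he0 : ∀ k, e k ≠ 0) (c : ℕ+ → K) :
    IsHasseSchmidt fun n => PowerSeries.coeff n (bosExp e c) :=
  isHasseSchmidt_fexp (coeff_series_eq_zero _ he0) fun n =>
    coeff_series_induction he (p := fun D => D ∈ derivations K (Bos K)) (Submodule.zero_mem _)
      (fun k => Submodule.smul_mem _ _ (dpB_mem_derivations k)) n

/-- By multiplicativity the elements with finite expansion form a subalgebra, so the generators
suffice. -/
theorem bosExp_finite [CharZero K] {e : ℕ+ → ℕ} (he : Function.Injective e)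
    (he0 : ∀ k, e k ≠ 0) (c : ℕ+ → K) (x : Bos K) :
    ∃ N, ∀ n, N ≤ n → PowerSeries.coeff n (bosExp e c) x = 0 := by
  refine bos_subalgebra_eq_top (S := (isHasseSchmidt_bosExp he he0 c).finiteSubalgebra)
    (fun k => ⟨e k + 1, fun n hn => ?_⟩) x
  rw [bosExp_X he he0, if_neg (by omega), if_neg (by omega), add_zero]

/-- The exponential `exp (∑ b k w ^ (1 - 2 k) (∑_{m < N k} c ^ m ψ_m†) ∂/∂π_k)`. -/
def fermPlus (b : ℕ+ → K) (N : ℕ+ → ℕ) (c : K) : PowerSeries (Module.End K (Ext K)) :=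
  fexp K (series (fun k => 2 * (k : ℕ) - 1) fun k =>
    b k • ((∑ m ∈ Finset.range (N k), c ^ m • psiDag K m) * dpiE K k))

/-- The exponential `exp (∑ b k w ^ (2 k - 1) π_k ∑_{m < N k} c ^ m ψ_m)`. -/
def fermMinus (b : ℕ+ → K) (N : ℕ+ → ℕ) (c : K) : PowerSeries (Module.End K (Ext K)) :=
  fexp K (series (fun k => 2 * (k : ℕ) - 1) fun k =>
    b k • (piE K k * ∑ m ∈ Finset.range (N k), c ^ m • psi K m))

theorem two_mul_sub_one_ne_zero (k : ℕ+) : 2 * (k : ℕ) - 1 ≠ 0 := by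
  have := k.pos
  omega

theorem two_mul_ne_zero (k : ℕ+) : 2 * (k : ℕ) ≠ 0 := by
  have := k.pos
  omega

theorem fermPlus_term_apply_inl (b : K) (N : ℕ) (c : K) (k l : ℕ+) :
    (b • ((∑ m ∈ Finset.range N, c ^ m • psiDag K m) * dpiE K k)) (gen K (Sum.inl l)) =
      if l = k then b • ∑ m ∈ Finset.range N, c ^ m • gen K (Sum.inr m) else 0 := by
  rw [LinearMap.smul_apply, Module.End.mul_apply, dpiE, annih_gen]
  by_cases h : l = k
  · simp only [h, if_true, LinearMap.sum_apply, LinearMap.smul_apply, psiDag, create_apply, mul_one]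
  · simp [h]

theorem fermPlus_term_apply_inr (b : K) (N : ℕ) (c : K) (k : ℕ+) (m : ℕ) :
    (b • ((∑ m ∈ Finset.range N, c ^ m • psiDag K m) * dpiE K k)) (gen K (Sum.inr m)) = 0 := by
  rw [LinearMap.smul_apply, Module.End.mul_apply, dpiE, annih_gen, if_neg (by simp), map_zero,
    smul_zero]

theorem fermMinus_term_apply_inr (b : K) (N : ℕ) (c : K) (k : ℕ+) (m : ℕ) :
    (b • (piE K k * ∑ m ∈ Finset.range N, c ^ m • psi K m)) (gen K (Sum.inr m)) =
      if m < N then (b * c ^ m) • gen K (Sum.inl k) else 0 := by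
  rw [LinearMap.smul_apply, Module.End.mul_apply, LinearMap.sum_apply]
  simp only [LinearMap.smul_apply, psi, annih_gen, Sum.inr.injEq, smul_ite, smul_zero]
  rw [Finset.sum_ite_eq]
  simp only [Finset.mem_range]
  split_ifs
  · rw [piE, create_apply, mul_smul_comm, mul_one, smul_smul]
  · rw [map_zero, smul_zero]

theorem fermMinus_term_apply_inl (b : K) (N : ℕ) (c : K) (k l : ℕ+) :
    (b • (piE K k * ∑ m ∈ Finset.range N, c ^ m • psi K m)) (gen K (Sum.inl l)) = 0 := by
  rw [LinearMap.smul_apply, Module.End.mul_apply, LinearMap.sum_apply]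
  simp [psi, annih_gen]

variable (b : ℕ+ → K) (N : ℕ+ → ℕ) (c : K)

theorem fermPlus_inr (m n : ℕ) :
    PowerSeries.coeff n (fermPlus b N c) (gen K (Sum.inr m)) =
      if n = 0 then gen K (Sum.inr m) else 0 := by
  have h : ∀ n, PowerSeries.coeff n (series (fun k => 2 * (k : ℕ) - 1) fun k =>
      b k • ((∑ m ∈ Finset.range (N k), c ^ m • psiDag K m) * dpiE K k)) (gen K (Sum.inr m)) = 0 :=
    coeff_series_apply_eq_zero two_mul_sub_one_injective fun k =>
      fermPlus_term_apply_inr _ _ _ _ _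
  rw [fermPlus, coeff_fexp_apply_of_sq (coeff_series_eq_zero _ two_mul_sub_one_ne_zero), h,
    add_zero]
  intro i j
  rw [h, map_zero]

/-- One application of the exponent turns π_l into a combination of the ψ_m†, which the exponent
kills. -/
theorem fermPlus_inl (l : ℕ+) (n : ℕ) :
    PowerSeries.coeff n (fermPlus b N c) (gen K (Sum.inl l)) =
      (if n = 0 then gen K (Sum.inl l) else 0) + if n = 2 * (l : ℕ) - 1 then
        b l • ∑ m ∈ Finset.range (N l), c ^ m • gen K (Sum.inr m) else 0 := by
  have h : ∀ n, PowerSeries.coeff n (series (fun k => 2 * (k : ℕ) - 1) fun k =>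
      b k • ((∑ m ∈ Finset.range (N k), c ^ m • psiDag K m) * dpiE K k)) (gen K (Sum.inl l)) =
      if n = 2 * (l : ℕ) - 1 then
        b l • ∑ m ∈ Finset.range (N l), c ^ m • gen K (Sum.inr m) else 0 := by
    intro n
    rw [coeff_series_apply_single two_mul_sub_one_injective l]
    · rw [fermPlus_term_apply_inl, if_pos rfl]
    · intro k hk
      rw [fermPlus_term_apply_inl, if_neg hk.symm]
  rw [fermPlus, coeff_fexp_apply_of_sq (coeff_series_eq_zero _ two_mul_sub_one_ne_zero), h]
  intro i j
  rw [h]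
  split_ifs
  · refine coeff_series_apply_eq_zero two_mul_sub_one_injective (fun k => ?_) i
    rw [map_smul, map_sum]
    simp only [map_smul, fermPlus_term_apply_inr, smul_zero, Finset.sum_const_zero]
  · rw [map_zero]

theorem fermMinus_inl (l : ℕ+) (n : ℕ) :
    PowerSeries.coeff n (fermMinus b N c) (gen K (Sum.inl l)) =
      if n = 0 then gen K (Sum.inl l) else 0 := by
  have h : ∀ n, PowerSeries.coeff n (series (fun k => 2 * (k : ℕ) - 1) fun k =>
      b k • (piE K k * ∑ m ∈ Finset.range (N k), c ^ m • psi K m)) (gen K (Sum.inl l)) = 0 :=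
    coeff_series_apply_eq_zero two_mul_sub_one_injective fun k =>
      fermMinus_term_apply_inl _ _ _ _ _
  rw [fermMinus, coeff_fexp_apply_of_sq (coeff_series_eq_zero _ two_mul_sub_one_ne_zero), h,
    add_zero]
  intro i j
  rw [h, map_zero]

/-- Here ψ_m acts as the derivative in ψ_m†, and the resulting π_k are killed by the exponent.
Infinitely many π_k may occur, so this factor is kept as a power series in w, whereas `fermPlus` is
evaluated as a polynomial in w⁻¹. -/
theorem fermMinus_inr (m n : ℕ) :
    PowerSeries.coeff n (fermMinus b N c) (gen K (Sum.inr m)) =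
      (if n = 0 then gen K (Sum.inr m) else 0) +
        PowerSeries.coeff n (series (fun k => 2 * (k : ℕ) - 1) fun k : ℕ+ =>
          if m < N k then (b k * c ^ m) • gen K (Sum.inl k : ℕ+ ⊕ ℕ) else 0) := by
  have h : ∀ n, PowerSeries.coeff n (series (fun k => 2 * (k : ℕ) - 1) fun k =>
      b k • (piE K k * ∑ m ∈ Finset.range (N k), c ^ m • psi K m)) (gen K (Sum.inr m)) =
      PowerSeries.coeff n (series (fun k => 2 * (k : ℕ) - 1) fun k : ℕ+ =>
          if m < N k then (b k * c ^ m) • gen K (Sum.inl k : ℕ+ ⊕ ℕ) else 0) :=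
    coeff_series_congr two_mul_sub_one_injective
      (p := fun D : Module.End K (Ext K) => D (gen K (Sum.inr m))) (p' := id) rfl
      fun k => fermMinus_term_apply_inr _ _ _ _ _
  rw [fermMinus, coeff_fexp_apply_of_sq (coeff_series_eq_zero _ two_mul_sub_one_ne_zero), h]
  intro i j
  rw [h]
  refine coeff_series_induction two_mul_sub_one_injective
    (p := fun x => PowerSeries.coeff i (series (fun k => 2 * (k : ℕ) - 1) fun k =>
      b k • (piE K k * ∑ m ∈ Finset.range (N k), c ^ m • psi K m)) x = 0) (map_zero _)
    (fun l => ?_) j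
  refine coeff_series_apply_eq_zero two_mul_sub_one_injective (fun k => ?_) i
  split_ifs
  · rw [map_smul, fermMinus_term_apply_inl, smul_zero]
  · rw [map_zero]

theorem isHasseSchmidt_fermPlus [CharZero K] :
    IsHasseSchmidt fun n => PowerSeries.coeff n (fermPlus b N c) :=
  isHasseSchmidt_fexp (coeff_series_eq_zero _ two_mul_sub_one_ne_zero) fun n =>
    coeff_series_induction two_mul_sub_one_injective (p := fun D => D ∈ derivations K (Ext K))
      (Submodule.zero_mem _) (fun k => Submodule.smul_mem _ _ (by
        rw [Finset.sum_mul]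
        refine Submodule.sum_mem _ fun m _ => ?_
        rw [smul_mul_assoc]
        exact Submodule.smul_mem _ _ (create_mul_annih_mem_derivations _ _))) n

theorem isHasseSchmidt_fermMinus [CharZero K] :
    IsHasseSchmidt fun n => PowerSeries.coeff n (fermMinus b N c) :=
  isHasseSchmidt_fexp (coeff_series_eq_zero _ two_mul_sub_one_ne_zero) fun n =>
    coeff_series_induction two_mul_sub_one_injective (p := fun D => D ∈ derivations K (Ext K))
      (Submodule.zero_mem _) (fun k => Submodule.smul_mem _ _ (by
        rw [Finset.mul_sum]
        refine Submodule.sum_mem _ fun m _ => ?_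
        rw [mul_smul_comm]
        exact Submodule.smul_mem _ _ (create_mul_annih_mem_derivations _ _))) n

theorem fermPlus_finite [CharZero K] (x : Ext K) :
    ∃ N', ∀ n, N' ≤ n → PowerSeries.coeff n (fermPlus b N c) x = 0 := by
  refine grass_subalgebra_eq_top (S := (isHasseSchmidt_fermPlus b N c).finiteSubalgebra) ?_ x
  rintro (l | m)
  · refine ⟨2 * l, fun n hn => ?_⟩
    have := l.pos
    rw [fermPlus_inl, if_neg (by omega), if_neg (by omega), add_zero]
  · refine ⟨1, fun n hn => ?_⟩
    rw [fermPlus_inr, if_neg (by omega)]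

end Exponentials

/-! ### Fields with values in formal Laurent series -/

section Field

variable {K : Type*} [Field K]

/-- The formal Laurent series in `w` with coefficients in the space of supersymmetric polynomials. -/
abbrev LSer (K : Type*) [Field K] : Type _ := HahnSeries ℤ (Fock K)

instance : Ring (LSer K) := inferInstance

instance : IsScalarTower K (LSer K) (LSer K) :=
  ⟨fun r x y => (Algebra.smul_mul_assoc r x y :)⟩

instance : SMulCommClass K (LSer K) (LSer K) :=
  ⟨fun r x y => ((Algebra.mul_smul_comm r x y).symm :)⟩

theorem commute_of_forall {A : Type*} [Mul A] {a : A} (h : ∀ x, a * x = x * a) (x : A) :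
    Commute a x := h x

/-- The power `w ^ n`. -/
def wPow (K : Type*) [Field K] (n : ℤ) : LSer K := HahnSeries.single n 1

theorem coeff_mul_wPow (x : LSer K) (n m : ℤ) : (x * wPow K n).coeff m = x.coeff (m - n) := by
  rw [wPow, HahnSeries.coeff_mul_single, mul_one]

theorem coeff_wPow_mul (x : LSer K) (n m : ℤ) : (wPow K n * x).coeff m = x.coeff (m - n) := by
  rw [wPow, HahnSeries.coeff_single_mul, one_mul]

theorem wPow_comm (n : ℤ) (x : LSer K) : wPow K n * x = x * wPow K n := by
  ext m
  rw [coeff_mul_wPow, coeff_wPow_mul]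

theorem wPow_mul (m n : ℤ) : wPow K m * wPow K n = wPow K (m + n) := by
  rw [wPow, wPow, HahnSeries.single_mul_single, mul_one, wPow]

theorem wPow_zero : wPow K 0 = 1 := rfl

theorem wPow_pow (m : ℤ) (n : ℕ) : wPow K m ^ n = wPow K (n * m) := by
  rw [wPow, HahnSeries.single_pow, one_pow, wPow, nsmul_eq_mul]

/-- The constant Laurent series. -/
def constL (K : Type*) [Field K] : Fock K →ₐ[K] LSer K :=
  { (HahnSeries.C : Fock K →+* LSer K) with
    commutes' := fun _ => rfl }

theorem coeff_constL_mul (x : Fock K) (y : LSer K) (n : ℤ) :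
    (constL K x * y).coeff n = x * y.coeff n :=
  HahnSeries.coeff_single_zero_mul

theorem coeff_mul_constL (x : Fock K) (y : LSer K) (n : ℤ) :
    (y * constL K x).coeff n = y.coeff n * x :=
  HahnSeries.coeff_mul_single_zero

/-- The embedding of power series into Laurent series. -/
def psL (K : Type*) [Field K] : PowerSeries (Fock K) →ₐ[K] LSer K :=
  HahnSeries.ofPowerSeriesAlg ℤ K

theorem coeff_psL_natCast (x : PowerSeries (Fock K)) (n : ℕ) :
    (psL K x).coeff n = PowerSeries.coeff n x :=
  HahnSeries.ofPowerSeries_apply_coeff x n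

theorem coeff_psL_of_neg (x : PowerSeries (Fock K)) {n : ℤ} (hn : n < 0) :
    (psL K x).coeff n = 0 := by
  refine HahnSeries.embDomain_of_notMem_range ?_
  rintro ⟨m, rfl⟩
  exact absurd hn (by simp)

/-- The bosonic part of the space of supersymmetric polynomials. -/
abbrev inB (K : Type*) [Field K] : Bos K →ₐ[K] Fock K := Algebra.TensorProduct.includeLeft

/-- The fermionic part of the space of supersymmetric polynomials. -/
abbrev inF (K : Type*) [Field K] : Grass K ℕ+ →ₐ[K] Fock K := Algebra.TensorProduct.includeRight

theorem inB_comm (f : Bos K) (x : Fock K) : inB K f * x = x * inB K f := by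
  induction x using TensorProduct.induction_on with
  | zero => simp
  | tmul f' g => simp [mul_comm]
  | add x y hx hy => rw [mul_add, add_mul, hx, hy]

theorem constL_inB_comm (f : Bos K) (x : LSer K) :
    constL K (inB K f) * x = x * constL K (inB K f) := by
  ext n
  rw [coeff_constL_mul, coeff_mul_constL, inB_comm]

theorem hahnSeries_mul_comm {x y : LSer K} (h : ∀ i j, x.coeff i * y.coeff j = y.coeff j * x.coeff i) :
    x * y = y * x := by
  ext n
  rw [HahnSeries.coeff_mul, HahnSeries.coeff_mul]
  refine Finset.sum_bij' (fun p _ => p.swap) (fun p _ => p.swap) ?_ ?_ ?_ ?_ ?_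
  · intro p hp
    exact Finset.swap_mem_antidiagonal.2 hp
  · intro p hp
    exact Finset.swap_mem_antidiagonal.2 hp
  · intro p _
    rfl
  · intro p _
    rfl
  · intro p _
    exact h _ _

theorem psL_inB_comm (h : PowerSeries (Bos K)) (x : LSer K) :
    psL K (PowerSeries.map (inB K : Bos K →+* Fock K) h) * x =
      x * psL K (PowerSeries.map (inB K : Bos K →+* Fock K) h) := by
  refine hahnSeries_mul_comm fun i j => ?_
  rcases lt_or_ge i 0 with hi | hi
  · rw [coeff_psL_of_neg _ hi, zero_mul, mul_zero]
  · obtain ⟨n, rfl⟩ := Int.eq_ofNat_of_zero_le hi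
    rw [coeff_psL_natCast, PowerSeries.coeff_map]
    exact inB_comm _ _

/-- `⟨∅|` as a homomorphism. -/
def vacOutHom (K : Type*) [Field K] : Ext K →ₐ[K] Grass K ℕ+ :=
  ExteriorAlgebra.map (Finsupp.lcomapDomain (Sum.inl : ℕ+ → ℕ+ ⊕ ℕ)
    Sum.inl_injective : (ℕ+ ⊕ ℕ →₀ K) →ₗ[K] (ℕ+ →₀ K))

/-- `v ↦ v ⊗ |∅⟩` as a homomorphism. -/
def vacInHom (K : Type*) [Field K] : Grass K ℕ+ →ₐ[K] Ext K :=
  ExteriorAlgebra.map (Finsupp.lmapDomain K K (Sum.inl : ℕ+ → ℕ+ ⊕ ℕ))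

theorem vacInHom_gen (k : ℕ+) : vacInHom K (gen K k) = gen K (Sum.inl k) := by
  refine (ExteriorAlgebra.map_apply_ι _ _).trans ?_
  simp [gen]

theorem vacOutHom_gen_inl (k : ℕ+) : vacOutHom K (gen K (Sum.inl k)) = gen K k := by
  refine (ExteriorAlgebra.map_apply_ι _ _).trans ?_
  rw [gen]
  congr 1
  ext j
  simp [Finsupp.lcomapDomain, Finsupp.single_apply]

theorem vacOutHom_gen_inr (m : ℕ) : vacOutHom K (gen K (Sum.inr m)) = 0 := by
  refine (ExteriorAlgebra.map_apply_ι _ _).trans ?_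
  rw [← map_zero (ExteriorAlgebra.ι K)]
  congr 1
  ext j
  simp [Finsupp.lcomapDomain]

end Field

/-! ### Contour integrals as coefficients -/

section Contour

variable {K : Type*} [Field K]

/-- The exponential `exp (∑ (1 - t⁻ᵏ) / k p_k w ^ (2 k))` in the polynomial algebra. -/
def bosSeries (t : K) : PowerSeries (Bos K) :=
  fexp K (series (fun k => 2 * (k : ℕ)) fun k =>
    ((1 - t⁻¹ ^ (k : ℕ)) / ((k : ℕ) : K)) • MvPolynomial.X k)

theorem coeff_VBminus_apply (t : K) (n : ℕ) (x : Bos K) :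
    PowerSeries.coeff n (VBminus t) x = PowerSeries.coeff n (bosSeries t) * x := by
  have h : VBminus t = PowerSeries.map (Algebra.lmul K (Bos K) : Bos K →+* _) (bosSeries t) := by
    rw [bosSeries, map_fexp, map_series two_mul_injective]
    simp only [RingHom.coe_coe, map_smul]
    rfl
  rw [h, PowerSeries.coeff_map]
  rfl

/-- The factor `V_B^{(-)}(w)` as a Laurent series. -/
def bosL (t : K) : LSer K := psL K (PowerSeries.map (inB K : Bos K →+* Fock K) (bosSeries t))

theorem bosL_comm (t : K) (x : LSer K) : bosL t * x = x * bosL t := psL_inB_comm _ _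

theorem VBplus_eq (q : K) :
    VBplus q = bosExp (fun k => 2 * (k : ℕ)) fun k => q ^ (k : ℕ) - 1 := rfl

theorem commute_wPow (x : LSer K) (n : ℤ) : Commute x (wPow K n) := (wPow_comm n x).symm

variable [CharZero K]

/-- The action of `V_B^{(+)}(w)` as a homomorphism. -/
def bosHom (q : K) : Bos K →ₐ[K] LSer K :=
  (isHasseSchmidt_bosExp two_mul_injective two_mul_ne_zero fun k => q ^ (k : ℕ) - 1).eval
    (bosExp_finite two_mul_injective two_mul_ne_zero _) ((constL K).comp (inB K)) (wPow K (-1))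
    fun _ => commute_wPow _ _

theorem bosHom_comm (q : K) (f : Bos K) (x : LSer K) : bosHom q f * x = x * bosHom q f := by
  obtain ⟨N, hN⟩ := bosExp_finite two_mul_injective two_mul_ne_zero
    (fun k : ℕ+ => q ^ (k : ℕ) - 1) f
  rw [bosHom, IsHasseSchmidt.eval_apply _ _ _ _ _ _ hN, Finset.sum_mul, Finset.mul_sum]
  refine Finset.sum_congr rfl fun n _ => ?_
  rw [wPow_pow, AlgHom.comp_apply, mul_assoc, wPow_comm, ← mul_assoc, constL_inB_comm, mul_assoc]

variable {M P : PowerSeries (Module.End K (Ext K))}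
  (hM : IsHasseSchmidt fun n => PowerSeries.coeff n M)
  (hP : IsHasseSchmidt fun n => PowerSeries.coeff n P)
  (hfin : ∀ x, ∃ N, ∀ n, N ≤ n → PowerSeries.coeff n P x = 0)

/-- The action of `⟨∅| M(w)` as a homomorphism. -/
def outHom : Ext K →ₐ[K] LSer K :=
  (psL K).comp ((PowerSeries.mapAlgHom ((inF K).comp (vacOutHom K))).comp hM.toPowerSeries)

/-- The operator `⟨∅| M(w) P(w) |∅⟩` as a homomorphism. -/
def fermHom : Grass K ℕ+ →ₐ[K] LSer K :=
  (hP.eval hfin (outHom hM) (wPow K (-1)) fun _ => commute_wPow _ _).comp (vacInHom K)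

/-- The operator `V_B^{(+)}(w) ⟨∅| M(w) P(w) |∅⟩` as a homomorphism. -/
def plusHom (q : K) (φ' : Grass K ℕ+ →ₐ[K] LSer K) : Fock K →ₐ[K] LSer K :=
  Algebra.TensorProduct.lift (bosHom q) φ' fun f g => commute_of_forall (bosHom_comm q f) (φ' g)

theorem plusHom_tmul (q : K) (φ' : Grass K ℕ+ →ₐ[K] LSer K) (f : Bos K) (g : Grass K ℕ+) :
    plusHom q φ' (f ⊗ₜ g) = bosHom q f * φ' g := rfl

omit [CharZero K] in
-- With b and d fixed, the residue condition selects the antidiagonal a + c = b + d - r, which lies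
-- in the box of side N; it is empty when b + d - r is negative.
theorem sum_coeff_eq_coeff_mul (x y : PowerSeries (Fock K)) (r : ℤ) (b d N : ℕ)
    (hN : b + d + r.natAbs < N) :
    (∑ a ∈ Finset.range N, ∑ c ∈ Finset.range N,
      if r + a - b + c - d = 0 then PowerSeries.coeff a x * PowerSeries.coeff c y else 0) =
      (psL K (x * y)).coeff (-r + b + d) := by
  rw [← Finset.sum_product', ← Finset.sum_filter]
  rcases lt_or_ge (-r + b + d) 0 with h | h
  · rw [coeff_psL_of_neg _ h]
    refine Finset.sum_eq_zero fun p hp => ?_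
    rw [Finset.mem_filter] at hp
    omega
  · obtain ⟨m, hm⟩ := Int.eq_ofNat_of_zero_le h
    rw [hm]
    refine Eq.trans ?_ (coeff_psL_natCast _ _).symm
    rw [PowerSeries.coeff_mul]
    refine Finset.sum_congr ?_ fun _ _ => rfl
    ext p
    simp only [Finset.mem_filter, Finset.mem_product, Finset.mem_range,
      Finset.HasAntidiagonal.mem_antidiagonal]
    omega

/-- The factors in w⁻¹ have finite expansions on f and g, and the residue condition then bounds the
exponents of the factors in w. The same finite box serves for local finiteness and for the value of
the sum. -/
theorem contourTerm_tmul (q t : K) (r : ℤ) (f : Bos K) (g : Grass K ℕ+) :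
    (Function.support fun i => contourTerm q t M P r i (f ⊗ₜ g)).Finite ∧
      ∑ᶠ i, contourTerm q t M P r i (f ⊗ₜ g) =
        (bosL t * plusHom q (fermHom hM hP hfin) (f ⊗ₜ g)).coeff (-r) := by
  obtain ⟨N₁, hN₁⟩ := bosExp_finite two_mul_injective two_mul_ne_zero
    (fun k : ℕ+ => q ^ (k : ℕ) - 1) f
  obtain ⟨N₂, hN₂⟩ := hfin (vacInHom K g)
  have hterm : ∀ a b c d, contourTerm q t M P r (a, b, c, d) (f ⊗ₜ g) =
      if r + a - b + c - d = 0 then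
        (PowerSeries.coeff a (bosSeries t) * PowerSeries.coeff b (VBplus q) f) ⊗ₜ[K]
          vacOutHom K (PowerSeries.coeff c M (PowerSeries.coeff d P (vacInHom K g))) else 0 := by
    intro a b c d
    simp only [contourTerm]
    split_ifs
    · rw [← coeff_VBminus_apply]
      rfl
    · rfl
  -- If b < N₁, d < N₂ and a + c = b + d - r, then both a and c are less than N.
  set N := N₁ + N₂ + r.natAbs + 1 with hN
  set S := Finset.range N ×ˢ Finset.range N₁ ×ˢ Finset.range N ×ˢ Finset.range N₂
  have hsupp : (Function.support fun i => contourTerm q t M P r i (f ⊗ₜ g)) ⊆ S := by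
    rintro ⟨a, b, c, d⟩ hi
    rw [Function.mem_support, hterm] at hi
    have h0 : r + a - b + c - d = 0 := by
      by_contra h
      rw [if_neg h] at hi
      exact hi rfl
    rw [if_pos h0] at hi
    have hb : b < N₁ := by
      by_contra h
      rw [VBplus_eq, hN₁ b (by omega), mul_zero, TensorProduct.zero_tmul] at hi
      exact hi rfl
    have hd : d < N₂ := by
      by_contra h
      rw [hN₂ d (by omega), map_zero, map_zero, TensorProduct.tmul_zero] at hi
      exact hi rfl
    simp only [S, Finset.coe_product, Finset.coe_range, Set.mem_prod, Set.mem_Iio]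
    omega
  refine ⟨S.finite_toSet.subset hsupp, ?_⟩
  rw [finsum_eq_sum_of_support_subset _ hsupp]
  have hφ : fermHom hM hP hfin g = ∑ d ∈ Finset.range N₂,
      outHom hM (PowerSeries.coeff d P (vacInHom K g)) * wPow K (-1) ^ d :=
    hP.eval_apply hfin (outHom hM) (wPow K (-1)) (fun _ => commute_wPow _ _) _ hN₂
  have hτ : bosHom q f = ∑ b ∈ Finset.range N₁,
      constL K (inB K (PowerSeries.coeff b (VBplus q) f)) * wPow K (-1) ^ b :=
    IsHasseSchmidt.eval_apply _ _ ((constL K).comp (inB K)) (wPow K (-1))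
      (fun _ => commute_wPow _ _) _ hN₁
  rw [plusHom_tmul, hφ, hτ, Finset.sum_mul_sum, Finset.mul_sum]
  simp only [Finset.mul_sum, HahnSeries.coeff_sum]
  rw [Finset.sum_product]
  simp only [Finset.sum_product]
  rw [Finset.sum_comm]
  refine Finset.sum_congr rfl fun b hb => ?_
  have hswap : ∀ a, (∑ c ∈ Finset.range N, ∑ d ∈ Finset.range N₂,
      contourTerm q t M P r (a, b, c, d) (f ⊗ₜ g)) = ∑ d ∈ Finset.range N₂,
      ∑ c ∈ Finset.range N, contourTerm q t M P r (a, b, c, d) (f ⊗ₜ g) := fun a =>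
    Finset.sum_comm
  simp only [hswap]
  rw [Finset.sum_comm]
  refine Finset.sum_congr rfl fun d hd => ?_
  rw [Finset.mem_range] at hb hd
  set y := PowerSeries.coeff d P (vacInHom K g)
  set z := PowerSeries.coeff b (VBplus q) f
  -- Powers of w are central, so all negative powers can be collected to the right of a genuine
  -- power series.
  have h1 : bosL t * (constL K (inB K z) * wPow K (-1) ^ b * (outHom hM y * wPow K (-1) ^ d)) =
      psL K ((PowerSeries.map (inB K : Bos K →+* Fock K) (bosSeries t) *
        PowerSeries.C (inB K z)) * PowerSeries.mapAlgHom ((inF K).comp (vacOutHom K))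
          (hM.toPowerSeries y)) * wPow K (-(b : ℤ) - d) := by
    have hC : constL K (inB K z) = psL K (PowerSeries.C (inB K z)) :=
      (HahnSeries.ofPowerSeries_C (inB K z)).symm
    rw [map_mul, map_mul, ← hC]
    change _ = bosL t * constL K (inB K z) * outHom hM y * _
    rw [wPow_pow, wPow_pow, mul_assoc (constL K (inB K z)), ← mul_assoc (wPow K _), wPow_comm,
      mul_assoc (outHom hM y), wPow_mul, mul_assoc, mul_assoc]
    congr 4
    ring
  rw [h1, coeff_mul_wPow, show -r - (-(b : ℤ) - d) = -r + b + d by ring,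
    ← sum_coeff_eq_coeff_mul _ _ r b d N (by omega)]
  refine Finset.sum_congr rfl fun a _ => Finset.sum_congr rfl fun c _ => ?_
  rw [hterm]
  congr 1
  rw [PowerSeries.coeff_mul_C, PowerSeries.coeff_map]
  change _ = _ * PowerSeries.coeff c (PowerSeries.map _ _)
  rw [PowerSeries.coeff_map, IsHasseSchmidt.coeff_toPowerSeries]
  change _ = (PowerSeries.coeff a (bosSeries t) ⊗ₜ[K] (1 : Grass K ℕ+) * z ⊗ₜ[K] (1 : Grass K ℕ+)) *
    ((1 : Bos K) ⊗ₜ[K] (vacOutHom K (PowerSeries.coeff c M y)))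
  rw [Algebra.TensorProduct.tmul_mul_tmul, Algebra.TensorProduct.tmul_mul_tmul, mul_one, mul_one,
    one_mul]

omit [CharZero K] in
theorem locFinite_of_tmul {ι : Type*} {F : ι → Module.End K (Fock K)}
    (h : ∀ f g, (Function.support fun i => F i (f ⊗ₜ g)).Finite) : LocFinite F := by
  intro v
  induction v using TensorProduct.induction_on with
  | zero => simp
  | tmul f g => exact h f g
  | add v w hv hw =>
    refine (hv.union hw).subset ?_
    simp only [map_add]
    exact Function.support_add _ _

include hM hP hfin in
theorem locFinite_contourTerm (q t : K) (r : ℤ) : LocFinite (contourTerm q t M P r) :=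
  locFinite_of_tmul fun f g => (contourTerm_tmul hM hP hfin q t r f g).1

omit [CharZero K] in
theorem locSum_apply {V ι : Type*} [AddCommGroup V] [Module K V] {F : ι → Module.End K V}
    (h : LocFinite F) (v : V) : locSum F v = ∑ᶠ i, F i v := by
  rw [locSum, dif_pos h]
  rfl

theorem contour_apply (q t : K) (r : ℤ) (v : Fock K) :
    contour q t M P r v = (bosL t * plusHom q (fermHom hM hP hfin) v).coeff (-r) := by
  induction v using TensorProduct.induction_on with
  | zero => simp
  | tmul f g =>
    rw [contour, locSum_apply (locFinite_contourTerm hM hP hfin q t r)]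
    exact (contourTerm_tmul hM hP hfin q t r f g).2
  | add v w hv hw => rw [map_add, map_add, mul_add, HahnSeries.coeff_add, hv, hw]

end Contour

/-! ### Series in the fermionic generators -/

section PiSeries

variable {K : Type*} [Field K]

/-- The series `∑ c k π_k w ^ (2 k)`. -/
def piSer (c : ℕ+ → K) : LSer K :=
  psL K (series (fun k => 2 * (k : ℕ)) fun k => c k • inF K (gen K k))

theorem piSer_add (c d : ℕ+ → K) : piSer c + piSer d = piSer fun k => c k + d k := by
  rw [piSer, piSer, ← map_add, series_add two_mul_injective, piSer]
  simp only [add_smul]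

theorem series_smul {A : Type*} [Ring A] [Algebra K A] {e : ℕ+ → ℕ} (he : Function.Injective e)
    (r : K) (f : ℕ+ → A) : r • series e f = series e fun k => r • f k := by
  ext n
  exact coeff_series_congr he (p := fun x => r • x) (p' := id) (smul_zero r) (fun _ => rfl) n

theorem smul_piSer (r : K) (c : ℕ+ → K) : r • piSer c = piSer fun k => r * c k := by
  rw [piSer, ← map_smul, series_smul two_mul_injective, piSer]
  simp only [smul_smul]

theorem piSer_zero : piSer (fun _ => (0 : K)) = 0 := by
  have h := smul_piSer (0 : K) fun _ => 0
  rw [zero_smul] at h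
  simpa only [zero_mul] using h.symm

theorem sum_piSer {ι : Type*} (s : Finset ι) (c : ι → ℕ+ → K) :
    ∑ i ∈ s, piSer (c i) = piSer fun k => ∑ i ∈ s, c i k := by
  classical
  induction s using Finset.induction_on with
  | empty => simp [piSer_zero]
  | insert i s hi ih => simp only [Finset.sum_insert hi, ih, piSer_add]

theorem inF_gen_mul_swap (j k : ℕ+) :
    inF K (gen K j) * inF K (gen K k) = -(inF K (gen K k) * inF K (gen K j)) := by
  have h : gen K j * gen K k = -(gen K k * gen K j) :=
    eq_neg_of_add_eq_zero_left (ExteriorAlgebra.ι_add_mul_swap _ _)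
  rw [← map_mul, ← map_mul, ← map_neg, h]

theorem piSer_mul_swap (c d : ℕ+ → K) : piSer c * piSer d = -(piSer d * piSer c) := by
  rw [piSer, piSer, ← map_mul, ← map_mul, ← map_neg]
  congr 1
  ext n
  rw [map_neg, PowerSeries.coeff_mul, PowerSeries.coeff_mul, ← Finset.Nat.sum_antidiagonal_swap,
    ← Finset.sum_neg_distrib]
  refine Finset.sum_congr rfl fun p _ => ?_
  rw [Prod.fst_swap, Prod.snd_swap]
  refine coeff_series_induction two_mul_injective
    (p := fun x => x * _ = -(_ * x)) (by rw [zero_mul, mul_zero, neg_zero]) (fun j => ?_) p.2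
  refine coeff_series_induction two_mul_injective
    (p := fun x => _ * x = -(x * _)) (by rw [zero_mul, mul_zero, neg_zero]) (fun k => ?_) p.1
  rw [smul_mul_smul_comm, smul_mul_smul_comm, inF_gen_mul_swap, smul_neg, mul_comm (c j)]

/-- Anticommutation only shows that twice the square vanishes; 2 is invertible in K. -/
theorem piSer_mul_self [CharZero K] (c : ℕ+ → K) : piSer c * piSer c = 0 := by
  have h : (2 : K) • (piSer c * piSer c) = 0 := by
    rw [two_smul]
    nth_rewrite 1 [piSer_mul_swap]
    exact neg_add_cancel _
  rw [← one_smul K (piSer c * piSer c), ← inv_mul_cancel₀ (two_ne_zero (α := K)), mul_smul, h,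
    smul_zero]

theorem piSer_single (l : ℕ+) (r : K) :
    (piSer fun k => if k = l then r else 0) = wPow K (2 * (l : ℤ)) * constL K (r • inF K (gen K l)) := by
  ext n
  rw [coeff_wPow_mul]
  change _ = (HahnSeries.single 0 _ : LSer K).coeff _
  rw [HahnSeries.coeff_single]
  rcases lt_or_ge n 0 with hn | hn
  · rw [piSer, coeff_psL_of_neg _ hn, if_neg (by have := l.pos; omega)]
  · obtain ⟨n, rfl⟩ := Int.eq_ofNat_of_zero_le hn
    rw [piSer]
    refine (coeff_psL_natCast _ _).trans ?_
    simp only [ite_smul, zero_smul]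
    rw [show (fun k : ℕ+ => if k = l then r • inF K (gen K k) else 0) =
      fun k : ℕ+ => if k = l then r • inF K (gen K l) else 0 by
        funext k; split_ifs with h <;> simp [h]]
    rw [coeff_series_single two_mul_injective]
    by_cases h : n = 2 * (l : ℕ)
    · rw [if_pos h, if_pos (by omega)]
    · rw [if_neg h, if_neg (by omega)]

theorem smul_wPow_mul (r : K) (n : ℤ) (x : LSer K) : r • (wPow K n * x) = wPow K n * (r • x) :=
  (mul_smul_comm r _ _).symm

theorem psL_series_odd (c : ℕ+ → K) :
    psL K (series (fun k => 2 * (k : ℕ) - 1) fun k => c k • inF K (gen K k)) =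
      wPow K (-1) * piSer c := by
  have h : (series (fun k => 2 * (k : ℕ)) fun k => c k • inF K (gen K k)) =
      PowerSeries.X * series (fun k => 2 * (k : ℕ) - 1) fun k => c k • inF K (gen K k) := by
    ext n
    rcases n with _ | n
    · rw [PowerSeries.coeff_zero_X_mul, coeff_series_eq_zero _ two_mul_ne_zero]
    · rw [PowerSeries.coeff_succ_X_mul]
      by_cases h : ∃ k : ℕ+, 2 * (k : ℕ) - 1 = n
      · obtain ⟨k, rfl⟩ := h
        have := k.pos
        rw [show 2 * (k : ℕ) - 1 + 1 = 2 * k by omega, coeff_series two_mul_injective,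
          coeff_series two_mul_sub_one_injective]
      · rw [coeff_series_eq_zero, coeff_series_eq_zero]
        · simpa using h
        · intro k hk
          exact h ⟨k, by omega⟩
  have hX : psL K PowerSeries.X = wPow K 1 := HahnSeries.ofPowerSeries_X
  rw [piSer, h, map_mul, hX, ← mul_assoc, wPow_mul]
  exact (one_mul _).symm

theorem mapAlgHom_toPowerSeries_coeff {M : PowerSeries (Module.End K (Ext K))}
    (hM : IsHasseSchmidt fun n => PowerSeries.coeff n M) (x : Ext K) (n : ℕ) :
    PowerSeries.coeff n (PowerSeries.mapAlgHom ((inF K).comp (vacOutHom K)) (hM.toPowerSeries x)) =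
      inF K (vacOutHom K (PowerSeries.coeff n M x)) := by
  change PowerSeries.coeff n (PowerSeries.map _ _) = _
  rw [PowerSeries.coeff_map, IsHasseSchmidt.coeff_toPowerSeries]
  rfl

variable [CharZero K] (a b : ℕ+ → K) (N : ℕ+ → ℕ) (c d : K)

theorem outHom_gen_inl (l : ℕ+) :
    outHom (isHasseSchmidt_fermMinus a N c) (gen K (Sum.inl l)) = constL K (inF K (gen K l)) := by
  rw [outHom, AlgHom.comp_apply, AlgHom.comp_apply]
  refine Eq.trans ?_ (HahnSeries.ofPowerSeries_C (inF K (gen K l)))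
  change psL K _ = psL K _
  congr 1
  ext n
  rw [mapAlgHom_toPowerSeries_coeff, fermMinus_inl, PowerSeries.coeff_C]
  split_ifs
  · rw [vacOutHom_gen_inl]
  · rw [map_zero, map_zero]

theorem outHom_gen_inr (m : ℕ) :
    outHom (isHasseSchmidt_fermMinus a N c) (gen K (Sum.inr m)) =
      wPow K (-1) * piSer fun k => if m < N k then a k * c ^ m else 0 := by
  rw [outHom, AlgHom.comp_apply, AlgHom.comp_apply, ← psL_series_odd]
  congr 1
  ext n
  rw [mapAlgHom_toPowerSeries_coeff, fermMinus_inr, map_add, map_add]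
  have h0 : inF K (vacOutHom K (if n = 0 then gen K (Sum.inr m) else 0)) = 0 := by
    split_ifs
    · rw [vacOutHom_gen_inr, map_zero]
    · rw [map_zero, map_zero]
  rw [h0, zero_add]
  refine coeff_series_congr two_mul_sub_one_injective (p := fun x => inF K (vacOutHom K x))
    (p' := id) ?_ (fun k => ?_) n
  · rw [map_zero, map_zero]
    rfl
  · simp only [id]
    split_ifs
    · rw [map_smul, map_smul, vacOutHom_gen_inl]
    · rw [map_zero, map_zero, zero_smul]

/-- The operator `⟨∅| M(w) P(w) |∅⟩` for a pair of fermionic exponentials. -/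
def fermPair : Grass K ℕ+ →ₐ[K] LSer K :=
  fermHom (isHasseSchmidt_fermMinus a N c) (isHasseSchmidt_fermPlus b N d) (fermPlus_finite b N d)

/-- Wick contraction on a generator: `fermPlus` turns π_l into itself plus modes ψ_m† with m < N l,
and each ψ_m† becomes the π_k with m < N k. The pair (l, k) therefore collects a geometric sum over
m < min (N k) (N l). -/
theorem fermPair_gen (l : ℕ+) : fermPair a b N c d (gen K l) = wPow K (-2 * (l : ℤ)) *
    piSer fun k => (if k = l then 1 else 0) +
      a k * b l * ∑ m ∈ Finset.range (min (N k) (N l)), (c * d) ^ m := by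
  have hl := l.pos
  rw [fermPair, fermHom, AlgHom.comp_apply, vacInHom_gen,
    -- Only the degrees 0 and 2l - 1 occur in the image of π_l.
    IsHasseSchmidt.eval_apply _ _ _ _ (fun _ => commute_wPow _ _) _ (N := 2 * l)]
  swap
  · intro n hn
    rw [fermPlus_inl, if_neg (by omega), if_neg (by omega), add_zero]
  have h1 : ∀ n, outHom (isHasseSchmidt_fermMinus a N c)
      (PowerSeries.coeff n (fermPlus b N d) (gen K (Sum.inl l))) * wPow K (-1) ^ n =
      (if n = 0 then constL K (inF K (gen K l)) else 0) +
      if n = 2 * (l : ℕ) - 1 then wPow K (-2 * (l : ℤ)) * piSer fun k =>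
        a k * b l * ∑ m ∈ Finset.range (min (N k) (N l)), (c * d) ^ m else 0 := by
    intro n
    rw [fermPlus_inl, map_add, add_mul]
    congr 1
    · split_ifs with h
      · rw [outHom_gen_inl, h, pow_zero, mul_one]
      · rw [map_zero, zero_mul]
    · split_ifs with h
      · rw [map_smul, map_sum]
        simp only [map_smul, outHom_gen_inr, smul_wPow_mul]
        rw [← Finset.mul_sum, wPow_pow, smul_mul_assoc, ← wPow_comm, ← mul_assoc, wPow_mul,
          smul_wPow_mul, h]
        have he : ((2 * (l : ℕ) - 1 : ℕ) : ℤ) * -1 + -1 = -2 * (l : ℤ) := by omega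
        rw [he]
        congr 1
        simp only [smul_piSer, sum_piSer]
        congr 1
        funext k
        rw [mul_comm (a k), mul_assoc]
        congr 1
        rw [Finset.mul_sum, ← Finset.sum_filter_add_sum_filter_not (Finset.range (N l)) (fun m => m < N k),
          Finset.sum_eq_zero (s := (Finset.range (N l)).filter fun m => ¬ m < N k), add_zero]
        · refine Finset.sum_congr ?_ fun m hm => ?_
          · ext m
            simp only [Finset.mem_filter, Finset.mem_range, lt_min_iff]
            tauto
          · rw [Finset.mem_range, lt_min_iff] at hm
            rw [if_pos hm.1, mul_pow]
            ring
        · intro m hm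
          rw [if_neg (Finset.mem_filter.1 hm).2, mul_zero]
      · rw [map_zero, zero_mul]
  simp only [h1]
  rw [Finset.sum_add_distrib, Finset.sum_ite_eq', Finset.sum_ite_eq',
    if_pos (Finset.mem_range.2 (by omega)), if_pos (Finset.mem_range.2 (by omega)), ← piSer_add,
    mul_add, piSer_single, ← mul_assoc, wPow_mul, one_smul,
    show -2 * (l : ℤ) + 2 * l = 0 by ring, wPow_zero, one_mul]

end PiSeries

/-! ### Vertex operators as homomorphisms -/

section Vertex

variable {K : Type*} [Field K]

theorem liftF_create_apply (k : ℕ+) (v : Fock K) : piOp K k v = inF K (gen K k) * v := by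
  induction v using TensorProduct.induction_on with
  | zero => simp
  | tmul f g =>
    change f ⊗ₜ[K] (gen K k * g) = ((1 : Bos K) ⊗ₜ[K] gen K k) * (f ⊗ₜ[K] g)
    rw [Algebra.TensorProduct.tmul_mul_tmul, one_mul]
  | add v w hv hw => rw [map_add, mul_add, hv, hw]

theorem dpiOp_pi_mul (k a : ℕ+) (v : Fock K) :
    dpiOp K k (inF K (gen K a) * v) = (if a = k then v else 0) - inF K (gen K a) * dpiOp K k v := by
  induction v using TensorProduct.induction_on with
  | zero => simp
  | tmul f g =>
    have h : ∀ g, inF K (gen K a) * (f ⊗ₜ[K] g) = f ⊗ₜ[K] (gen K a * g) := fun g => by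
      change ((1 : Bos K) ⊗ₜ[K] gen K a) * (f ⊗ₜ[K] g) = _
      rw [Algebra.TensorProduct.tmul_mul_tmul, one_mul]
    have h' : ∀ g, dpiOp K k (f ⊗ₜ[K] g) = f ⊗ₜ[K] annih K k g := fun _ => rfl
    rw [h, h', h', annih_gen_mul, TensorProduct.tmul_sub, h]
    split_ifs <;> simp
  | add v w hv hw =>
    rw [mul_add, map_add, map_add, mul_add, hv, hw]
    split_ifs
    · abel
    · abel

theorem exists_dpiOp_eq_zero (v : Fock K) : ∃ N : ℕ, ∀ k : ℕ+, N ≤ k → dpiOp K k v = 0 := by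
  induction v using TensorProduct.induction_on with
  | zero => exact ⟨0, fun k _ => map_zero _⟩
  | tmul f g =>
    obtain ⟨N, hN⟩ := exists_annih_eq_zero g
    refine ⟨N, fun k hk => ?_⟩
    change f ⊗ₜ[K] annih K k g = 0
    rw [hN k hk, TensorProduct.tmul_zero]
  | add v w hv hw =>
    obtain ⟨M, hM⟩ := hv
    obtain ⟨N, hN⟩ := hw
    refine ⟨max M N, fun k hk => ?_⟩
    rw [map_add, hM k (le_trans (le_max_left _ _) hk), hN k (le_trans (le_max_right _ _) hk),
      add_zero]

theorem finite_support_of_dpiOp {A : Type*} [AddCommGroup A] {f : ℕ+ → A} (v : Fock K)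
    (h : ∀ k, dpiOp K k v = 0 → f k = 0) : (Function.support f).Finite := by
  obtain ⟨N, hN⟩ := exists_dpiOp_eq_zero v
  refine (Set.finite_Iio (Nat.succPNat N)).subset fun k hk => ?_
  by_contra hk'
  refine hk (h k (hN k ?_))
  rw [Set.mem_Iio, not_lt, ← PNat.coe_le_coe, Nat.succPNat_coe] at hk'
  omega

/-- The operator `∑ q ^ k w ^ (-2 k) T ∂/∂π_k`. -/
def dSum (q : K) (T : Fock K →ₗ[K] LSer K) : Fock K →ₗ[K] LSer K where
  toFun v := ∑ᶠ k : ℕ+, q ^ (k : ℕ) • (wPow K (-2 * (k : ℤ)) * T (dpiOp K k v))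
  map_add' v w := by
    rw [← finsum_add_distrib]
    · simp only [map_add, mul_add, smul_add]
    · exact finite_support_of_dpiOp v fun k hk => by rw [hk, map_zero, mul_zero, smul_zero]
    · exact finite_support_of_dpiOp w fun k hk => by rw [hk, map_zero, mul_zero, smul_zero]
  map_smul' r v := by
    rw [RingHom.id_apply, smul_finsum']
    · refine finsum_congr fun k => ?_
      rw [map_smul, map_smul, mul_smul_comm, smul_comm]
    · exact finite_support_of_dpiOp v fun k hk => by rw [hk, map_zero, mul_zero, smul_zero]

theorem dSum_apply (q : K) (T : Fock K →ₗ[K] LSer K) (v : Fock K) :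
    dSum q T v = ∑ᶠ k : ℕ+, q ^ (k : ℕ) • (wPow K (-2 * (k : ℤ)) * T (dpiOp K k v)) := rfl

theorem coeff_dSum (q : K) (T : Fock K →ₗ[K] LSer K) (v : Fock K) (n : ℤ) :
    (dSum q T v).coeff n =
      ∑ᶠ k : ℕ+, q ^ (k : ℕ) • (T (dpiOp K k v)).coeff (n + 2 * (k : ℤ)) := by
  rw [dSum_apply]
  have h := AddMonoidHom.map_finsum (HahnSeries.coeff.addMonoidHom n : LSer K →+ Fock K)
    (f := fun k : ℕ+ => q ^ (k : ℕ) • (wPow K (-2 * (k : ℤ)) * T (dpiOp K k v)))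
    (finite_support_of_dpiOp v fun k hk => by rw [hk, map_zero, mul_zero, smul_zero])
  refine h.trans (finsum_congr fun k => ?_)
  change q ^ (k : ℕ) • (wPow K (-2 * (k : ℤ)) * T (dpiOp K k v)).coeff n = _
  rw [coeff_wPow_mul]
  congr 2
  ring

/-- This is ∂_k π_a = δ_{ka} - π_a ∂_k, summed over k with p taken out on the left. -/
theorem dSum_pi_mul (q : K) {T : Fock K →ₗ[K] LSer K} {p : LSer K} {a : ℕ+}
    (h : ∀ v, T (inF K (gen K a) * v) = p * T v) (v : Fock K) :
    dSum q T (inF K (gen K a) * v) =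
      q ^ (a : ℕ) • (wPow K (-2 * (a : ℤ)) * T v) - p * dSum q T v := by
  have hp : p * dSum q T v =
      ∑ᶠ k : ℕ+, q ^ (k : ℕ) • (wPow K (-2 * (k : ℤ)) * (p * T (dpiOp K k v))) := by
    have := AddMonoidHom.map_finsum (AddMonoidHom.mulLeft p)
      (f := fun k : ℕ+ => q ^ (k : ℕ) • (wPow K (-2 * (k : ℤ)) * T (dpiOp K k v)))
      (finite_support_of_dpiOp v fun k hk => by rw [hk, map_zero, mul_zero, smul_zero])
    refine this.trans (finsum_congr fun k => ?_)
    rw [AddMonoidHom.coe_mulLeft, mul_smul_comm, ← mul_assoc, ← wPow_comm, mul_assoc]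
  have h1 : ∀ k : ℕ+, q ^ (k : ℕ) • (wPow K (-2 * (k : ℤ)) *
      T (dpiOp K k (inF K (gen K a) * v))) =
      (if k = a then q ^ (a : ℕ) • (wPow K (-2 * (a : ℤ)) * T v) else 0) -
      q ^ (k : ℕ) • (wPow K (-2 * (k : ℤ)) * (p * T (dpiOp K k v))) := by
    intro k
    rw [dpiOp_pi_mul, map_sub, h, mul_sub, smul_sub]
    congr 1
    by_cases hk : k = a
    · rw [hk, if_pos rfl, if_pos rfl]
    · rw [if_neg (Ne.symm hk), if_neg hk, map_zero, mul_zero, smul_zero]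
  rw [dSum_apply, finsum_congr h1, finsum_sub_distrib, hp]
  · congr 1
    rw [finsum_eq_single _ a fun k hk => if_neg hk, if_pos rfl]
  · refine (Set.finite_singleton a).subset fun k hk => ?_
    by_contra hk'
    exact hk (if_neg hk')
  · exact finite_support_of_dpiOp v fun k hk => by
      rw [hk, map_zero, mul_zero, mul_zero, smul_zero]

theorem dSum_inB (q : K) (T : Fock K →ₗ[K] LSer K) (f : Bos K) : dSum q T (inB K f) = 0 := by
  rw [dSum_apply]
  refine (finsum_congr fun k => ?_).trans finsum_zero
  have : dpiOp K k (inB K f) = 0 := by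
    change f ⊗ₜ[K] annih K k 1 = 0
    rw [annih_one, TensorProduct.tmul_zero]
  rw [this, map_zero, mul_zero, smul_zero]

/-- The sign from moving b past p cancels the sign in `dSum_pi_mul`, and the term quadratic in b
vanishes. So T + b·D is again multiplicative in π_a, with p replaced by p + q^a w^{-2a} b. -/
theorem rank_one_pi_mul (q : K) {T : Fock K →ₗ[K] LSer K} {p b : LSer K} {a : ℕ+}
    (hT : ∀ v, T (inF K (gen K a) * v) = p * T v) (hbp : p * b = -(b * p)) (hb : b * b = 0)
    (v : Fock K) :
    T (inF K (gen K a) * v) + b * dSum q T (inF K (gen K a) * v) =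
      (p + q ^ (a : ℕ) • (wPow K (-2 * (a : ℤ)) * b)) * (T v + b * dSum q T v) := by
  rw [hT, dSum_pi_mul q hT]
  have e1 : wPow K (-2 * (a : ℤ)) * b * (b * dSum q T v) = 0 := by
    rw [mul_assoc, ← mul_assoc b, hb, zero_mul, mul_zero]
  have e2 : p * (b * dSum q T v) = -(b * (p * dSum q T v)) := by
    rw [← mul_assoc, hbp, neg_mul, mul_assoc]
  rw [add_mul, mul_add, mul_add, e2, smul_mul_assoc, smul_mul_assoc, e1, smul_zero, add_zero,
    mul_sub, mul_smul_comm, ← mul_assoc b (wPow K _), ← wPow_comm]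
  abel

theorem fock_induction {P : Fock K → Prop} (hB : ∀ f, P (inB K f))
    (hsmul : ∀ (c : K) v, P v → P (c • v)) (hadd : ∀ v w, P v → P w → P (v + w))
    (hmul : ∀ a v, P v → P (inF K (gen K a) * v)) (v : Fock K) : P v := by
  induction v using TensorProduct.induction_on with
  | zero =>
    have h := hB 0
    rwa [map_zero] at h
  | add v w hv hw => exact hadd v w hv hw
  | tmul f g =>
    induction g using grass_left_induction with
    | h1 => exact hB f
    | hsmul c x hx =>
      rw [TensorProduct.tmul_smul]
      exact hsmul c _ hx
    | hadd x y hx hy =>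
      rw [TensorProduct.tmul_add]
      exact hadd _ _ hx hy
    | hmul i x hx =>
      have h : f ⊗ₜ[K] (gen K i * x) = inF K (gen K i) * (f ⊗ₜ[K] x) := by
        change _ = ((1 : Bos K) ⊗ₜ[K] gen K i) * (f ⊗ₜ[K] x)
        rw [Algebra.TensorProduct.tmul_mul_tmul, one_mul]
      rw [h]
      exact hmul i _ hx

/-- Both sides agree on purely bosonic elements, where the derivative sum vanishes, and obey the
same rule under multiplication by each π_a. -/
theorem rank_one_update (q : K) {T T' : Fock K →ₗ[K] LSer K} {p p' : ℕ+ → LSer K} {b : LSer K}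
    (h1 : ∀ f, T' (inB K f) = T (inB K f))
    (hT : ∀ a v, T (inF K (gen K a) * v) = p a * T v)
    (hT' : ∀ a v, T' (inF K (gen K a) * v) = p' a * T' v)
    (hp : ∀ a, p' a = p a + q ^ (a : ℕ) • (wPow K (-2 * (a : ℤ)) * b))
    (hbp : ∀ a, p a * b = -(b * p a)) (hb : b * b = 0) (v : Fock K) :
    T' v = T v + b * dSum q T v := by
  induction v using fock_induction with
  | hB f => rw [dSum_inB, mul_zero, add_zero, h1]
  | hsmul c v hv => rw [map_smul, map_smul, map_smul, hv, smul_add, mul_smul_comm]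
  | hadd v w hv hw =>
    simp only [map_add, mul_add, hv, hw]
    abel
  | hmul a v hv => rw [hT', rank_one_pi_mul q (hT a) (hbp a) hb, hv, hp]

/-- The operator `f ⊗ g ↦ V_B^{(-)}(w) A(f) B(g)`. -/
def vertex (t : K) (A : Bos K →ₐ[K] LSer K) (hA : ∀ f x, A f * x = x * A f)
    (B : Grass K ℕ+ →ₐ[K] LSer K) : Fock K →ₗ[K] LSer K :=
  LinearMap.mulLeft K (bosL t) ∘ₗ
    (Algebra.TensorProduct.lift A B fun f g => commute_of_forall (hA f) (B g)).toLinearMap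

variable (t : K) (A : Bos K →ₐ[K] LSer K) (hA : ∀ f x, A f * x = x * A f)
    (B : Grass K ℕ+ →ₐ[K] LSer K)

theorem vertex_tmul (f : Bos K) (g : Grass K ℕ+) :
    vertex t A hA B (f ⊗ₜ g) = bosL t * (A f * B g) := rfl

theorem vertex_inB (f : Bos K) : vertex t A hA B (inB K f) = bosL t * A f := by
  change vertex t A hA B (f ⊗ₜ 1) = _
  rw [vertex_tmul, map_one, mul_one]

theorem vertex_pi_mul (a : ℕ+) (v : Fock K) :
    vertex t A hA B (inF K (gen K a) * v) = B (gen K a) * vertex t A hA B v := by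
  have h : Algebra.TensorProduct.lift A B (fun f g => commute_of_forall (hA f) (B g)) (inF K (gen K a)) = B (gen K a) := by
    change Algebra.TensorProduct.lift A B _ ((1 : Bos K) ⊗ₜ[K] gen K a) = _
    rw [Algebra.TensorProduct.lift_tmul, map_one, one_mul]
  change bosL t * Algebra.TensorProduct.lift A B (fun f g => commute_of_forall (hA f) (B g)) _ =
    B (gen K a) * (bosL t * Algebra.TensorProduct.lift A B (fun f g => commute_of_forall (hA f) (B g)) v)
  rw [map_mul, h, ← mul_assoc, bosL_comm, mul_assoc]

theorem contour_eq_vertex [CharZero K] {M P : PowerSeries (Module.End K (Ext K))}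
    (hM : IsHasseSchmidt fun n => PowerSeries.coeff n M)
    (hP : IsHasseSchmidt fun n => PowerSeries.coeff n P)
    (hfin : ∀ x, ∃ N, ∀ n, N ≤ n → PowerSeries.coeff n P x = 0) (q : K) (r : ℤ) (v : Fock K) :
    contour q t M P r v =
      (vertex t (bosHom q) (bosHom_comm q) (fermHom hM hP hfin) v).coeff (-r) :=
  contour_apply hM hP hfin q t r v

end Vertex

/-! ### The operators `c̃_k` -/

section CTilde

variable {K : Type*} [Field K]

theorem liftB_isHasseSchmidt {F : ℕ → Module.End K (Bos K)} (hF : IsHasseSchmidt F) :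
    IsHasseSchmidt fun n => liftB (F n) where
  map_one n := by
    change F n 1 ⊗ₜ[K] (1 : Grass K ℕ+) = _
    rw [hF.map_one]
    split_ifs
    · rfl
    · exact TensorProduct.zero_tmul _ _
  map_mul n x y := by
    induction x using TensorProduct.induction_on with
    | zero => simp
    | add x x' hx hx' => simp only [add_mul, map_add, hx, hx', Finset.sum_add_distrib]
    | tmul f g =>
      induction y using TensorProduct.induction_on with
      | zero => simp
      | add y y' hy hy' => simp only [mul_add, map_add, hy, hy', Finset.sum_add_distrib]
      | tmul f' g' =>
        rw [Algebra.TensorProduct.tmul_mul_tmul]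
        change F n (f * f') ⊗ₜ[K] (g * g') =
          ∑ p ∈ Finset.HasAntidiagonal.antidiagonal n, (F p.1 f ⊗ₜ[K] g) * (F p.2 f' ⊗ₜ[K] g')
        simp only [Algebra.TensorProduct.tmul_mul_tmul]
        rw [hF.map_mul, TensorProduct.sum_tmul]

theorem liftB_finite {F : ℕ → Module.End K (Bos K)} (hF : ∀ x, ∃ N, ∀ n, N ≤ n → F n x = 0)
    (v : Fock K) : ∃ N, ∀ n, N ≤ n → liftB (F n) v = 0 := by
  induction v using TensorProduct.induction_on with
  | zero => exact ⟨0, fun n _ => map_zero _⟩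
  | tmul f g =>
    obtain ⟨N, hN⟩ := hF f
    refine ⟨N, fun n hn => ?_⟩
    change F n f ⊗ₜ[K] g = 0
    rw [hN n hn, TensorProduct.zero_tmul]
  | add v w hv hw =>
    obtain ⟨M, hM⟩ := hv
    obtain ⟨N, hN⟩ := hw
    refine ⟨max M N, fun n hn => ?_⟩
    rw [map_add, hM n (le_trans (le_max_left _ _) hn), hN n (le_trans (le_max_right _ _) hn),
      add_zero]

/-- The linear operators on an algebra. -/
abbrev AlgEnd (K : Type*) [Field K] (B : Type*) [Ring B] [Algebra K B] : Type _ := Module.End K B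

/-- The coefficientwise action of an operator on Laurent series. -/
def coeffMap (D : Module.End K (Fock K)) : AlgEnd K (LSer K) where
  toFun x := x.map D
  map_add' x y := by
    ext n
    simp
  map_smul' c x := by
    ext n
    simp

@[simp]
theorem coeff_coeffMap (D : Module.End K (Fock K)) (x : LSer K) (n : ℤ) :
    (coeffMap D x).coeff n = D (x.coeff n) := rfl

theorem coeff_smul_powerSeries {A : Type*} [Ring A] [Algebra K A] (c : K) (x : PowerSeries A)
    (n : ℕ) : PowerSeries.coeff n (c • x) = c • PowerSeries.coeff n x := rfl

/-- The product rule holds coefficient by coefficient; the care needed is about supports, which may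
shrink when an operator is applied. -/
theorem coeffMap_isHasseSchmidt {F : ℕ → Module.End K (Fock K)} (hF : IsHasseSchmidt F) :
    IsHasseSchmidt (B := LSer K) fun n => coeffMap (F n) where
  map_one n := by
    ext m
    rw [coeff_coeffMap, HahnSeries.coeff_one]
    by_cases hm : m = 0
    · rw [if_pos hm, hF.map_one]
      split_ifs
      · rw [hm]
        exact (HahnSeries.coeff_single_same (0 : ℤ) (1 : Fock K)).symm
      · rfl
    · rw [if_neg hm, map_zero]
      split_ifs
      · rw [HahnSeries.coeff_one, if_neg hm]
      · rfl
  map_mul n x y := by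
    ext m
    rw [coeff_coeffMap, HahnSeries.coeff_mul, map_sum, HahnSeries.coeff_sum]
    simp only [hF.map_mul]
    rw [Finset.sum_comm]
    refine Finset.sum_congr rfl fun p _ => ?_
    have hx : (coeffMap (F p.1) x).support ⊆ x.support := by
      intro i hi hi'
      exact hi (by rw [coeff_coeffMap, hi', map_zero])
    -- The sum for the image of x is enlarged to the support of x itself, so that both sides can be
    -- compared on the antidiagonal of the original supports.
    rw [HahnSeries.coeff_mul_left' x.isPWO_support hx]
    refine (Finset.sum_subset ?_ ?_).symm
    · intro ij
      simp only [Finset.mem_antidiagonal]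
      rintro ⟨h1, h2, h3⟩
      refine ⟨h1, ?_, h3⟩
      intro h
      exact h2 (by rw [coeff_coeffMap, h, map_zero])
    · intro ij h1 h2
      simp only [Finset.mem_antidiagonal] at h1 h2
      have : (coeffMap (F p.2) y).coeff ij.2 = 0 := by
        by_contra h
        exact h2 ⟨h1.1, h, h1.2.2⟩
      rw [coeff_coeffMap] at this
      rw [this, mul_zero]

theorem coeffMap_wPow_mul (D : Module.End K (Fock K)) (n : ℤ) (x : LSer K) :
    coeffMap D (wPow K n * x) = wPow K n * coeffMap D x := by
  ext m
  rw [coeff_coeffMap, coeff_wPow_mul, coeff_wPow_mul, coeff_coeffMap]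

theorem coeffMap_constL (D : Module.End K (Fock K)) (x : Fock K) :
    coeffMap D (constL K x) = constL K (D x) := by
  ext m
  change D ((HahnSeries.single 0 x : LSer K).coeff m) = (HahnSeries.single 0 (D x) : LSer K).coeff m
  rw [HahnSeries.coeff_single, HahnSeries.coeff_single]
  split_ifs
  · rfl
  · exact map_zero _

theorem PNat_coe_injective : Function.Injective fun n : ℕ+ => (n : ℕ) := PNat.coe_injective

theorem cTilde_eq (q : K) (n : ℕ) : cTilde q n =
    PowerSeries.coeff n (bosExp (fun n => (n : ℕ)) fun n => q⁻¹ ^ (n : ℕ) - 1) := rfl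

theorem cTilde_X (q : K) (k : ℕ+) (n : ℕ) : cTilde q n (MvPolynomial.X k) =
    (if n = 0 then MvPolynomial.X k else 0) +
      if n = k then algebraMap K (Bos K) (q⁻¹ ^ (k : ℕ) - 1) else 0 := by
  rw [cTilde_eq, bosExp_X PNat_coe_injective fun k => k.ne_zero]

/-- The operators `c̃_k` on supersymmetric polynomials. -/
def cF (q : K) (n : ℕ) : Module.End K (Fock K) := liftB (cTilde q n)

theorem cF_inB (q : K) (n : ℕ) (f : Bos K) : cF q n (inB K f) = inB K (cTilde q n f) := rfl

theorem dpiOp_cF (q : K) (n : ℕ) (k : ℕ+) (v : Fock K) :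
    dpiOp K k (cF q n v) = cF q n (dpiOp K k v) := by
  induction v using TensorProduct.induction_on with
  | zero => simp
  | tmul f g => rfl
  | add v w hv hw => simp only [map_add, hv, hw]

variable [CharZero K]

theorem isHasseSchmidt_cTilde (q : K) : IsHasseSchmidt (cTilde q) :=
  isHasseSchmidt_bosExp PNat_coe_injective (fun k => k.ne_zero) _

theorem cTilde_finite (q : K) (x : Bos K) : ∃ N, ∀ n, N ≤ n → cTilde q n x = 0 :=
  bosExp_finite PNat_coe_injective (fun k => k.ne_zero) _ x

theorem isHasseSchmidt_cF (q : K) : IsHasseSchmidt (cF q) :=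
  liftB_isHasseSchmidt (isHasseSchmidt_cTilde q)

theorem cF_finite (q : K) (v : Fock K) : ∃ N, ∀ n, N ≤ n → cF q n v = 0 :=
  liftB_finite (cTilde_finite q) v

theorem cF_inF (q : K) (n : ℕ) (g : Grass K ℕ+) :
    cF q n (inF K g) = if n = 0 then inF K g else 0 := by
  change cTilde q n 1 ⊗ₜ[K] g = _
  rw [(isHasseSchmidt_cTilde q).map_one]
  split_ifs
  · rfl
  · exact TensorProduct.zero_tmul _ _

/-- The series c(z) is a homomorphism with p_k ↦ p_k + (q^{-k} - 1) z^{-k}. Applied to V_B^{(-)}(w)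
it produces the factor exp(∑ (1 - t^{-k})(q^{-k} - 1)/k · (w²/z)^k), which `fexp_logSeries`
evaluates. In the proof the inner power series variable is z⁻¹ and the outer one is w. -/
theorem cTilde_bosSeries (q t : K) (i n : ℕ) :
    cTilde q i (PowerSeries.coeff n (bosSeries t)) = if 2 * i ≤ n then
      structCoeff q⁻¹ t⁻¹ i • PowerSeries.coeff (n - 2 * i) (bosSeries t) else 0 := by
  let γ := (isHasseSchmidt_cTilde q).toPowerSeries
  let C' : Bos K →ₐ[K] PowerSeries (Bos K) :=
    { (PowerSeries.C : Bos K →+* PowerSeries (Bos K)) with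
      commutes' := fun _ => PowerSeries.algebraMap_apply.symm }
  have hγ : ∀ k, γ (MvPolynomial.X k) =
      C' (MvPolynomial.X k) + (q⁻¹ ^ (k : ℕ) - 1) • PowerSeries.X ^ (k : ℕ) := by
    intro k
    ext1 m
    rw [IsHasseSchmidt.coeff_toPowerSeries, cTilde_X, map_add]
    congr 1
    · exact (PowerSeries.coeff_C m _).symm
    · rw [coeff_smul_powerSeries, PowerSeries.coeff_X_pow]
      split_ifs
      · exact Algebra.algebraMap_eq_smul_one _
      · exact (smul_zero _).symm
  have h : PowerSeries.map (γ : Bos K →+* PowerSeries (Bos K)) (bosSeries t) =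
      PowerSeries.map (C' : Bos K →+* PowerSeries (Bos K)) (bosSeries t) *
        evenSeries fun m => structCoeff q⁻¹ t⁻¹ m • PowerSeries.X ^ m := by
    rw [← fexp_logSeries, bosSeries, map_fexp, map_fexp, map_series two_mul_injective,
      map_series two_mul_injective, ← fexp_add (Commute.all _ _)
        (coeff_series_eq_zero _ two_mul_ne_zero) (coeff_series_eq_zero _ two_mul_ne_zero),
      series_add two_mul_injective]
    congr 2
    funext k
    simp only [RingHom.coe_coe, map_smul, hγ, smul_add, smul_smul]
  have h2 : cTilde q i (PowerSeries.coeff n (bosSeries t)) =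
      PowerSeries.coeff i (PowerSeries.coeff n
        (PowerSeries.map (γ : Bos K →+* PowerSeries (Bos K)) (bosSeries t))) := by
    rw [PowerSeries.coeff_map]
    exact ((isHasseSchmidt_cTilde q).coeff_toPowerSeries _ _).symm
  rw [h2, h, PowerSeries.coeff_mul, map_sum]
  have hterm : ∀ p : ℕ × ℕ, PowerSeries.coeff i
      (PowerSeries.coeff p.1 (PowerSeries.map (C' : Bos K →+* PowerSeries (Bos K)) (bosSeries t)) *
        PowerSeries.coeff p.2 (evenSeries fun m =>
          structCoeff q⁻¹ t⁻¹ m • (PowerSeries.X : PowerSeries (Bos K)) ^ m)) =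
      if p.2 = 2 * i then structCoeff q⁻¹ t⁻¹ i • PowerSeries.coeff p.1 (bosSeries t) else 0 := by
    intro p
    rw [PowerSeries.coeff_map, evenSeries, PowerSeries.coeff_mk]
    change PowerSeries.coeff i (PowerSeries.C _ * _) = _
    rw [PowerSeries.coeff_C_mul]
    by_cases he : Even p.2
    · obtain ⟨m, hm⟩ := even_iff_two_dvd.1 he
      rw [if_pos he, coeff_smul_powerSeries, PowerSeries.coeff_X_pow, hm, Nat.mul_div_cancel_left _ two_pos]
      by_cases him : i = m
      · rw [if_pos him, if_pos (by omega), him, mul_smul_comm, mul_one]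
      · rw [if_neg him, if_neg (by omega), smul_zero, mul_zero]
    · rw [if_neg he, map_zero, mul_zero, if_neg]
      intro h
      exact he ⟨i, by omega⟩
  simp only [hterm]
  split_ifs with hn
  · rw [Finset.sum_eq_single (n - 2 * i, 2 * i), if_pos rfl]
    · rintro ⟨a, b⟩ hp hne
      rw [Finset.HasAntidiagonal.mem_antidiagonal] at hp
      refine if_neg fun hb => hne ?_
      simp only at hp hb
      rw [Prod.mk.injEq]
      omega
    · intro hp
      refine absurd ?_ hp
      rw [Finset.HasAntidiagonal.mem_antidiagonal]
      exact Nat.sub_add_cancel hn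
  · refine Finset.sum_eq_zero fun p hp => if_neg ?_
    rw [Finset.HasAntidiagonal.mem_antidiagonal] at hp
    omega

theorem coeffMap_bosL (q t : K) (i : ℕ) :
    coeffMap (cF q i) (bosL t) = structCoeff q⁻¹ t⁻¹ i • (wPow K (2 * (i : ℤ)) * bosL t) := by
  ext n
  rw [coeff_coeffMap, HahnSeries.coeff_smul, coeff_wPow_mul, bosL]
  rcases lt_or_ge n 0 with hn | hn
  · rw [coeff_psL_of_neg _ hn, coeff_psL_of_neg _ (by omega), map_zero, smul_zero]
  · obtain ⟨m, rfl⟩ := Int.eq_ofNat_of_zero_le hn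
    have h1 : ∀ k : ℕ, (psL K (PowerSeries.map (inB K : Bos K →+* Fock K) (bosSeries t))).coeff
        (k : ℤ) = inB K (PowerSeries.coeff k (bosSeries t)) := fun k =>
      (coeff_psL_natCast _ k).trans (PowerSeries.coeff_map _ _ _)
    refine (congrArg (cF q i) (h1 m)).trans ?_
    rw [cF_inB, cTilde_bosSeries]
    split_ifs with h
    · rw [map_smul, show ((m : ℤ) - 2 * (i : ℤ)) = ((m - 2 * i : ℕ) : ℤ) by
        push_cast [h]; rfl, h1]
    · rw [map_zero, coeff_psL_of_neg, smul_zero]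
      omega

theorem bosHom_X (q : K) (k : ℕ+) : bosHom q (MvPolynomial.X k) =
    constL K (inB K (MvPolynomial.X k)) + (q ^ (k : ℕ) - 1) • wPow K (-2 * (k : ℤ)) := by
  have hk := k.pos
  rw [bosHom, IsHasseSchmidt.eval_apply _ _ _ _ (fun _ => commute_wPow _ _) _ (N := 2 * k + 1)]
  · have h1 : ∀ n, ((constL K).comp (inB K)) (PowerSeries.coeff n
        (bosExp (fun k => 2 * (k : ℕ)) fun k => q ^ (k : ℕ) - 1) (MvPolynomial.X k)) *
        wPow K (-1) ^ n =
        (if n = 0 then constL K (inB K (MvPolynomial.X k)) else 0) +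
        if n = 2 * (k : ℕ) then (q ^ (k : ℕ) - 1) • wPow K (-2 * (k : ℤ)) else 0 := by
      intro n
      rw [bosExp_X two_mul_injective two_mul_ne_zero, map_add, add_mul]
      congr 1
      · split_ifs with h
        · rw [h, pow_zero, mul_one]
          rfl
        · rw [map_zero, zero_mul]
      · split_ifs with h
        · rw [AlgHom.commutes, ← Algebra.smul_def, wPow_pow, h]
          congr 2
          push_cast
          ring
        · rw [map_zero, zero_mul]
    simp only [h1]
    rw [Finset.sum_add_distrib, Finset.sum_ite_eq', Finset.sum_ite_eq',
      if_pos (Finset.mem_range.2 (by omega)), if_pos (Finset.mem_range.2 (by omega))]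
  · intro n hn
    rw [bosExp_X two_mul_injective two_mul_ne_zero, if_neg (by omega), if_neg (by omega), add_zero]

theorem coeffMap_cF_algebraMap (q : K) (n : ℕ) (c : K) (m : ℤ) :
    coeffMap (cF q n) (c • wPow K m) = if n = 0 then c • wPow K m else 0 := by
  rw [map_smul, ← mul_one (wPow K m), coeffMap_wPow_mul,
    (coeffMap_isHasseSchmidt (isHasseSchmidt_cF q)).map_one]
  split_ifs
  · rfl
  · rw [mul_zero, smul_zero]

/-- Both operations translate the p_k by scalars, so they commute; the generators suffice by
multiplicativity. -/
theorem coeffMap_bosHom (q : K) (n : ℕ) (f : Bos K) :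
    coeffMap (cF q n) (bosHom q f) = bosHom q (cTilde q n f) := by
  have h : (coeffMap_isHasseSchmidt (isHasseSchmidt_cF q)).toPowerSeries.comp (bosHom q) =
      (PowerSeries.mapAlgHom (bosHom q)).comp (isHasseSchmidt_cTilde q).toPowerSeries := by
    refine MvPolynomial.algHom_ext fun k => ?_
    ext1 m
    rw [AlgHom.comp_apply, IsHasseSchmidt.coeff_toPowerSeries, AlgHom.comp_apply]
    refine Eq.trans ?_ (PowerSeries.coeff_map _ _ _).symm
    rw [IsHasseSchmidt.coeff_toPowerSeries, cTilde_X, bosHom_X, map_add, coeffMap_constL, cF_inB,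
      coeffMap_cF_algebraMap, cTilde_X]
    simp only [RingHom.coe_coe, map_add]
    by_cases hm : m = 0
    · have hk : (0 : ℕ) ≠ k := k.pos.ne
      subst hm
      simp only [if_pos, if_neg hk, map_zero, add_zero, bosHom_X]
    · simp only [if_neg hm, map_zero, zero_add, add_zero]
      split_ifs
      · simp only [AlgHom.commutes]
      · simp only [map_zero]
  have h2 := congrArg (PowerSeries.coeff n) (DFunLike.congr_fun h f)
  rw [AlgHom.comp_apply, IsHasseSchmidt.coeff_toPowerSeries, AlgHom.comp_apply] at h2
  refine h2.trans ((PowerSeries.coeff_map _ _ _).trans ?_)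
  rw [IsHasseSchmidt.coeff_toPowerSeries]
  rfl

theorem coeffMap_piSer (q : K) (n : ℕ) (c : ℕ+ → K) :
    coeffMap (cF q n) (piSer c) = if n = 0 then piSer c else 0 := by
  have h : ∀ m : ℤ, cF q n ((piSer c).coeff m) = if n = 0 then (piSer c).coeff m else 0 := by
    intro m
    rcases lt_or_ge m 0 with hm | hm
    · rw [piSer, coeff_psL_of_neg _ hm, map_zero, ite_self]
    · obtain ⟨m, rfl⟩ := Int.eq_ofNat_of_zero_le hm
      have h1 : (piSer c).coeff (m : ℤ) = PowerSeries.coeff m (series (fun k => 2 * (k : ℕ))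
          fun k => c k • inF K (gen K k)) := coeff_psL_natCast _ m
      rw [h1]
      refine coeff_series_induction two_mul_injective
        (p := fun x => cF q n x = if n = 0 then x else 0) (by rw [map_zero, ite_self])
        (fun k => ?_) m
      rw [map_smul, cF_inF]
      split_ifs
      · rfl
      · exact smul_zero _
  ext m
  rw [coeff_coeffMap, h]
  split_ifs <;> rfl

/-- The images of the generators contain no p_k, so c(z) fixes them, and hence fixes the whole image
of B. -/
theorem coeffMap_grass (q : K) {B : Grass K ℕ+ →ₐ[K] LSer K}
    (hB : ∀ l, ∃ m c, B (gen K l) = wPow K m * piSer c) (n : ℕ) (g : Grass K ℕ+) :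
    coeffMap (cF q n) (B g) = if n = 0 then B g else 0 := by
  let C' : LSer K →ₐ[K] PowerSeries (LSer K) :=
    { (PowerSeries.C : LSer K →+* PowerSeries (LSer K)) with
      commutes' := fun _ => PowerSeries.algebraMap_apply.symm }
  have h : (coeffMap_isHasseSchmidt (isHasseSchmidt_cF q)).toPowerSeries.comp B = C'.comp B := by
    refine grass_algHom_ext fun l => ?_
    ext1 m
    rw [AlgHom.comp_apply, IsHasseSchmidt.coeff_toPowerSeries, AlgHom.comp_apply]
    refine Eq.trans ?_ (PowerSeries.coeff_C _ _).symm
    obtain ⟨j, c, hc⟩ := hB l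
    rw [hc, coeffMap_wPow_mul, coeffMap_piSer]
    split_ifs
    · rfl
    · exact mul_zero _
  have h2 := congrArg (PowerSeries.coeff n) (DFunLike.congr_fun h g)
  rw [AlgHom.comp_apply, IsHasseSchmidt.coeff_toPowerSeries, AlgHom.comp_apply] at h2
  exact h2.trans (PowerSeries.coeff_C _ _)

/-- Exchange relation c(z) V(w) = g(w²/z) V(w) c(z), read off at z^{-n}: only V_B^{(-)} contributes
the factor g. -/
theorem coeffMap_vertex (q t : K) {B : Grass K ℕ+ →ₐ[K] LSer K}
    (hB : ∀ l, ∃ m c, B (gen K l) = wPow K m * piSer c) (n : ℕ) (v : Fock K) :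
    coeffMap (cF q n) (vertex t (bosHom q) (bosHom_comm q) B v) =
      ∑ p ∈ Finset.HasAntidiagonal.antidiagonal n, structCoeff q⁻¹ t⁻¹ p.1 •
        (wPow K (2 * (p.1 : ℤ)) * vertex t (bosHom q) (bosHom_comm q) B (cF q p.2 v)) := by
  induction v using TensorProduct.induction_on with
  | zero => simp
  | add v w hv hw => simp only [map_add, hv, hw, mul_add, smul_add, Finset.sum_add_distrib]
  | tmul f g =>
    have hs := coeffMap_isHasseSchmidt (isHasseSchmidt_cF q)
    rw [vertex_tmul, hs.map_mul]
    refine Finset.sum_congr rfl fun p _ => ?_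
    rw [coeffMap_bosL, smul_mul_assoc, mul_assoc]
    congr 2
    change _ = vertex t (bosHom q) (bosHom_comm q) B (cTilde q p.2 f ⊗ₜ g)
    rw [vertex_tmul, hs.map_mul]
    congr 1
    rw [Finset.sum_eq_single (p.2, 0)]
    · rw [coeffMap_bosHom, coeffMap_grass q hB, if_pos rfl]
    · rintro ⟨i, j⟩ hp hne
      rw [Finset.HasAntidiagonal.mem_antidiagonal] at hp
      simp only at hp
      have hj : j ≠ 0 := by
        rintro rfl
        exact hne (by rw [← hp, add_zero])
      rw [coeffMap_grass q hB, if_neg hj, mul_zero]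
    · intro h
      exact absurd (Finset.HasAntidiagonal.mem_antidiagonal.2 (add_zero _)) h

/-- The embedding of polynomials in the `p_k` as constant Laurent series. -/
def constB (K : Type*) [Field K] : Bos K →ₐ[K] LSer K := (constL K).comp (inB K)

omit [CharZero K] in
theorem constB_comm (f : Bos K) (x : LSer K) : constB K f * x = x * constB K f :=
  constL_inB_comm f x

/-- At z = w²/q the translation of p_k by c(z) is (q^{-k} - 1) q^k w^{-2k} = (1 - q^k) w^{-2k},
which undoes the translation by V_B^{(+)}(w). -/
theorem sum_vertex_cF (q t : K) (hq : q ≠ 0) (B : Grass K ℕ+ →ₐ[K] LSer K) (v : Fock K) {N : ℕ}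
    (hN : ∀ n, N ≤ n → cF q n v = 0) :
    ∑ n ∈ Finset.range N, q ^ n • (wPow K (-2 * (n : ℤ)) *
      vertex t (bosHom q) (bosHom_comm q) B (cF q n v)) =
      vertex t (constB K) constB_comm B v := by
  let A : Fock K →ₐ[K] LSer K :=
    Algebra.TensorProduct.lift (bosHom q) B fun f g => commute_of_forall (bosHom_comm q f) (B g)
  let A' : Fock K →ₐ[K] LSer K :=
    Algebra.TensorProduct.lift (constB K) B fun f g => commute_of_forall (constB_comm f) (B g)
  have hz : ∀ v, Commute (A v) (q • wPow K (-2)) := fun v => (commute_wPow _ _).smul_right q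
  have hzpow : ∀ n : ℕ, (q • wPow K (-2)) ^ n = q ^ n • wPow K (-2 * (n : ℤ)) := by
    intro n
    rw [smul_pow, wPow_pow, mul_comm]
  let E := (isHasseSchmidt_cF q).eval (cF_finite q) A (q • wPow K (-2)) hz
  have hE : E = A' := by
    refine Algebra.TensorProduct.ext (MvPolynomial.algHom_ext fun k => ?_)
      (AlgHom.ext fun g => ?_)
    · have hA : A (inB K (MvPolynomial.X k)) = bosHom q (MvPolynomial.X k) := by
        change bosHom q (MvPolynomial.X k) * B 1 = _
        rw [map_one, mul_one]
      have hA' : A' (inB K (MvPolynomial.X k)) = constB K (MvPolynomial.X k) := by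
        change constB K (MvPolynomial.X k) * B 1 = _
        rw [map_one, mul_one]
      have hk := k.pos
      have h1 : ∀ n, A (cF q n (inB K (MvPolynomial.X k))) * (q • wPow K (-2)) ^ n =
          (if n = 0 then bosHom q (MvPolynomial.X k) else 0) +
          if n = k then (1 - q ^ (k : ℕ)) • wPow K (-2 * (k : ℤ)) else 0 := by
        intro n
        rw [cF_inB, cTilde_X, map_add, map_add, add_mul, hzpow]
        congr 1
        · split_ifs with h
          · rw [hA, h, pow_zero, one_smul, Nat.cast_zero, mul_zero, wPow_zero, mul_one]
          · rw [map_zero, map_zero, zero_mul]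
        · split_ifs with h
          · rw [AlgHom.commutes, AlgHom.commutes, ← Algebra.smul_def, h, smul_smul, inv_pow, sub_mul,
              inv_mul_cancel₀ (pow_ne_zero _ hq), one_mul]
          · rw [map_zero, map_zero, zero_mul]
      change E (inB K (MvPolynomial.X k)) = A' (inB K (MvPolynomial.X k))
      rw [hA', IsHasseSchmidt.eval_apply _ _ _ _ hz _ (N := k + 1)]
      · simp only [h1]
        rw [Finset.sum_add_distrib, Finset.sum_ite_eq', Finset.sum_ite_eq',
          if_pos (Finset.mem_range.2 (by omega)), if_pos (Finset.mem_range.2 (by omega)), bosHom_X,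
          add_assoc, ← add_smul, sub_add_sub_cancel, sub_self, zero_smul, add_zero]
        rfl
      · intro n hn
        rw [cF_inB, cTilde_X, if_neg (by omega), if_neg (by omega), add_zero, map_zero]
    · have hA : A (inF K g) = B g := by
        change bosHom q 1 * B g = _
        rw [map_one, one_mul]
      have hA' : A' (inF K g) = B g := by
        change constB K 1 * B g = _
        rw [map_one, one_mul]
      change E (inF K g) = A' (inF K g)
      rw [hA', IsHasseSchmidt.eval_apply _ _ _ _ hz _ (N := 1)]
      · rw [Finset.sum_range_one, cF_inF, if_pos rfl, pow_zero, mul_one, hA]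
      · intro n hn
        rw [cF_inF, if_neg (by omega)]
  have h := DFunLike.congr_fun hE v
  change E v = A' v at h
  rw [IsHasseSchmidt.eval_apply _ _ _ _ hz _ hN] at h
  change _ = bosL t * A' v
  rw [← h, Finset.mul_sum]
  refine Finset.sum_congr rfl fun n _ => ?_
  rw [hzpow, mul_smul_comm, mul_smul_comm, ← mul_assoc, ← wPow_comm]
  rfl

end CTilde

/-! ### Comparison of the structure coefficients -/

section Coefficients

variable {K : Type*} [Field K]

/-- The matrix of `⟨Ṽ_F(w)⟩` on the generators. -/
def tildeCoeff (q t : K) (l k : ℕ+) : K :=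
  (if k = l then 1 else 0) + (1 - t⁻¹) * t ^ (2 - (k : ℤ)) * ((q - 1) * q ^ ((l : ℤ) - 2)) *
    ∑ m ∈ Finset.range (min ((k : ℕ) - 1) ((l : ℕ) - 1)), (t * q⁻¹) ^ m

/-- The matrix of `⟨V_F(w)⟩` on the generators. -/
def fullCoeff (q t : K) (l k : ℕ+) : K :=
  (if k = l then 1 else 0) + (1 - t⁻¹) * t ^ (1 - (k : ℤ)) * ((q - 1) * q ^ ((l : ℤ) - 1)) *
    ∑ m ∈ Finset.range (min (k : ℕ) (l : ℕ)), (t * q⁻¹) ^ m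

/-- The rank one part of `⟨V_F(w)⟩ - ⟨Ṽ_F(w)⟩`. -/
def gapCoeff (q t : K) (k : ℕ+) : K :=
  (1 - q⁻¹) * (1 - t⁻¹) * t⁻¹ ^ k.natPred

/-- The rank one part of the difference between multiplication by the structure function and
`⟨Ṽ_F(w)⟩`. -/
def shiftCoeff (q t : K) (k : ℕ+) : K :=
  -((1 - q⁻¹) * (1 - t⁻¹) * t⁻¹ ^ k.natPred * (t * q⁻¹) *
    ∑ m ∈ Finset.range k.natPred, (t * q⁻¹) ^ m)

theorem geomSum_succ (x : K) (n : ℕ) :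
    ∑ m ∈ Finset.range (n + 1), x ^ m = x * ∑ m ∈ Finset.range n, x ^ m + 1 := by
  rw [Finset.sum_range_succ', Finset.mul_sum, pow_zero]
  congr 1
  exact Finset.sum_congr rfl fun m _ => pow_succ' x m

theorem geomSum_add (x : K) (m n : ℕ) : ∑ i ∈ Finset.range (m + n), x ^ i =
    ∑ i ∈ Finset.range m, x ^ i + x ^ m * ∑ i ∈ Finset.range n, x ^ i := by
  rw [Finset.sum_range_add, Finset.mul_sum]
  simp only [pow_add]

theorem homSum_succ_eq {q t : K} (ht : t ≠ 0) (m : ℕ) :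
    homSum q⁻¹ t⁻¹ (m + 1) = t⁻¹ ^ m * ∑ i ∈ Finset.range (m + 1), (t * q⁻¹) ^ i := by
  induction m with
  | zero => simp [homSum]
  | succ m ih =>
    rw [homSum, ih, geomSum_succ _ (m + 1), pow_succ]
    field_simp

variable {q t : K} (hq : q ≠ 0) (ht : t ≠ 0)

include ht in
theorem zpow_two_sub (n : ℕ) : t ^ (2 - ((n + 1 : ℕ) : ℤ)) = t * t⁻¹ ^ n := by
  rw [show 2 - ((n + 1 : ℕ) : ℤ) = 1 - (n : ℤ) by push_cast; ring, zpow_sub₀ ht, zpow_one,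
    zpow_natCast, inv_pow, div_eq_mul_inv]

theorem zpow_one_sub (n : ℕ) : t ^ (1 - ((n + 1 : ℕ) : ℤ)) = t⁻¹ ^ n := by
  rw [show 1 - ((n + 1 : ℕ) : ℤ) = -(n : ℤ) by push_cast; ring, zpow_neg, zpow_natCast, inv_pow]

include hq in
theorem zpow_sub_two (n : ℕ) : q ^ (((n + 1 : ℕ) : ℤ) - 2) = q⁻¹ * q ^ n := by
  rw [show ((n + 1 : ℕ) : ℤ) - 2 = (n : ℤ) - 1 by push_cast; ring, zpow_sub₀ hq, zpow_one,
    zpow_natCast, div_eq_inv_mul]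

theorem zpow_sub_one_succ (n : ℕ) : q ^ (((n + 1 : ℕ) : ℤ) - 1) = q ^ n := by
  rw [show ((n + 1 : ℕ) : ℤ) - 1 = (n : ℤ) by push_cast; ring, zpow_natCast]

include hq ht in
-- Splitting off the first term of the geometric sum in t/q leaves t/q times a sum with one term
-- fewer. That part is the tilde matrix, and the split-off 1 is a product of a function of l and a
-- function of k.
theorem fullCoeff_eq (l k : ℕ+) :
    fullCoeff q t l k = tildeCoeff q t l k + q ^ (l : ℕ) * gapCoeff q t k := by
  obtain ⟨l, rfl⟩ : ∃ n : ℕ, l = n.succPNat := ⟨l.natPred, by simp⟩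
  obtain ⟨k, rfl⟩ : ∃ n : ℕ, k = n.succPNat := ⟨k.natPred, by simp⟩
  rw [fullCoeff, tildeCoeff, gapCoeff, add_assoc]
  congr 1
  simp only [Nat.succPNat_coe, Nat.succ_eq_add_one, Nat.natPred_succPNat, Nat.add_sub_cancel,
    zpow_two_sub ht, zpow_one_sub, zpow_sub_two hq, zpow_sub_one_succ, Nat.add_min_add_right,
    geomSum_succ]
  field_simp
  ring

include ht in
theorem structCoeff_eq (k : ℕ+) :
    structCoeff q⁻¹ t⁻¹ k = shiftCoeff q t k - gapCoeff q t k := by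
  obtain ⟨k, rfl⟩ : ∃ n : ℕ, k = n.succPNat := ⟨k.natPred, by simp⟩
  rw [shiftCoeff, gapCoeff, Nat.succPNat_coe, Nat.natPred_succPNat, Nat.succ_eq_add_one,
    structCoeff, homSum_succ_eq ht, geomSum_succ]
  ring

include hq ht in
-- For k ≤ l the geometric sums in the tilde and shift terms have the same length and cancel. For k
-- > l the longer sum in the shift term splits at length l - 1: its initial part cancels and the
-- tail is the coefficient of g at k - l.
theorem ite_structCoeff_eq (l k : ℕ+) :
    (if (l : ℕ) ≤ k then structCoeff q⁻¹ t⁻¹ ((k : ℕ) - l) else 0) =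
      tildeCoeff q t l k + q ^ (l : ℕ) * shiftCoeff q t k := by
  obtain ⟨l, rfl⟩ : ∃ n : ℕ, l = n.succPNat := ⟨l.natPred, by simp⟩
  obtain ⟨k, rfl⟩ : ∃ n : ℕ, k = n.succPNat := ⟨k.natPred, by simp⟩
  rw [tildeCoeff, shiftCoeff]
  simp only [Nat.succPNat_coe, Nat.succ_eq_add_one, Nat.natPred_succPNat, Nat.add_sub_cancel,
    zpow_two_sub ht, zpow_sub_two hq, Nat.succPNat_inj, Nat.add_le_add_iff_right,
    Nat.add_sub_add_right]
  rcases le_or_gt k l with h | h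
  · rw [min_eq_left h]
    have h1 : (1 - t⁻¹) * (t * t⁻¹ ^ k) * ((q - 1) * (q⁻¹ * q ^ l)) *
        (∑ m ∈ Finset.range k, (t * q⁻¹) ^ m) + q ^ (l + 1) *
        -((1 - q⁻¹) * (1 - t⁻¹) * t⁻¹ ^ k * (t * q⁻¹) * ∑ m ∈ Finset.range k, (t * q⁻¹) ^ m) = 0 := by
      field_simp
      ring
    rw [add_assoc, h1, add_zero]
    rcases h.eq_or_lt with h2 | h2
    · rw [h2, if_pos le_rfl, if_pos rfl, Nat.sub_self, structCoeff]
    · rw [if_neg (by omega), if_neg (by omega)]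
  · obtain ⟨j, rfl⟩ := Nat.exists_eq_add_of_lt h
    rw [min_eq_right (by omega), if_pos (by omega), if_neg (by omega), zero_add,
      show l + j + 1 - l = j + 1 by omega, structCoeff, homSum_succ_eq ht,
      show l + j + 1 = l + (j + 1) by ring, geomSum_add _ l (j + 1), mul_pow, pow_add t⁻¹ l,
      pow_succ t⁻¹ j]
    simp only [inv_pow]
    field_simp
    ring

end Coefficients

/-! ### The anticommutators -/

section Anticommutators

variable {K : Type*} [Field K]

theorem finsum_pnat {A : Type*} [AddCommMonoid A] {f : ℕ+ → A} {N : ℕ}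
    (h : ∀ k : ℕ+, N < k → f k = 0) : ∑ᶠ k, f k = ∑ n ∈ Finset.range N, f n.succPNat := by
  refine Eq.trans ?_
    (Finset.sum_map (Finset.range N) ⟨Nat.succPNat, Nat.succPNat_injective⟩ f)
  refine finsum_eq_sum_of_support_subset _ fun k hk => ?_
  rw [Finset.mem_coe, Finset.mem_map]
  refine ⟨k.natPred, ?_, by simp⟩
  rw [Finset.mem_range]
  by_contra hN
  refine hk (h k ?_)
  have := PNat.natPred_add_one k
  omega

theorem dSum_eq_sum (q : K) (T : Fock K →ₗ[K] LSer K) (v : Fock K) {N : ℕ}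
    (hN : ∀ k : ℕ+, N ≤ k → dpiOp K k v = 0) :
    dSum q T v = ∑ n ∈ Finset.range N, q ^ (n.succPNat : ℕ) •
      (wPow K (-2 * ((n.succPNat : ℕ) : ℤ)) * T (dpiOp K n.succPNat v)) :=
  finsum_pnat fun k hk => by rw [hN k hk.le, map_zero, mul_zero, smul_zero]

theorem hahnSeries_coeff_mul (x y : LSer K) (n : ℤ) :
    (Function.support fun i => x.coeff i * y.coeff (n - i)).Finite ∧
      (x * y).coeff n = ∑ᶠ i, x.coeff i * y.coeff (n - i) := by
  set A := Finset.antidiagonal x.isPWO_support y.isPWO_support n with hA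
  have hsupp : (Function.support fun i => x.coeff i * y.coeff (n - i)) ⊆
      ((A.image Prod.fst : Finset ℤ) : Set ℤ) := by
    intro i hi
    rw [Function.mem_support] at hi
    rw [Finset.coe_image]
    refine ⟨(i, n - i), ?_, rfl⟩
    rw [Finset.mem_coe, hA, Finset.mem_antidiagonal]
    exact ⟨left_ne_zero_of_mul hi, right_ne_zero_of_mul hi, by ring⟩
  refine ⟨(Finset.finite_toSet _).subset hsupp, ?_⟩
  rw [finsum_eq_sum_of_support_subset _ hsupp, HahnSeries.coeff_mul, Finset.sum_image]
  · refine Finset.sum_congr rfl fun p hp => ?_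
    rw [Finset.mem_antidiagonal] at hp
    rw [show n - p.1 = p.2 by rw [← hp.2.2]; ring]
  · intro p hp p' hp' h
    rw [Finset.mem_coe, hA, Finset.mem_antidiagonal] at hp hp'
    refine Prod.ext h ?_
    have h1 := hp.2.2
    have h2 := hp'.2.2
    rw [h] at h1
    omega

theorem coeff_piSer (c : ℕ+ → K) (k : ℕ+) :
    (piSer c).coeff (2 * (k : ℤ)) = c k • inF K (gen K k) := by
  have h := coeff_psL_natCast (series (fun k => 2 * (k : ℕ)) fun k => c k • inF K (gen K k))
    (2 * (k : ℕ))
  rw [coeff_series two_mul_injective] at h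
  rw [← h, piSer]
  push_cast
  rfl

theorem coeff_piSer_eq_zero (c : ℕ+ → K) {n : ℤ} (h : ∀ k : ℕ+, 2 * (k : ℤ) ≠ n) :
    (piSer c).coeff n = 0 := by
  rcases lt_or_ge n 0 with hn | hn
  · exact coeff_psL_of_neg _ hn
  · obtain ⟨m, rfl⟩ := Int.eq_ofNat_of_zero_le hn
    refine (coeff_psL_natCast _ m).trans (coeff_series_eq_zero _ fun k hk => h k ?_)
    rw [← hk]
    push_cast
    rfl

theorem coeff_piSer_mul (c : ℕ+ → K) (y : LSer K) (n : ℤ) :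
    (Function.support fun k : ℕ+ => c k • (inF K (gen K k) * y.coeff (n - 2 * (k : ℤ)))).Finite ∧
      (piSer c * y).coeff n =
        ∑ᶠ k : ℕ+, c k • (inF K (gen K k) * y.coeff (n - 2 * (k : ℤ))) := by
  obtain ⟨h1, h2⟩ := hahnSeries_coeff_mul (piSer c) y n
  have hinj : Function.Injective fun k : ℕ+ => 2 * (k : ℤ) := by
    intro a b h
    simp only at h
    exact PNat.coe_injective (by omega)
  have he : ∀ k : ℕ+, c k • (inF K (gen K k) * y.coeff (n - 2 * (k : ℤ))) =
      (piSer c).coeff (2 * (k : ℤ)) * y.coeff (n - 2 * (k : ℤ)) := fun k => by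
    rw [coeff_piSer, smul_mul_assoc]
  simp only [he]
  refine ⟨h1.preimage hinj.injOn, ?_⟩
  rw [h2, ← finsum_mem_range (f := fun i => (piSer c).coeff i * y.coeff (n - i)) hinj]
  rw [finsum_mem_def]
  refine finsum_congr fun i => ?_
  by_cases hi : i ∈ Set.range fun k : ℕ+ => 2 * (k : ℤ)
  · rw [Set.indicator_of_mem hi]
  · rw [Set.indicator_of_notMem hi, coeff_piSer_eq_zero, zero_mul]
    intro k hk
    exact hi ⟨k, hk⟩

variable [CharZero K]

/-- The homomorphism `⟨Ṽ_F(w)⟩`. -/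
def tildeHom (q t : K) : Grass K ℕ+ →ₐ[K] LSer K :=
  fermPair (fun k => (1 - t⁻¹) * t ^ (2 - (k : ℤ))) (fun k => (q - 1) * q ^ ((k : ℤ) - 2))
    (fun k => (k : ℕ) - 1) t q⁻¹

/-- The homomorphism `⟨V_F(w)⟩`. -/
def fullHom (q t : K) : Grass K ℕ+ →ₐ[K] LSer K :=
  fermPair (fun k => (1 - t⁻¹) * t ^ (1 - (k : ℤ))) (fun k => (q - 1) * q ^ ((k : ℤ) - 1))
    (fun k => (k : ℕ)) t q⁻¹

theorem tildeHom_gen (q t : K) (l : ℕ+) :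
    tildeHom q t (gen K l) = wPow K (-2 * (l : ℤ)) * piSer (tildeCoeff q t l) :=
  fermPair_gen _ _ _ _ _ l

theorem fullHom_gen (q t : K) (l : ℕ+) :
    fullHom q t (gen K l) = wPow K (-2 * (l : ℤ)) * piSer (fullCoeff q t l) :=
  fermPair_gen _ _ _ _ _ l

/-- The operator `V_B(w) ⟨Ṽ_F(w)⟩`. -/
def tildeField (q t : K) : Fock K →ₗ[K] LSer K :=
  vertex t (bosHom q) (bosHom_comm q) (tildeHom q t)

/-- The operator `V_B(w) ⟨V_F(w)⟩`. -/
def fullField (q t : K) : Fock K →ₗ[K] LSer K :=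
  vertex t (bosHom q) (bosHom_comm q) (fullHom q t)

/-- The operator `V_B^{(-)}(w) ⟨Ṽ_F(w)⟩`. -/
def minusField (q t : K) : Fock K →ₗ[K] LSer K :=
  vertex t (constB K) constB_comm (tildeHom q t)

theorem contour_tilde (q t : K) (r : ℤ) (v : Fock K) :
    contour q t (VFtildeMinus t) (VFtildePlus q) r v = (tildeField q t v).coeff (-r) :=
  contour_eq_vertex t (isHasseSchmidt_fermMinus _ _ _) (isHasseSchmidt_fermPlus _ _ _)
    (fermPlus_finite _ _ _) q r v

theorem contour_full (q t : K) (r : ℤ) (v : Fock K) :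
    contour q t (VFminus t) (VFplus q) r v = (fullField q t v).coeff (-r) :=
  contour_eq_vertex t (isHasseSchmidt_fermMinus _ _ _) (isHasseSchmidt_fermPlus _ _ _)
    (fermPlus_finite _ _ _) q r v

theorem locFinite_contour_tilde (q t : K) (r : ℤ) :
    LocFinite (contourTerm q t (VFtildeMinus t) (VFtildePlus q) r) :=
  locFinite_contourTerm (isHasseSchmidt_fermMinus _ _ _) (isHasseSchmidt_fermPlus _ _ _)
    (fermPlus_finite _ _ _) q t r

theorem locFinite_contour_full (q t : K) (r : ℤ) :
    LocFinite (contourTerm q t (VFminus t) (VFplus q) r) :=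
  locFinite_contourTerm (isHasseSchmidt_fermMinus _ _ _) (isHasseSchmidt_fermPlus _ _ _)
    (fermPlus_finite _ _ _) q t r

omit [CharZero K] in
theorem locFinite_E21Term (q t : K) : LocFinite (E21Term q t) := fun v =>
  finite_support_of_dpiOp v fun k hk => by
    rw [E21Term, LinearMap.smul_apply, Module.End.mul_apply, hk, map_zero, smul_zero]

omit [CharZero K] in
theorem locFinite_F12Term (q t : K) : LocFinite (F12Term q t) := fun v =>
  finite_support_of_dpiOp v fun k hk => by
    rw [F12Term, LinearMap.smul_apply, Module.End.mul_apply, hk, map_zero, smul_zero]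

omit [CharZero K] in
theorem F2m1Term_apply (q : K) (k : ℕ+) (v : Fock K) :
    F2m1Term q k v = inF K (gen K k) * cF q k v :=
  liftF_create_apply k _

theorem locFinite_F2m1Term (q : K) : LocFinite (F2m1Term q) := by
  intro v
  obtain ⟨N, hN⟩ := cF_finite q v
  refine (Set.finite_Iio (Nat.succPNat N)).subset fun k hk => ?_
  by_contra hk'
  rw [Set.mem_Iio, not_lt, ← PNat.coe_le_coe, Nat.succPNat_coe] at hk'
  refine hk ?_
  simp only
  rw [F2m1Term_apply, hN k (by omega), mul_zero]

theorem locSum_E21Term_apply (q t : K) (v : Fock K) :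
    locSum (E21Term q t) v = (dSum q (tildeField q t) v).coeff 0 := by
  rw [locSum_apply (locFinite_E21Term q t), coeff_dSum]
  refine finsum_congr fun k => ?_
  rw [E21Term, LinearMap.smul_apply, Module.End.mul_apply, contour_tilde]
  congr 2
  ring

/-- Compared with E_{2,1}, the weight q^{k-1} costs a factor q⁻¹ and the extra w² moves the residue
to w^{-2}. -/
theorem locSum_F12Term_apply {q : K} (hq : q ≠ 0) (t : K) (v : Fock K) :
    locSum (F12Term q t) v = q⁻¹ • (dSum q (tildeField q t) v).coeff (-2) := by
  rw [locSum_apply (locFinite_F12Term q t), coeff_dSum, smul_finsum']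
  · refine finsum_congr fun k => ?_
    rw [F12Term, LinearMap.smul_apply, Module.End.mul_apply, contour_tilde, smul_smul]
    congr 1
    · obtain ⟨n, hn⟩ : ∃ n, (k : ℕ) = n + 1 := ⟨k.natPred, k.natPred_add_one.symm⟩
      rw [hn, Nat.add_sub_cancel, pow_succ', inv_mul_cancel_left₀ hq]
    · congr 1
      ring
  · exact finite_support_of_dpiOp v fun k hk => by
      rw [hk, map_zero, HahnSeries.coeff_zero, smul_zero]

theorem tildeField_pi_mul (q t : K) (a : ℕ+) (v : Fock K) :
    tildeField q t (inF K (gen K a) * v) = tildeHom q t (gen K a) * tildeField q t v :=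
  vertex_pi_mul _ _ _ _ a v

theorem minusField_pi_mul (q t : K) (a : ℕ+) (v : Fock K) :
    minusField q t (inF K (gen K a) * v) = tildeHom q t (gen K a) * minusField q t v :=
  vertex_pi_mul _ _ _ _ a v

/-- The tilde exponents have no term at k = 1, so π_1 passes through ⟨Ṽ_F⟩ unchanged. -/
theorem tildeHom_gen_one (q t : K) : tildeHom q t (gen K 1) = constL K (inF K (gen K 1)) := by
  have h : tildeCoeff q t 1 = fun k => if k = 1 then 1 else 0 := by
    funext k
    simp [tildeCoeff]
  rw [tildeHom_gen, h, piSer_single, ← mul_assoc, wPow_mul, one_smul,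
    show -2 * ((1 : ℕ+) : ℤ) + 2 * ((1 : ℕ+) : ℤ) = 0 by ring, wPow_zero, one_mul]

theorem acomm_piOp_one_locSum_F12Term {q : K} (hq : q ≠ 0) (t : K) :
    acomm (piOp K 1) (locSum (F12Term q t)) =
      contour q t (VFtildeMinus t) (VFtildePlus q) 0 := by
  refine LinearMap.ext fun v => ?_
  rw [acomm, LinearMap.add_apply, Module.End.mul_apply, Module.End.mul_apply, liftF_create_apply,
    liftF_create_apply, locSum_F12Term_apply hq, locSum_F12Term_apply hq,
    dSum_pi_mul q (tildeField_pi_mul q t 1), tildeHom_gen_one, HahnSeries.coeff_sub,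
    HahnSeries.coeff_smul, coeff_constL_mul, coeff_wPow_mul, contour_tilde, PNat.one_coe, pow_one,
    smul_sub, smul_smul, inv_mul_cancel₀ hq, one_smul, mul_smul_comm, add_sub_cancel]
  rfl

theorem fullField_apply {q t : K} (hq : q ≠ 0) (ht : t ≠ 0) (v : Fock K) :
    fullField q t v =
      tildeField q t v + piSer (gapCoeff q t) * dSum q (tildeField q t) v := by
  refine rank_one_update q (p := fun a => tildeHom q t (gen K a))
    (p' := fun a => fullHom q t (gen K a)) (fun f => ?_) (tildeField_pi_mul q t)
    (vertex_pi_mul _ _ _ _) (fun a => ?_) (fun a => ?_) (piSer_mul_self _) v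
  · exact (vertex_inB _ _ _ _ f).trans (vertex_inB _ _ _ _ f).symm
  · rw [fullHom_gen, tildeHom_gen, smul_wPow_mul, ← mul_add, smul_piSer, piSer_add]
    congr 2
    funext k
    exact fullCoeff_eq hq ht a k
  · rw [tildeHom_gen, mul_assoc, piSer_mul_swap, mul_neg, ← mul_assoc, ← mul_assoc, wPow_comm]

omit [CharZero K] in
-- Triangularity of the coefficients removes the negative powers created by w^{-2a}.
theorem exists_psL_eq (a : ℕ+) {c : ℕ+ → K} (hc : ∀ k, k < a → c k = 0) (hca : c a = 1) :
    ∃ p, psL K p = wPow K (-2 * (a : ℤ)) * piSer c ∧ PowerSeries.coeff 0 p = inF K (gen K a) := by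
  set s := series (fun k => 2 * (k : ℕ)) fun k => c k • inF K (gen K k)
  let p : PowerSeries (Fock K) := PowerSeries.mk fun n => PowerSeries.coeff (n + 2 * (a : ℕ)) s
  have h : PowerSeries.X ^ (2 * (a : ℕ)) * p = s := by
    ext n
    rw [PowerSeries.coeff_X_pow_mul']
    split_ifs with hn
    · rw [PowerSeries.coeff_mk, Nat.sub_add_cancel hn]
    · by_cases hk : ∃ k : ℕ+, 2 * (k : ℕ) = n
      · obtain ⟨k, rfl⟩ := hk
        rw [coeff_series two_mul_injective, hc k, zero_smul]
        rw [← PNat.coe_lt_coe]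
        omega
      · exact (coeff_series_eq_zero _ (by simpa using hk)).symm
  refine ⟨p, ?_, ?_⟩
  · have hX : psL K (PowerSeries.X ^ (2 * (a : ℕ))) = wPow K (2 * (a : ℤ)) := by
      rw [map_pow, show psL K PowerSeries.X = wPow K 1 from HahnSeries.ofPowerSeries_X, wPow_pow]
      push_cast
      rw [mul_one]
    rw [show piSer c = psL K s from rfl, ← h, map_mul, hX, ← mul_assoc, wPow_mul,
      show -2 * (a : ℤ) + 2 * a = 0 by ring, wPow_zero, one_mul]
  · rw [PowerSeries.coeff_mk, zero_add, coeff_series two_mul_injective, hca, one_smul]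

/-- After the rank one change, π_a is represented by the Toeplitz row of g, a power series starting
with π_a. Since V_B^{(-)} starts with 1, induction on products of the π_a gives a power series
starting with v. -/
theorem exists_psL_minusField {q t : K} (hq : q ≠ 0) (ht : t ≠ 0) (v : Fock K) :
    ∃ p, psL K p = minusField q t v + piSer (shiftCoeff q t) * dSum q (minusField q t) v ∧
      PowerSeries.coeff 0 p = v := by
  induction v using fock_induction with
  | hB f =>
    refine ⟨PowerSeries.map (inB K : Bos K →+* Fock K) (bosSeries t) * PowerSeries.C (inB K f),
      ?_, ?_⟩
    · rw [dSum_inB, mul_zero, add_zero, minusField, vertex_inB, map_mul]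
      congr 1
      exact HahnSeries.ofPowerSeries_C (inB K f)
    · rw [PowerSeries.coeff_mul_C, PowerSeries.coeff_map, bosSeries, coeff_zero_fexp, map_one,
        one_mul]
  | hsmul c v hv =>
    obtain ⟨p, hp, hp0⟩ := hv
    refine ⟨c • p, ?_, ?_⟩
    · rw [map_smul, hp, map_smul, map_smul, smul_add, mul_smul_comm]
    · rw [coeff_smul_powerSeries, hp0]
  | hadd v w hv hw =>
    obtain ⟨p, hp, hp0⟩ := hv
    obtain ⟨r, hr, hr0⟩ := hw
    refine ⟨p + r, ?_, ?_⟩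
    · rw [map_add, hp, hr, map_add, map_add, mul_add]
      abel
    · rw [map_add, hp0, hr0]
  | hmul a v hv =>
    obtain ⟨p, hp, hp0⟩ := hv
    have hc := ite_structCoeff_eq hq ht a
    obtain ⟨r, hr, hr0⟩ := exists_psL_eq a
      (c := fun k => if (a : ℕ) ≤ k then structCoeff q⁻¹ t⁻¹ ((k : ℕ) - a) else 0)
      (fun k hk => if_neg (by rw [← PNat.coe_lt_coe] at hk; omega))
      (by rw [if_pos le_rfl, Nat.sub_self, structCoeff])
    refine ⟨r * p, ?_, ?_⟩
    · rw [map_mul, hp, hr, rank_one_pi_mul q (p := tildeHom q t (gen K a))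
        (minusField_pi_mul q t a) _ (piSer_mul_self _)]
      · congr 1
        rw [tildeHom_gen, smul_wPow_mul, ← mul_add, smul_piSer, piSer_add]
        simp only [hc]
      · rw [tildeHom_gen, mul_assoc, piSer_mul_swap, mul_neg, ← mul_assoc, ← mul_assoc, wPow_comm]
    · rw [PowerSeries.coeff_mul, Finset.Nat.antidiagonal_zero, Finset.sum_singleton, hr0, hp0]

/-! ### The anticommutator of E_{2,1} and F_{2,-1}. -/

theorem coeffMap_dSum_tildeField (q t : K) (n : ℕ) (v : Fock K) :
    coeffMap (cF q n) (dSum q (tildeField q t) v) =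
      ∑ p ∈ Finset.HasAntidiagonal.antidiagonal n, structCoeff q⁻¹ t⁻¹ p.1 •
        (wPow K (2 * (p.1 : ℤ)) * dSum q (tildeField q t) (cF q p.2 v)) := by
  obtain ⟨N, hN⟩ := exists_dpiOp_eq_zero v
  have hN' : ∀ j (k : ℕ+), N ≤ k → dpiOp K k (cF q j v) = 0 := fun j k hk => by
    rw [dpiOp_cF, hN k hk, map_zero]
  rw [dSum_eq_sum q _ v hN, map_sum]
  simp only [dSum_eq_sum q _ _ (hN' _), Finset.mul_sum, Finset.smul_sum]
  rw [Finset.sum_comm]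
  refine Finset.sum_congr rfl fun j _ => ?_
  rw [map_smul, coeffMap_wPow_mul, tildeField,
    coeffMap_vertex q t fun l => ⟨_, _, tildeHom_gen q t l⟩, Finset.mul_sum, Finset.smul_sum]
  refine Finset.sum_congr rfl fun p _ => ?_
  rw [dpiOp_cF, mul_smul_comm, mul_smul_comm, smul_comm, ← mul_assoc, ← mul_assoc, wPow_mul,
    wPow_mul, add_comm]

theorem sum_dSum_cF (q t : K) (hq : q ≠ 0) (v : Fock K) {N : ℕ}
    (hN : ∀ n, N ≤ n → cF q n v = 0) :
    ∑ n ∈ Finset.range N, q ^ n • (wPow K (-2 * (n : ℤ)) * dSum q (tildeField q t) (cF q n v)) =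
      dSum q (minusField q t) v := by
  obtain ⟨M, hM⟩ := exists_dpiOp_eq_zero v
  have hM' : ∀ j (k : ℕ+), M ≤ k → dpiOp K k (cF q j v) = 0 := fun j k hk => by
    rw [dpiOp_cF, hM k hk, map_zero]
  rw [dSum_eq_sum q _ v hM]
  simp only [dSum_eq_sum q _ _ (hM' _), Finset.mul_sum, Finset.smul_sum]
  rw [Finset.sum_comm]
  refine Finset.sum_congr rfl fun j _ => ?_
  rw [minusField, ← sum_vertex_cF q t hq _ _ (N := N), Finset.mul_sum, Finset.smul_sum]
  · refine Finset.sum_congr rfl fun n _ => ?_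
    rw [dpiOp_cF, mul_smul_comm, mul_smul_comm, smul_comm, ← mul_assoc, ← mul_assoc, wPow_mul,
      wPow_mul, add_comm]
    rfl
  · intro n hn
    rw [← dpiOp_cF, hN n hn, map_zero]

omit [CharZero K] in
theorem cF_zero (q : K) (v : Fock K) : cF q 0 v = v := by
  induction v using TensorProduct.induction_on with
  | zero => simp
  | add v w hv hw => rw [map_add, hv, hw]
  | tmul f g =>
    change cTilde q 0 f ⊗ₜ[K] g = _
    rw [cTilde_eq, bosExp, coeff_zero_fexp]
    rfl

/-- The series `∑_{k ≥ a} c_{k-a} π_k w^{2(k-a)}` with the structure constants `c`. -/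
def shiftSer (q t : K) (a : ℕ) : LSer K :=
  wPow K (-2 * (a : ℤ)) *
    piSer (fun k : ℕ+ => if a ≤ (k : ℕ) then structCoeff q⁻¹ t⁻¹ ((k : ℕ) - a) else 0)

/-- The exchange relation spreads c̃_l over the terms g_{l-a} w^{2(l-a)} c̃_a. Collecting the terms
π_l for fixed a gives the series `shiftSer`. -/
theorem locSum_F2m1Term_coeff (q t : K) (v : Fock K) {N : ℕ}
    (hN : ∀ n, N ≤ n → cF q n v = 0) :
    locSum (F2m1Term q) ((dSum q (tildeField q t) v).coeff 0) =
      ∑ a ∈ Finset.range N, (shiftSer q t a * dSum q (tildeField q t) (cF q a v)).coeff 0 := by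
  set y := fun a => dSum q (tildeField q t) (cF q a v) with hy
  have hterm : ∀ l : ℕ+, F2m1Term q l ((dSum q (tildeField q t) v).coeff 0) =
      ∑ a ∈ Finset.range N, (if a ≤ (l : ℕ) then structCoeff q⁻¹ t⁻¹ ((l : ℕ) - a) else 0) •
        (inF K (gen K l) * (y a).coeff (2 * (a : ℤ) - 2 * (l : ℤ))) := by
    intro l
    rw [F2m1Term_apply, ← coeff_coeffMap, coeffMap_dSum_tildeField, HahnSeries.coeff_sum,
      ← Finset.Nat.sum_antidiagonal_swap,
      Finset.Nat.sum_antidiagonal_eq_sum_range_succ_mk, Finset.mul_sum]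
    have h0 : ∀ a, N ≤ a → y a = 0 := fun a ha => by
      simp only [hy]
      rw [hN a ha, map_zero]
    have hl : ∀ a, ¬ a ≤ (l : ℕ) → (if a ≤ (l : ℕ) then structCoeff q⁻¹ t⁻¹ ((l : ℕ) - a) else 0) •
        (inF K (gen K l) * (y a).coeff (2 * (a : ℤ) - 2 * (l : ℤ))) = 0 := fun a ha => by
      rw [if_neg ha, zero_smul]
    -- The ranges a < N and a ≤ l are compared inside a common range: c̃_a v vanishes outside the
    -- first, the structure constant outside the second.
    have e1 := Finset.sum_subset (s₁ := Finset.range N) (s₂ := Finset.range (N + (l + 1)))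
      (f := fun a => (if a ≤ (l : ℕ) then structCoeff q⁻¹ t⁻¹ ((l : ℕ) - a) else 0) •
        (inF K (gen K l) * (y a).coeff (2 * (a : ℤ) - 2 * (l : ℤ)))) (by simp) (fun a _ ha => by
          rw [h0 a (by simpa using ha), HahnSeries.coeff_zero, mul_zero, smul_zero])
    have e2 := Finset.sum_subset (s₁ := Finset.range (l + 1)) (s₂ := Finset.range (N + (l + 1)))
      (f := fun a => (if a ≤ (l : ℕ) then structCoeff q⁻¹ t⁻¹ ((l : ℕ) - a) else 0) •
        (inF K (gen K l) * (y a).coeff (2 * (a : ℤ) - 2 * (l : ℤ)))) (by simp) (fun a _ ha =>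
          hl a (by simpa [Nat.lt_succ_iff] using ha))
    rw [e1, ← e2]
    refine Finset.sum_congr rfl fun a ha => ?_
    have hal : a ≤ (l : ℕ) := Nat.lt_succ_iff.1 (Finset.mem_range.1 ha)
    rw [if_pos hal, HahnSeries.coeff_smul, mul_smul_comm, Prod.fst_swap, Prod.snd_swap,
      coeff_wPow_mul]
    simp only [hy]
    congr 3
    push_cast [hal]
    ring
  have hA : ∀ a : ℕ, (shiftSer q t a * y a).coeff 0 =
      ∑ᶠ l : ℕ+, (if a ≤ (l : ℕ) then structCoeff q⁻¹ t⁻¹ ((l : ℕ) - a) else 0) •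
        (inF K (gen K l) * (y a).coeff (2 * (a : ℤ) - 2 * (l : ℤ))) := by
    intro a
    rw [shiftSer, mul_assoc, coeff_wPow_mul, (coeff_piSer_mul _ _ _).2]
    refine finsum_congr fun l => ?_
    congr 3
    ring
  rw [locSum_apply (locFinite_F2m1Term q), finsum_congr hterm, Finset.sum_congr rfl fun a _ => hA a]
  exact finsum_sum_comm _ _ fun a _ => (coeff_piSer_mul _ (y a) (2 * (a : ℤ))).1

theorem shiftSer_succ {q t : K} (hq : q ≠ 0) (ht : t ≠ 0) (n : ℕ) :
    shiftSer q t (n + 1) = tildeHom q t (gen K n.succPNat) +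
      q ^ (n + 1) • (wPow K (-2 * ((n + 1 : ℕ) : ℤ)) * piSer (shiftCoeff q t)) := by
  have h : (fun k : ℕ+ => if n + 1 ≤ (k : ℕ) then structCoeff q⁻¹ t⁻¹ ((k : ℕ) - (n + 1)) else 0) =
      fun k => tildeCoeff q t n.succPNat k + q ^ (n + 1) * shiftCoeff q t k := by
    funext k
    exact ite_structCoeff_eq hq ht n.succPNat k
  rw [tildeHom_gen, Nat.succPNat_coe, Nat.succ_eq_add_one, shiftSer, h, ← piSer_add, ← smul_piSer,
    mul_add, mul_smul_comm]

omit [CharZero K] in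
-- There is no π_0, so the row a = 0 consists of the g_k with k ≥ 1. This is where the gap series,
-- and with it V_F in place of Ṽ_F, enters.
theorem shiftSer_zero {q t : K} (ht : t ≠ 0) :
    shiftSer q t 0 = piSer (shiftCoeff q t) - piSer (gapCoeff q t) := by
  have h : (fun k : ℕ+ => if 0 ≤ (k : ℕ) then structCoeff q⁻¹ t⁻¹ ((k : ℕ) - 0) else 0) =
      fun k : ℕ+ => structCoeff q⁻¹ t⁻¹ (k : ℕ) := by
    funext k
    rw [if_pos (Nat.zero_le _), Nat.sub_zero]
  rw [eq_sub_iff_add_eq, shiftSer, h, Nat.cast_zero, mul_zero, wPow_zero, one_mul, piSer_add]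
  congr 1
  funext k
  rw [structCoeff_eq ht, sub_add_cancel]

theorem locSum_E21Term_locSum_F2m1Term (q t : K) (v : Fock K) {N : ℕ}
    (hN : ∀ n, N ≤ n → cF q n v = 0) :
    locSum (E21Term q t) (locSum (F2m1Term q) v) =
      (∑ n ∈ Finset.range N, (q ^ (n + 1) • (wPow K (-2 * ((n + 1 : ℕ) : ℤ)) *
        tildeField q t (cF q (n + 1) v)) - tildeHom q t (gen K n.succPNat) *
          dSum q (tildeField q t) (cF q (n + 1) v))).coeff 0 := by
  rw [locSum_E21Term_apply, locSum_apply (locFinite_F2m1Term q),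
    finsum_pnat (N := N) fun k hk => by rw [F2m1Term_apply, hN k hk.le, mul_zero], map_sum]
  congr 1
  refine Finset.sum_congr rfl fun n _ => ?_
  rw [F2m1Term_apply, dSum_pi_mul q (tildeField_pi_mul q t _), Nat.succPNat_coe]

theorem acomm_locSum_E21Term_F2m1Term {q t : K} (hq : q ≠ 0) (ht : t ≠ 0) :
    acomm (locSum (E21Term q t)) (locSum (F2m1Term q)) =
      1 - contour q t (VFminus t) (VFplus q) 0 := by
  refine LinearMap.ext fun v => ?_
  obtain ⟨N, hN⟩ := cF_finite q v
  -- With N + 1 as bound, the sums over a ≥ 0 split into the term a = 0 and the terms a = n + 1 with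
  -- n < N, matching the index set of F_{2,-1}.
  have hN' : ∀ n, N + 1 ≤ n → cF q n v = 0 := fun n hn => hN n (by omega)
  have hFE : locSum (F2m1Term q) (locSum (E21Term q t) v) =
      (∑ n ∈ Finset.range N, shiftSer q t (n + 1) * dSum q (tildeField q t) (cF q (n + 1) v) +
        shiftSer q t 0 * dSum q (tildeField q t) v).coeff 0 := by
    rw [locSum_E21Term_apply, locSum_F2m1Term_coeff q t v hN', ← HahnSeries.coeff_sum,
      Finset.sum_range_succ', cF_zero]
  have h1 : _ = minusField q t v := sum_vertex_cF q t hq (tildeHom q t) v hN'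
  have h2 := sum_dSum_cF q t hq v hN'
  rw [Finset.sum_range_succ', cF_zero, pow_zero, one_smul, Nat.cast_zero, mul_zero, wPow_zero,
    one_mul] at h1 h2
  obtain ⟨p, hp, hp0⟩ := exists_psL_minusField hq ht v
  have hv : v = (minusField q t v + piSer (shiftCoeff q t) * dSum q (minusField q t) v).coeff 0 := by
    rw [← hp]
    exact hp0.symm.trans (coeff_psL_natCast p 0).symm
  have h3 : ∀ n : ℕ, piSer (shiftCoeff q t) * (wPow K (-2 * ((n + 1 : ℕ) : ℤ)) *
      dSum q (tildeField q t) (cF q (n + 1) v)) = wPow K (-2 * ((n + 1 : ℕ) : ℤ)) *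
        piSer (shiftCoeff q t) * dSum q (tildeField q t) (cF q (n + 1) v) := fun n => by
    rw [← mul_assoc, ← wPow_comm]
  -- The identity holds for the whole Laurent series, before any coefficient is taken: the terms
  -- with `tildeHom` cancel, the field terms miss only a = 0 and give T⁻ - T, and the shift terms
  -- sum to S D⁻, leaving -G D from the row a = 0.
  have key : ∑ n ∈ Finset.range N, (q ^ (n + 1) • (wPow K (-2 * ((n + 1 : ℕ) : ℤ)) *
        tildeField q t (cF q (n + 1) v)) - tildeHom q t (gen K n.succPNat) *
          dSum q (tildeField q t) (cF q (n + 1) v)) +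
      (∑ n ∈ Finset.range N, shiftSer q t (n + 1) * dSum q (tildeField q t) (cF q (n + 1) v) +
        shiftSer q t 0 * dSum q (tildeField q t) v) =
      minusField q t v + piSer (shiftCoeff q t) * dSum q (minusField q t) v - fullField q t v := by
    rw [fullField_apply hq ht, ← h1, ← h2, shiftSer_zero ht, mul_add, Finset.mul_sum, sub_mul]
    simp only [shiftSer_succ hq ht, Finset.sum_sub_distrib, add_mul, Finset.sum_add_distrib,
      smul_mul_assoc, mul_smul_comm, h3]
    simp only [tildeField]
    abel
  rw [acomm, LinearMap.add_apply, Module.End.mul_apply, Module.End.mul_apply,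
    locSum_E21Term_locSum_F2m1Term q t v hN, hFE, LinearMap.sub_apply, Module.End.one_apply,
    contour_full, neg_zero, ← HahnSeries.coeff_add, key, HahnSeries.coeff_sub, ← hv]

end Anticommutators

/-! ### Restoring the normalisation by u and the square root. -/

section Rescaling

variable {K A : Type*} [Field K] [Ring A] [Algebra K A]

theorem acomm_smul (u : K) {X Y Z : A} (h : acomm X Y = Z) : acomm X (u • Y) = u • Z := by
  rw [← h, acomm, acomm, mul_smul_comm, smul_mul_assoc, smul_add]

/-- The minus signs in E_{2,1} and F_{2,-1} cancel each other, while the one in H_{2,+1} turns 1 - Z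
into the stated 1 + u⁻¹ s⁻¹ H. -/
theorem acomm_smul_neg {u s : K} (hu : u ≠ 0) (hs : s ≠ 0) {X Y Z : A}
    (h : acomm X Y = 1 - Z) :
    acomm ((u * s) • -X) (-Y) = (s * u) • (1 + (u⁻¹ * s⁻¹) • -((u * s) • Z)) := by
  rw [acomm] at h
  rw [acomm, smul_mul_assoc, mul_smul_comm, neg_mul_neg, neg_mul_neg, ← smul_add, h, smul_neg,
    smul_smul, ← sub_eq_add_neg, mul_comm s u, show u⁻¹ * s⁻¹ * (u * s) = 1 by field_simp,
    one_smul]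

end Rescaling

end SuperMacdonald

end

/-- All infinite sums in the formulas are locally finite, and the two anticommutators are the
positive Hamiltonians. The element `s` is a square root of `t / q`. -/
theorem proposition1p4 {K : Type*} [Field K] [CharZero K] (q t u s : K)
    (hq : q ≠ 0) (ht : t ≠ 0) (hu : u ≠ 0) (hs : s ^ 2 = t / q) :
    ((∀ r : ℤ, SuperMacdonald.LocFinite (SuperMacdonald.contourTerm q t
        (SuperMacdonald.VFtildeMinus t) (SuperMacdonald.VFtildePlus q) r)) ∧
      (∀ r : ℤ, SuperMacdonald.LocFinite (SuperMacdonald.contourTerm q t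
        (SuperMacdonald.VFminus t) (SuperMacdonald.VFplus q) r)) ∧
      SuperMacdonald.LocFinite (SuperMacdonald.F2m1Term q) ∧
      SuperMacdonald.LocFinite (SuperMacdonald.E21Term q t) ∧
      SuperMacdonald.LocFinite (SuperMacdonald.F12Term q t)) ∧
    SuperMacdonald.acomm (SuperMacdonald.E21 q t u s) (SuperMacdonald.F2m1 q) =
      (s * u) • (1 + (u⁻¹ * s⁻¹) • SuperMacdonald.H21 q t u s) ∧
    SuperMacdonald.acomm (SuperMacdonald.E10 K) (SuperMacdonald.F12 q t u) =
      SuperMacdonald.H11 q t u := by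
  have hs0 : s ≠ 0 := by
    rintro rfl
    rw [zero_pow two_ne_zero] at hs
    exact div_ne_zero ht hq hs.symm
  refine ⟨⟨SuperMacdonald.locFinite_contour_tilde q t, SuperMacdonald.locFinite_contour_full q t,
    SuperMacdonald.locFinite_F2m1Term q, SuperMacdonald.locFinite_E21Term q t,
    SuperMacdonald.locFinite_F12Term q t⟩, ?_, ?_⟩
  · exact SuperMacdonald.acomm_smul_neg hu hs0 (SuperMacdonald.acomm_locSum_E21Term_F2m1Term hq ht)
  · exact SuperMacdonald.acomm_smul u (SuperMacdonald.acomm_piOp_one_locSum_F12Term hq t)
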